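/- Work in two-sorted first-order logic over the language $\mathcal L^2_A=\{0,1,+,\cdot,|\ |;=_1,=_2,\le,\in\}$ of bounded arithmetic (numbers, and strings, i.e. finite sets of numbers; $|X|$ is the length of $X$, and $X(i)$ means $i\in X$). The theory $\mathbf{V\#L}$ is axiomatized by the basic axioms 2-BASIC for the symbols of the language together with * $\Sigma^B_0$-COMP: $\exists Y\,(|Y|\le y\wedge\forall x<y\,(Y(x)\leftrightarrow\varphi(x)))$ for every formula $\varphi$ all of whose quantifiers are bounded number quantifiers and in which $Y$ is not free; * String Multiplication: $\forall X,Y\,\exists Z\,(Z=X\cdot Y)$ for natural numbers written in binary; * Matrix Powering: $\forall X\,\forall t\,\exists Y\,(Y=X^t)$ for square matrices $X$ of binary integers and numbers $t$. Here $Z=X\cdot Y$ is expressed by the existence of a string coding the partial sums of the school method, and $Y=X^t$ by the existence of a string coding the sequence $X^0,\dots,X^t$ of powers (with the sums in the matrix products given by strings of partial sums). $\mathbf{V\#L}$ proves a formula if the formula is a logical consequence of these axioms. In $\mathbf{V\#L}$ the Pfaffian of a skew symmetric $2m\times2m$ integer matrix ($m\ge1$) is defined by the following Berkowitz-type algorithm.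 Let $J$ be the block diagonal matrix with diagonal blocks $\begin{pmatrix}0&1\\-1&0\end{pmatrix}$. For a skew symmetric $2d\times 2d$ matrix $$C=\begin{pmatrix}0&c_{12}&R\\-c_{12}&0&-{}^tS\\-{}^tR&S&M\end{pmatrix}$$ let $P_C$ be the $(d+1)\times d$ lower triangular Toeplitz matrix with first column $(1,\ c_{12},\ RJS,\ RJ(MJ)S,\ \dots,\ RJ(MJ)^{d-2}S)$. The coefficient vector $\bar p_C=(p_d,\dots,p_0)$ is $(1,c_{12})$ if $d=1$ and $\bar p_C=P_C\,\bar p_M$ if $d>1$; and $\mathrm{pf}(A)=p_0$ is the last entry of $\bar p_A$. **Theorem.** $\mathbf{V\#L}$ proves: for all numbers $n,k$ with $1\le k<2n$, if $I[k]$ denotes the $2n\times 2n$ identity matrix with rows $k$ and $k+1$ swapped, then the $4n\times4n$ matrix below exists, its Pfaffian is defined, and $$\mathrm{pf}\begin{pmatrix}0&I[k]\\-I[k]&0\end{pmatrix}=(-1)^{n+1}.$$ -/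

import Mathlib

universe u

namespace BoundedArith

/-! ## Two-sorted first-order logic over the language of bounded arithmetic

The language has a number sort and a string sort (strings are finite sets of numbers), the symbols
`0, 1, +, ·, ≤` on numbers, the length `|X|` of a string, membership `t ∈ X` (also written `X(t)`),
and equality on both sorts. Variables of each sort are named by natural numbers. -/

/-- Number terms. The only string terms are string variables. -/
inductive NumTerm : Type
  | var (x : ℕ)
  | zero
  | one
  | add (s t : NumTerm)
  | mul (s t : NumTerm)
  | len (X : ℕ)

/-- Formulas of two-sorted first-order logic. -/
inductive Formula : Type
  | eqNum (s t : NumTerm)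
  | eqStr (X Y : ℕ)
  | le (s t : NumTerm)
  | mem (t : NumTerm) (X : ℕ)
  | neg (φ : Formula)
  | and (φ ψ : Formula)
  | or (φ ψ : Formula)
  | allNum (x : ℕ) (φ : Formula)
  | exNum (x : ℕ) (φ : Formula)
  | allStr (X : ℕ) (φ : Formula)
  | exStr (X : ℕ) (φ : Formula)

/-- Structures for the language. The number sort is inhabited by `zero`. -/
structure TwoSorted : Type (u + 1) where
  Num : Type u
  Str : Type u
  str_nonempty : Nonempty Str
  zero : Num
  one : Num
  add : Num → Num → Num
  mul : Num → Num → Num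
  len : Str → Num
  le : Num → Num → Prop
  mem : Num → Str → Prop

/-- The value of a number term under an assignment `v`, `w` of the two sorts of variables. -/
def NumTerm.eval (M : TwoSorted.{u}) (v : ℕ → M.Num) (w : ℕ → M.Str) : NumTerm → M.Num
  | .var x => v x
  | .zero => M.zero
  | .one => M.one
  | .add s t => M.add (s.eval M v w) (t.eval M v w)
  | .mul s t => M.mul (s.eval M v w) (t.eval M v w)
  | .len X => M.len (w X)

/-- Tarski's truth definition. -/
def Formula.Sat (M : TwoSorted.{u}) : Formula → (ℕ → M.Num) → (ℕ → M.Str) → Prop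
  | .eqNum s t, v, w => s.eval M v w = t.eval M v w
  | .eqStr X Y, _, w => w X = w Y
  | .le s t, v, w => M.le (s.eval M v w) (t.eval M v w)
  | .mem t X, v, w => M.mem (t.eval M v w) (w X)
  | .neg φ, v, w => ¬ φ.Sat M v w
  | .and φ ψ, v, w => φ.Sat M v w ∧ ψ.Sat M v w
  | .or φ ψ, v, w => φ.Sat M v w ∨ ψ.Sat M v w
  | .allNum x φ, v, w => ∀ a : M.Num, φ.Sat M (Function.update v x a) w
  | .exNum x φ, v, w => ∃ a : M.Num, φ.Sat M (Function.update v x a) w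
  | .allStr X φ, v, w => ∀ A : M.Str, φ.Sat M v (Function.update w X A)
  | .exStr X φ, v, w => ∃ A : M.Str, φ.Sat M v (Function.update w X A)

/-- A formula is valid in `M` if it holds under all assignments (that is, its universal closure
holds). -/
def Formula.ValidIn (φ : Formula) (M : TwoSorted.{u}) : Prop :=
  ∀ (v : ℕ → M.Num) (w : ℕ → M.Str), φ.Sat M v w

/-- `T ⊢ φ`: `φ` belongs to the theory axiomatized by `T`, i.e. it is a logical consequence of `T`
(by the completeness theorem this is the same as having a formal proof from `T`). -/
def Proves (T : Set Formula) (φ : Formula) : Prop :=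
  ∀ M : TwoSorted.{u}, (∀ ψ ∈ T, ψ.ValidIn M) → φ.ValidIn M

/-! ### The class of bounded formulas without string quantifiers -/

/-- The number variable `x` occurs in the term. -/
def NumTerm.HasVar (x : ℕ) : NumTerm → Prop
  | .var y => y = x
  | .zero => False
  | .one => False
  | .add s t => s.HasVar x ∨ t.HasVar x
  | .mul s t => s.HasVar x ∨ t.HasVar x
  | .len _ => False

/-- The string variable `X` occurs in the term. -/
def NumTerm.HasStr (X : ℕ) : NumTerm → Prop
  | .var _ => False
  | .zero => False
  | .one => False
  | .add s t => s.HasStr X ∨ t.HasStr X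
  | .mul s t => s.HasStr X ∨ t.HasStr X
  | .len Y => Y = X

/-- The string variable `X` occurs free in the formula. -/
def Formula.FreeStr (X : ℕ) : Formula → Prop
  | .eqNum s t => s.HasStr X ∨ t.HasStr X
  | .eqStr Y Z => Y = X ∨ Z = X
  | .le s t => s.HasStr X ∨ t.HasStr X
  | .mem t Y => t.HasStr X ∨ Y = X
  | .neg φ => φ.FreeStr X
  | .and φ ψ => φ.FreeStr X ∨ ψ.FreeStr X
  | .or φ ψ => φ.FreeStr X ∨ ψ.FreeStr X
  | .allNum _ φ => φ.FreeStr X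
  | .exNum _ φ => φ.FreeStr X
  | .allStr Y φ => Y ≠ X ∧ φ.FreeStr X
  | .exStr Y φ => Y ≠ X ∧ φ.FreeStr X

/-- `φ → ψ`. -/
def Formula.imp (φ ψ : Formula) : Formula := .or (.neg φ) ψ

/-- `φ ↔ ψ`. -/
def Formula.iff (φ ψ : Formula) : Formula := .and (φ.imp ψ) (ψ.imp φ)

/-- `s < t`, that is, `s ≤ t` and `s ≠ t`. -/
def Formula.lt (s t : NumTerm) : Formula := .and (.le s t) (.neg (.eqNum s t))

/-- The formulas in which every quantifier is a bounded number quantifier `∀ x ≤ t` or `∃ x ≤ t`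
(with `x` not occurring in `t`); string variables may occur, but are not quantified. -/
inductive IsSigmaB0 : Formula → Prop
  | eqNum (s t : NumTerm) : IsSigmaB0 (.eqNum s t)
  | eqStr (X Y : ℕ) : IsSigmaB0 (.eqStr X Y)
  | le (s t : NumTerm) : IsSigmaB0 (.le s t)
  | mem (t : NumTerm) (X : ℕ) : IsSigmaB0 (.mem t X)
  | neg {φ : Formula} : IsSigmaB0 φ → IsSigmaB0 (.neg φ)
  | and {φ ψ : Formula} : IsSigmaB0 φ → IsSigmaB0 ψ → IsSigmaB0 (.and φ ψ)
  | or {φ ψ : Formula} : IsSigmaB0 φ → IsSigmaB0 ψ → IsSigmaB0 (.or φ ψ)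
  | allLe {x : ℕ} {t : NumTerm} {φ : Formula} : ¬ t.HasVar x → IsSigmaB0 φ →
      IsSigmaB0 (.allNum x (Formula.imp (.le (.var x) t) φ))
  | exLe {x : ℕ} {t : NumTerm} {φ : Formula} : ¬ t.HasVar x → IsSigmaB0 φ →
      IsSigmaB0 (.exNum x (.and (.le (.var x) t) φ))

/-- The comprehension axiom `∃ Y (|Y| ≤ y ∧ ∀ x < y (Y(x) ↔ φ))`. -/
def comprehension (x y Y : ℕ) (φ : Formula) : Formula :=
  .exStr Y (.and (.le (.len Y) (.var y))
    (.allNum x (Formula.imp (Formula.lt (.var x) (.var y)) (Formula.iff (.mem (.var x) Y) φ))))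

/-! ### Writing formulas with Lean binders

A `Form` is a formula scheme that receives the first unused names `a`, `b` of a number variable and
of a string variable; a quantifier takes the first unused name, so no variable is ever captured.
A closed `Form` becomes a formula by starting with the names `0`, `0`. -/

/-- Formulas that receive the first unused variable names. -/
abbrev Form : Type := ℕ → ℕ → Formula

namespace Form

def eq (s t : NumTerm) : Form := fun _ _ => .eqNum s t
def eqS (X Y : ℕ) : Form := fun _ _ => .eqStr X Y
def le (s t : NumTerm) : Form := fun _ _ => .le s t
def lt (s t : NumTerm) : Form := fun _ _ => Formula.lt s t
def mem (t : NumTerm) (X : ℕ) : Form := fun _ _ => .mem t X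
def not (p : Form) : Form := fun a b => .neg (p a b)
def and (p q : Form) : Form := fun a b => .and (p a b) (q a b)
def or (p q : Form) : Form := fun a b => .or (p a b) (q a b)
def imp (p q : Form) : Form := fun a b => Formula.imp (p a b) (q a b)
def iff (p q : Form) : Form := fun a b => Formula.iff (p a b) (q a b)

end Form

/-- `∀ x`, for a number variable. -/
def allN (f : NumTerm → Form) : Form := fun a b => .allNum a (f (.var a) (a + 1) b)
/-- `∃ x`, for a number variable. -/
def exN (f : NumTerm → Form) : Form := fun a b => .exNum a (f (.var a) (a + 1) b)
/-- `∀ X`, for a string variable. -/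
def allS (f : ℕ → Form) : Form := fun a b => .allStr b (f b a (b + 1))
/-- `∃ X`, for a string variable. -/
def exS (f : ℕ → Form) : Form := fun a b => .exStr b (f b a (b + 1))

/-- The formula denoted by a closed `Form`. -/
def Form.close (p : Form) : Formula := p 0 0

instance : Zero NumTerm := ⟨.zero⟩
instance : One NumTerm := ⟨.one⟩
instance : Add NumTerm := ⟨.add⟩
instance : Mul NumTerm := ⟨.mul⟩
instance : OfNat NumTerm 2 := ⟨.add .one .one⟩

infix:50 " =ₒ " => Form.eq
infix:50 " ≤ₒ " => Form.le
infix:50 " <ₒ " => Form.lt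
infix:50 " ∈ₒ " => Form.mem
prefix:max "¬ₒ" => Form.not
infixr:35 " ∧ₒ " => Form.and
infixr:30 " ∨ₒ " => Form.or
infixr:25 " →ₒ " => Form.imp
infix:20 " ↔ₒ " => Form.iff

/-! ### Basic axioms -/

/-- The axioms 2-BASIC: B1–B12, L1, L2 and extensionality for strings. -/
def basicAxioms : Set Formula :=
  { (allN fun x => ¬ₒ(x + 1 =ₒ 0)).close,
    (allN fun x => allN fun y => x + 1 =ₒ y + 1 →ₒ x =ₒ y).close,
    (allN fun x => x + 0 =ₒ x).close,
    (allN fun x => allN fun y => x + (y + 1) =ₒ (x + y) + 1).close,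
    (allN fun x => x * 0 =ₒ 0).close,
    (allN fun x => allN fun y => x * (y + 1) =ₒ x * y + x).close,
    (allN fun x => allN fun y => (x ≤ₒ y ∧ₒ y ≤ₒ x) →ₒ x =ₒ y).close,
    (allN fun x => allN fun y => x ≤ₒ x + y).close,
    (allN fun x => 0 ≤ₒ x).close,
    (allN fun x => allN fun y => x ≤ₒ y ∨ₒ y ≤ₒ x).close,
    (allN fun x => allN fun y => x ≤ₒ y ↔ₒ x <ₒ y + 1).close,
    (allN fun x => ¬ₒ(x =ₒ 0) →ₒ exN fun y => y ≤ₒ x ∧ₒ y + 1 =ₒ x).close,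
    (allS fun X => allN fun y => y ∈ₒ X →ₒ y <ₒ .len X).close,
    (allS fun X => allN fun y => y + 1 =ₒ .len X →ₒ y ∈ₒ X).close,
    (allS fun X => allS fun Y =>
      (NumTerm.len X =ₒ .len Y ∧ₒ allN fun i => i <ₒ .len X →ₒ (i ∈ₒ X ↔ₒ i ∈ₒ Y)) →ₒ
        Form.eqS X Y).close }

/-! ### Binary arithmetic on strings

`Bits` is a string given by its bits: a formula with one distinguished number argument. `Vec` and
`Mat` are vectors and matrices of such strings. All indices of vectors and matrices start at `1`. -/

abbrev Bits : Type := NumTerm → Form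
abbrev Vec : Type := NumTerm → Bits
abbrev Mat : Type := NumTerm → NumTerm → Bits

/-- The pairing function `⟨s, t⟩ = (s + t)(s + t + 1) + 2 t`. -/
def pair (s t : NumTerm) : NumTerm := (s + t) * (s + t + 1) + 2 * t

/-- The string `X` itself. -/
def str (X : ℕ) : Bits := fun b => b ∈ₒ X
/-- The `i`-th row `X^[i]` of the string `X`. -/
def row (X : ℕ) : Vec := fun i b => pair i b ∈ₒ X
/-- The matrix coded by the string `X`; its entry `(i, j)` has the bits `X(⟨⟨i, j⟩, b⟩)`. -/
def mat (X : ℕ) : Mat := fun i j b => pair (pair i j) b ∈ₒ X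
/-- The `s`-th matrix in the sequence of matrices coded by the string `X`. -/
def matSeq (X : ℕ) (s : NumTerm) : Mat := fun i j b => pair (pair (pair s i) j) b ∈ₒ X

/-- The bits agree. -/
def same (P Q : Bits) : Form := allN fun b => P b ↔ₒ Q b

/-- The number with binary digits `P` is positive (some digit is `1`). -/
def nonzero (P : Bits) : Form := exN fun b => P b

def xor (p q : Form) : Form := (p ∧ₒ ¬ₒq) ∨ₒ (¬ₒp ∧ₒ q)

/-- The carry into position `i` when the natural numbers `P` and `Q` are added in binary. -/
def carry (P Q : Bits) (i : NumTerm) : Form :=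
  exN fun k => k <ₒ i ∧ₒ P k ∧ₒ Q k ∧ₒ allN fun j => (k <ₒ j ∧ₒ j <ₒ i) →ₒ (P j ∨ₒ Q j)

/-- `P + Q = R` for natural numbers in binary. -/
def natAdd (P Q R : Bits) : Form :=
  allN fun i => R i ↔ₒ xor (xor (P i) (Q i)) (carry P Q i)

/-- `2 ^ i · P`. -/
def shift (P : Bits) (i : NumTerm) : Bits := fun b => exN fun c => b =ₒ i + c ∧ₒ P c

/-- The zero string; it represents the natural number and the integer `0`. -/
def zeroBits : Bits := fun _ => ¬ₒ(Form.eq 0 0)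

/-- `P · Q = R` for natural numbers in binary, by the school method: the partial sums
`W^[i] = ∑_{j < i} Q(j) · 2 ^ j · P` form a string `W`, and `R = W^[l]`, where `Q` has no digits from
position `l` on. -/
def natMul (P Q R : Bits) : Form :=
  exS fun W => exN fun l =>
    (allN fun i => l ≤ₒ i →ₒ ¬ₒ(Q i)) ∧ₒ
    same (row W 0) zeroBits ∧ₒ
    (allN fun i => i <ₒ l →ₒ natAdd (row W i) (fun b => Q i ∧ₒ shift P i b) (row W (i + 1))) ∧ₒ
    same R (row W l)

/-! ### Integers

An integer is a string whose bit `0` is the sign (`1` for negative), and whose bits `1, 2, …` are the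
binary digits of the absolute value; the sign of `0` is positive. -/

/-- The absolute value. -/
def mag (P : Bits) : Bits := fun b => P (b + 1)

/-- `P` represents an integer (there is no negative zero). -/
def isInt (P : Bits) : Form := P 0 →ₒ nonzero (mag P)

/-- The integer `1`. -/
def oneBits : Bits := fun b => b =ₒ 1

/-- The integer `(-1) ^ e`. -/
def negOnePow (e : NumTerm) : Bits := fun b =>
  b =ₒ 1 ∨ₒ (b =ₒ 0 ∧ₒ exN fun h => e =ₒ 2 * h + 1)

/-- The integer `-P`. -/
def negBits (P : Bits) : Bits := fun b =>
  (b =ₒ 0 ∧ₒ ¬ₒ(P 0) ∧ₒ nonzero (mag P)) ∨ₒ (¬ₒ(b =ₒ 0) ∧ₒ P b)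

/-- `P + Q = R` for integers. -/
def intAdd (P Q R : Bits) : Form :=
  isInt R ∧ₒ
    (((P 0 ↔ₒ Q 0) ∧ₒ (R 0 ↔ₒ P 0) ∧ₒ natAdd (mag P) (mag Q) (mag R)) ∨ₒ
      (¬ₒ(P 0 ↔ₒ Q 0) ∧ₒ
        (((R 0 ↔ₒ P 0) ∧ₒ natAdd (mag R) (mag Q) (mag P)) ∨ₒ
          ((R 0 ↔ₒ Q 0) ∧ₒ natAdd (mag R) (mag P) (mag Q)))))

/-- `P · Q = R` for integers. -/
def intMul (P Q R : Bits) : Form :=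
  isInt R ∧ₒ natMul (mag P) (mag Q) (mag R) ∧ₒ
    (nonzero (mag R) →ₒ (R 0 ↔ₒ xor (P 0) (Q 0)))

/-! ### Integer matrices -/

/-- `1 ≤ i ≤ l`. -/
def inRange (i l : NumTerm) : Form := 1 ≤ₒ i ∧ₒ i ≤ₒ l

/-- `R = ∑_{1 ≤ r ≤ l} x_r · y_r`, with a string `T` of partial sums. -/
def dot (l : NumTerm) (x y : Vec) (R : Bits) : Form :=
  exS fun T =>
    same (row T 0) zeroBits ∧ₒ
    (allN fun r => r <ₒ l →ₒ exS fun U =>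
      intMul (x (r + 1)) (y (r + 1)) (str U) ∧ₒ intAdd (row T r) (str U) (row T (r + 1))) ∧ₒ
    same R (row T l)

/-- `X Y = Z` for an `a × b` matrix `X`, a `b × c` matrix `Y` and an `a × c` matrix `Z`. -/
def matMul (a b c : NumTerm) (X Y Z : Mat) : Form :=
  allN fun i => allN fun j => (inRange i a ∧ₒ inRange j c) →ₒ
    dot b (fun r => X i r) (fun r => Y r j) (Z i j)

/-- The `a × b` matrices `X` and `Y` are equal. -/
def sameMat (a b : NumTerm) (X Y : Mat) : Form :=
  allN fun i => allN fun j => (inRange i a ∧ₒ inRange j b) →ₒ same (X i j) (Y i j)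

/-- All entries of the `a × b` matrix `X` represent integers. -/
def isIntMat (a b : NumTerm) (X : Mat) : Form :=
  allN fun i => allN fun j => (inRange i a ∧ₒ inRange j b) →ₒ isInt (X i j)

/-- The identity matrix. -/
def idMat : Mat := fun i j b => i =ₒ j ∧ₒ oneBits b

/-- `Y = X ^ t` for `m × m` matrices, with a string `W` coding the sequence of powers
`X ^ 0, …, X ^ t`. -/
def matPow (m : NumTerm) (X : Mat) (t : NumTerm) (Y : Mat) : Form :=
  exS fun W =>
    sameMat m m (matSeq W 0) idMat ∧ₒ
    (allN fun s => s <ₒ t →ₒ matMul m m m (matSeq W s) X (matSeq W (s + 1))) ∧ₒ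
    sameMat m m Y (matSeq W t)

/-! ### The theory V#L -/

/-- String multiplication: `∀ X, Y ∃ Z (Z = X · Y)`. -/
def stringMultiplication : Formula :=
  (allS fun X => allS fun Y => exS fun Z => natMul (str X) (str Y) (str Z)).close

/-- Matrix powering: `∀ X ∀ t ∃ Y (Y = X ^ t)`, for `m × m` integer matrices `X`. -/
def matrixPowering : Formula :=
  (allN fun m => allN fun t => allS fun X => isIntMat m m (mat X) →ₒ
    exS fun Y => matPow m (mat X) t (mat Y)).close

/-- The theory V#L. -/
def VSharpL : Set Formula :=
  basicAxioms ∪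
  {ψ | ∃ (x y Y : ℕ) (φ : Formula), x ≠ y ∧ IsSigmaB0 φ ∧ ¬ φ.FreeStr Y ∧
    ψ = comprehension x y Y φ} ∪
  {stringMultiplication, matrixPowering}

/-! ### The Pfaffian in V#L, by the Berkowitz-type algorithm -/

/-- The matrix `J`, block diagonal with blocks `(0 1; -1 0)`. -/
def matJ : Mat := fun i j b =>
  (exN fun h => i =ₒ 2 * h + 1 ∧ₒ j =ₒ 2 * h + 2 ∧ₒ oneBits b) ∨ₒ
  (exN fun h => i =ₒ 2 * h + 2 ∧ₒ j =ₒ 2 * h + 1 ∧ₒ negBits oneBits b)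

/-- The matrix obtained by removing the first `p` rows and columns. -/
def minor (p : NumTerm) (A : Mat) : Mat := fun i j => A (p + i) (p + j)

/-- `Z = R J (M J) ^ t S`, for the block decomposition
`C = (0, c₁₂, R; -c₁₂, 0, -Sᵀ; -Rᵀ, S, M)` where `M` is `e × e`. -/
def berkowitzEntry (e : NumTerm) (C : Mat) (t : NumTerm) (Z : Bits) : Form :=
  exS fun MJ => exS fun G => exS fun RJ => exS fun V =>
    matMul e e e (minor 2 C) matJ (mat MJ) ∧ₒ
    matPow e (mat MJ) t (mat G) ∧ₒ
    matMul 1 e e (fun _ j => C 1 (2 + j)) matJ (mat RJ) ∧ₒ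
    matMul 1 e e (mat RJ) (mat G) (mat V) ∧ₒ
    matMul 1 e 1 (mat V) (fun i _ => C (2 + i) 2) (fun _ _ => Z)

/-- `P` is the `(d + 1) × d` matrix `P_C` of the algorithm for the `2d × 2d` matrix `C`: it is lower
triangular Toeplitz, with first column `1, c₁₂, R J S, R J (M J) S, …, R J (M J) ^ (d - 2) S`. -/
def berkowitzMat (d : NumTerm) (C P : Mat) : Form :=
  allN fun i => allN fun j => (inRange i (d + 1) ∧ₒ inRange j d) →ₒ
    ((i <ₒ j →ₒ same (P i j) zeroBits) ∧ₒ
     (i =ₒ j →ₒ same (P i j) oneBits) ∧ₒ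
     (i =ₒ j + 1 →ₒ same (P i j) (C 1 2)) ∧ₒ
     (allN fun t => allN fun e => (i =ₒ j + 2 + t ∧ₒ e + 2 =ₒ 2 * d) →ₒ
        berkowitzEntry e C t (P i j)))

/-- `Z` is the Pfaffian of the `2m × 2m` skew symmetric matrix `A` (`m ≥ 1`). The string `Q` codes
the Pfaffian coefficients: its row `s` is the coefficient vector `(p_d, …, p_0)` (`d = m - s`) of
the matrix `C_s` that is left of `A` without the first `2s` rows and columns. It is `(1, a₁₂)` for a
`2 × 2` matrix, and the product of `P_{C_s}` with the coefficient vector of `C_{s+1}` otherwise.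
The Pfaffian is the last coefficient of `C_0 = A`. -/
def pfaffian (m : NumTerm) (A : Mat) (Z : Bits) : Form :=
  exS fun Q =>
    (allN fun s => s + 1 =ₒ m →ₒ
      (same (mat Q s 1) oneBits ∧ₒ same (mat Q s 2) (minor (2 * s) A 1 2))) ∧ₒ
    (allN fun s => allN fun d => (s + d =ₒ m ∧ₒ 2 ≤ₒ d) →ₒ
      exS fun P =>
        berkowitzMat d (minor (2 * s) A) (mat P) ∧ₒ
        matMul (d + 1) d 1 (mat P) (fun i _ => mat Q (s + 1) i) (fun i _ => mat Q s i)) ∧ₒ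
    same Z (mat Q 0 (m + 1))

/-! ### The claim -/

/-- The matrix `I[k]`: the identity matrix with the rows `k` and `k + 1` swapped. -/
def swapMat (k : NumTerm) : Mat := fun i j b =>
  (i =ₒ k ∧ₒ idMat (k + 1) j b) ∨ₒ
  (i =ₒ k + 1 ∧ₒ idMat k j b) ∨ₒ
  (¬ₒ(i =ₒ k) ∧ₒ ¬ₒ(i =ₒ k + 1) ∧ₒ idMat i j b)

/-- The block matrix `(0 X; Y 0)` with blocks of size `N × N`. -/
def antidiagBlock (N : NumTerm) (X Y : Mat) : Mat := fun i j b =>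
  (exN fun h => i ≤ₒ N ∧ₒ 1 ≤ₒ h ∧ₒ j =ₒ N + h ∧ₒ X i h b) ∨ₒ
  (exN fun h => j ≤ₒ N ∧ₒ 1 ≤ₒ h ∧ₒ i =ₒ N + h ∧ₒ Y h j b)

/-- The matrix `(0 I[k]; -I[k] 0)` of size `4n × 4n`. -/
def blockSwap (n k : NumTerm) : Mat :=
  antidiagBlock (2 * n) (swapMat k) (fun i j => negBits (swapMat k i j))

/-- The sentence: for all `n`, `k` with `1 ≤ k < 2n`, the matrix `(0 I[k]; -I[k] 0)` exists (as a
string), its Pfaffian is defined, and the Pfaffian is `(-1) ^ (n + 1)`. -/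
def pfaffianBlockSwap : Formula :=
  (allN fun n => allN fun k => (1 ≤ₒ k ∧ₒ k <ₒ 2 * n) →ₒ
    ((exS fun A => sameMat (2 * (2 * n)) (2 * (2 * n)) (mat A) (blockSwap n k)) ∧ₒ
     (allS fun A => sameMat (2 * (2 * n)) (2 * (2 * n)) (mat A) (blockSwap n k) →ₒ
        ((exS fun Z => pfaffian (2 * n) (mat A) (str Z)) ∧ₒ
         (allS fun Z => pfaffian (2 * n) (mat A) (str Z) →ₒ
            same (str Z) (negOnePow (n + 1))))))).close

end BoundedArith

/-!
The formula has to be evaluated in an arbitrary model of `V#L`. The numbers of such a model form a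
discretely ordered semiring with induction for `Σ₀ᴮ`-definable predicates.

Every row and every column of the block matrix has exactly one nonzero entry, which is `±1`.
Hence in a product `R J (M J) ^ t S` only the path through the nonzero entries contributes, and this
path ends after at most two steps of `M J`. So the Berkowitz matrix of the `s`-th minor has ones on
its diagonal and at most one further nonzero subdiagonal, with constant entry `±1`, at distance `2`
from the diagonal, or `4` if `k = 2 s + 2`. The coefficient vectors of the last `n` minors are
`(1, 0, …, 0)`. From there on, each step of the recursion moves the last nonzero coefficient by the
distance of that subdiagonal and multiplies it by its entry, or leaves it alone if the subdiagonal
vanishes. In the end it stands in the last position and has the value `(-1) ^ (n + 1)`.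

The recursion has `2 n` steps, and Matrix Powering alone has to provide the string of all its
coefficient vectors. It is applied to a single block matrix with the transposed Berkowitz matrices
of all minors next to the diagonal: the first rows of its powers contain the coefficient vectors.
-/

namespace BoundedArith.TwoSorted

variable {M : TwoSorted.{u}}

instance : Zero M.Num := ⟨M.zero⟩
instance : One M.Num := ⟨M.one⟩
instance : Add M.Num := ⟨M.add⟩
instance : Mul M.Num := ⟨M.mul⟩
instance : LE M.Num := ⟨M.le⟩
instance : LT M.Num := ⟨fun a b => M.le a b ∧ ¬ a = b⟩
instance : Membership M.Num M.Str := ⟨fun X a => M.mem a X⟩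

section Definability

variable {n : ℕ}

/-- Functions of `n` numbers given by a number term with parameters. -/
class inductive IsTermFun : ((Fin n → M.Num) → M.Num) → Prop
  | const (c : M.Num) : IsTermFun fun _ => c
  | proj (i : Fin n) : IsTermFun fun z => z i
  | add {f g : (Fin n → M.Num) → M.Num} (hf : IsTermFun f) (hg : IsTermFun g) :
    IsTermFun fun z => f z + g z
  | mul {f g : (Fin n → M.Num) → M.Num} (hf : IsTermFun f) (hg : IsTermFun g) :
    IsTermFun fun z => f z * g z

namespace IsTermFun

variable {f g : (Fin n → M.Num) → M.Num}

attribute [instance] const proj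

instance [hf : IsTermFun f] [hg : IsTermFun g] : IsTermFun fun z => f z + g z := hf.add hg

instance [hf : IsTermFun f] [hg : IsTermFun g] : IsTermFun fun z => f z * g z := hf.mul hg

theorem comp (hf : IsTermFun f) {m : ℕ} (g : Fin n → (Fin m → M.Num) → M.Num)
    [hg : ∀ i, IsTermFun (g i)] : IsTermFun fun z => f fun i => g i z := by
  induction hf with
  | const => infer_instance
  | proj i => exact hg i
  | add _ _ hf hf' => exact hf.add hf'
  | mul _ _ hf hf' => exact hf.mul hf'

-- Lets instance search see terms in the scope of a quantifier whose variable they do not mention.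
instance reindex {m : ℕ} (e : Fin n → Fin m) [hf : IsTermFun f] :
    IsTermFun fun z => f fun i => z (e i) :=
  hf.comp fun i z => z (e i)

end IsTermFun

/-- Predicates on `n` numbers given by a `Σ₀ᴮ` formula with number and string parameters. -/
class inductive IsDefinable : {n : ℕ} → ((Fin n → M.Num) → Prop) → Prop
  | eq {n : ℕ} (f g : (Fin n → M.Num) → M.Num) [IsTermFun f] [IsTermFun g] :
    IsDefinable fun z => f z = g z
  | le {n : ℕ} (f g : (Fin n → M.Num) → M.Num) [IsTermFun f] [IsTermFun g] :
    IsDefinable fun z => f z ≤ g z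
  | mem {n : ℕ} (f : (Fin n → M.Num) → M.Num) [IsTermFun f] (X : M.Str) :
    IsDefinable fun z => f z ∈ X
  | not {n : ℕ} {p : (Fin n → M.Num) → Prop} (hp : IsDefinable p) : IsDefinable fun z => ¬p z
  | and {n : ℕ} {p q : (Fin n → M.Num) → Prop} (hp : IsDefinable p) (hq : IsDefinable q) :
    IsDefinable fun z => p z ∧ q z
  | forall_le {n : ℕ} (t : (Fin n → M.Num) → M.Num) {p : (Fin n → M.Num) → M.Num → Prop}
    [IsTermFun t]
    (hp : IsDefinable fun z : Fin (n + 1) → M.Num => p (fun i => z i.castSucc) (z (Fin.last n))) :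
    IsDefinable fun z => ∀ a ≤ t z, p z a

namespace IsDefinable

variable {f g : (Fin n → M.Num) → M.Num} {p q : (Fin n → M.Num) → Prop}

attribute [instance] eq le mem

instance [hp : IsDefinable p] : IsDefinable fun z => ¬p z := hp.not

instance [hp : IsDefinable p] [hq : IsDefinable q] : IsDefinable fun z => p z ∧ q z := hp.and hq

instance {p : (Fin n → M.Num) → M.Num → Prop} [IsTermFun f]
    [hp : IsDefinable fun z : Fin (n + 1) → M.Num => p (fun i => z i.castSucc) (z (Fin.last n))] :
    IsDefinable fun z => ∀ a ≤ f z, p z a := hp.forall_le f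

theorem comp (hp : IsDefinable p) {m : ℕ} (g : Fin n → (Fin m → M.Num) → M.Num)
    [∀ i, IsTermFun (g i)] : IsDefinable fun z => p fun i => g i z := by
  induction hp generalizing m with
  | @eq n f f' hf hf' =>
    have := hf.comp g
    have := hf'.comp g
    infer_instance
  | @le n f f' hf hf' =>
    have := hf.comp g
    have := hf'.comp g
    infer_instance
  | @mem n f hf X =>
    have := hf.comp g
    infer_instance
  | not _ hp => exact (hp g).not
  | and _ _ hp hq => exact (hp g).and (hq g)
  | @forall_le n f p hf _ hp =>
    have := hf.comp g
    let g' : Fin (n + 1) → (Fin (m + 1) → M.Num) → M.Num :=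
      Fin.snoc (fun i z => g i fun j => z j.castSucc) fun z => z (Fin.last m)
    have : ∀ i, IsTermFun (g' i) :=
      Fin.lastCases (by simp only [g', Fin.snoc_last]; infer_instance)
        fun i => by simp only [g', Fin.snoc_castSucc]; infer_instance
    refine .forall_le (fun z => f fun i => g i z) ?_
    simpa only [g', Fin.snoc_castSucc, Fin.snoc_last] using hp g'

theorem congr (hp : IsDefinable p) (h : ∀ z, p z ↔ q z) : IsDefinable q := by
  rwa [show q = p from funext fun z => propext (h z).symm]

instance [IsDefinable p] [IsDefinable q] : IsDefinable fun z => p z ∨ q z :=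
  congr (p := fun z => ¬(¬p z ∧ ¬q z)) inferInstance fun _ => or_iff_not_and_not.symm

instance [IsDefinable p] [IsDefinable q] : IsDefinable fun z => p z → q z :=
  congr (p := fun z => ¬p z ∨ q z) inferInstance fun _ => imp_iff_not_or.symm

instance [IsDefinable p] [IsDefinable q] : IsDefinable fun z => p z ↔ q z :=
  congr (p := fun z => (p z → q z) ∧ (q z → p z)) inferInstance fun _ => iff_def.symm

instance [IsTermFun f] [IsTermFun g] : IsDefinable fun z => f z < g z :=
  congr (p := fun z => f z ≤ g z ∧ ¬f z = g z) inferInstance fun _ => Iff.rfl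

instance {p : (Fin n → M.Num) → M.Num → Prop} [IsTermFun f]
    [IsDefinable fun z : Fin (n + 1) → M.Num => p (fun i => z i.castSucc) (z (Fin.last n))] :
    IsDefinable fun z => ∃ a ≤ f z, p z a :=
  congr (p := fun z => ¬∀ a ≤ f z, ¬p z a) inferInstance fun z => by
    simp only [not_forall, not_not, exists_prop]

instance (p : Prop) : IsDefinable fun _ : Fin n → M.Num => p := by
  by_cases hp : p
  · exact congr (p := fun _ => M.zero = M.zero) inferInstance fun _ => by simp [hp]
  · exact congr (p := fun _ => ¬M.zero = M.zero) inferInstance fun _ => by simp [hp]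

end IsDefinable

/-- The assignment `v` interprets the variables with even names by the entries of `z` and those with
odd names by the parameters `param`. -/
def Interprets (param : ℕ → M.Num) (z : Fin n → M.Num) (v : ℕ → M.Num) : Prop :=
  (∀ i : Fin n, v (2 * i) = z i) ∧ ∀ i, v (2 * i + 1) = param i

theorem Interprets.snoc {param : ℕ → M.Num} {z : Fin n → M.Num} {v : ℕ → M.Num}
    (h : Interprets param z v) (a : M.Num) :
    Interprets param (Fin.snoc z a : Fin (n + 1) → M.Num) (Function.update v (2 * n) a) := by
  refine ⟨fun i => ?_, fun i => ?_⟩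
  · refine Fin.lastCases (by simp) (fun i => ?_) i
    rw [Fin.snoc_castSucc, Fin.val_castSucc, Function.update_of_ne (by omega), h.1]
  · rw [Function.update_of_ne (by omega), h.2]

/-- The term `t` defines the function `f` when its variables are interpreted with `Interprets`. -/
structure Defines (param : ℕ → M.Num) (t : NumTerm) (f : (Fin n → M.Num) → M.Num) : Prop where
  not_hasVar : ∀ i, n ≤ i → ¬t.HasVar (2 * i)
  not_hasStr : ∀ X, ¬t.HasStr X
  eval_eq : ∀ z v w, Interprets param z v → t.eval M v w = f z

-- The term is uniform in the enumeration of the parameters, so that terms can be combined.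
theorem IsTermFun.exists_defines (f : (Fin n → M.Num) → M.Num) [hf : IsTermFun f] :
    ∃ S : List M.Num, ∀ param : ℕ → M.Num, (∀ c ∈ S, ∃ i, param i = c) →
      ∃ t, Defines param t f := by
  induction hf with
  | const c =>
    refine ⟨[c], fun param h => ?_⟩
    obtain ⟨i, hi⟩ := h c (by simp)
    refine ⟨.var (2 * i + 1), fun j _ => ?_, fun X => id, fun z v w hv => ?_⟩
    · simp only [NumTerm.HasVar]; omega
    · simp [NumTerm.eval, hv.2, hi]
  | proj i =>
    exact ⟨[], fun _ _ => ⟨.var (2 * i), fun j hj => by simp only [NumTerm.HasVar]; omega,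
      fun _ => id, fun _ _ _ hv => hv.1 i⟩⟩
  | add _ _ hf hg | mul _ _ hf hg =>
    obtain ⟨S, hf⟩ := hf
    obtain ⟨S', hg⟩ := hg
    refine ⟨S ++ S', fun param h => ?_⟩
    obtain ⟨s, hs⟩ := hf param fun c hc => h c (by simp [hc])
    obtain ⟨t, ht⟩ := hg param fun c hc => h c (by simp [hc])
    first
    | exact ⟨.add s t, fun i hi => not_or.2 ⟨hs.1 i hi, ht.1 i hi⟩,
        fun X => not_or.2 ⟨hs.2 X, ht.2 X⟩, fun z v w hv =>
          congrArg₂ M.add (hs.3 z v w hv) (ht.3 z v w hv)⟩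
    | exact ⟨.mul s t, fun i hi => not_or.2 ⟨hs.1 i hi, ht.1 i hi⟩,
        fun X => not_or.2 ⟨hs.2 X, ht.2 X⟩, fun z v w hv =>
          congrArg₂ M.mul (hs.3 z v w hv) (ht.3 z v w hv)⟩

theorem eval_update_of_not_hasVar {x : ℕ} {v : ℕ → M.Num} {w : ℕ → M.Str} (a : M.Num)
    {t : NumTerm} (ht : ¬ t.HasVar x) :
    t.eval M (Function.update v x a) w = t.eval M v w := by
  induction t with
  | var y => exact Function.update_of_ne ht _ _
  | zero | one | len X => rfl
  | add s t hs ht' | mul s t hs ht' =>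
    obtain ⟨h, h'⟩ := not_or.1 ht
    simp only [NumTerm.eval, hs h, ht' h']

/-- Predicates on `n` numbers defined by a `Σ₀ᴮ` formula, uniformly in the enumerations of the
parameters. The string variable `0` is kept free for the string defined by a comprehension axiom. -/
def HasFormula (p : (Fin n → M.Num) → Prop) : Prop :=
  ∃ (S : List M.Num) (L : List M.Str), ∀ (param : ℕ → M.Num) (paramS : ℕ → M.Str),
    (∀ c ∈ S, ∃ i, param i = c) → (∀ C ∈ L, ∃ i, paramS i = C) →
    ∃ φ : Formula, IsSigmaB0 φ ∧ ¬φ.FreeStr 0 ∧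
      ∀ z v w, Interprets param z v → (∀ i, w (i + 1) = paramS i) → (φ.Sat M v w ↔ p z)

namespace HasFormula

variable {p q : (Fin n → M.Num) → Prop}

theorem of_terms (f g : (Fin n → M.Num) → M.Num) [IsTermFun f] [IsTermFun g]
    (rel : NumTerm → NumTerm → Formula) (relM : M.Num → M.Num → Prop)
    (isSigmaB0_rel : ∀ s t, IsSigmaB0 (rel s t))
    (freeStr_rel : ∀ s t X, (rel s t).FreeStr X ↔ s.HasStr X ∨ t.HasStr X)
    (sat_rel : ∀ s t v w, (rel s t).Sat M v w ↔ relM (s.eval M v w) (t.eval M v w)) :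
    HasFormula fun z => relM (f z) (g z) := by
  obtain ⟨S, hf⟩ := IsTermFun.exists_defines f
  obtain ⟨S', hg⟩ := IsTermFun.exists_defines g
  refine ⟨S ++ S', [], fun param _ h _ => ?_⟩
  obtain ⟨s, hs⟩ := hf param fun c hc => h c (by simp [hc])
  obtain ⟨t, ht⟩ := hg param fun c hc => h c (by simp [hc])
  refine ⟨rel s t, isSigmaB0_rel s t, ?_, fun z v w hv _ => ?_⟩
  · rw [freeStr_rel, not_or]; exact ⟨hs.not_hasStr 0, ht.not_hasStr 0⟩
  · rw [sat_rel, hs.eval_eq z v w hv, ht.eval_eq z v w hv]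

theorem mem (f : (Fin n → M.Num) → M.Num) [IsTermFun f] (X : M.Str) :
    HasFormula fun z => f z ∈ X := by
  obtain ⟨S, hf⟩ := IsTermFun.exists_defines f
  refine ⟨S, [X], fun param paramS h h' => ?_⟩
  obtain ⟨t, ht⟩ := hf param h
  obtain ⟨i, rfl⟩ := h' X (by simp)
  refine ⟨.mem t (i + 1), .mem _ _, by simp [Formula.FreeStr, ht.not_hasStr],
    fun z v w hv hw => ?_⟩
  rw [Formula.Sat, ht.eval_eq z v w hv, hw]; rfl

theorem not (hp : HasFormula p) : HasFormula fun z => ¬p z := by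
  obtain ⟨S, L, hp⟩ := hp
  refine ⟨S, L, fun param paramS h h' => ?_⟩
  obtain ⟨φ, φ_sigma, φ_str, sat_φ⟩ := hp param paramS h h'
  exact ⟨.neg φ, .neg φ_sigma, φ_str, fun z v w hv hw => not_congr (sat_φ z v w hv hw)⟩

theorem and (hp : HasFormula p) (hq : HasFormula q) : HasFormula fun z => p z ∧ q z := by
  obtain ⟨S, L, hp⟩ := hp
  obtain ⟨S', L', hq⟩ := hq
  refine ⟨S ++ S', L ++ L', fun param paramS h h' => ?_⟩
  obtain ⟨φ, φ_sigma, φ_str, sat_φ⟩ :=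
    hp param paramS (fun c hc => h c (by simp [hc])) fun C hC => h' C (by simp [hC])
  obtain ⟨ψ, ψ_sigma, ψ_str, sat_ψ⟩ :=
    hq param paramS (fun c hc => h c (by simp [hc])) fun C hC => h' C (by simp [hC])
  exact ⟨.and φ ψ, .and φ_sigma ψ_sigma, not_or.2 ⟨φ_str, ψ_str⟩,
    fun z v w hv hw => and_congr (sat_φ z v w hv hw) (sat_ψ z v w hv hw)⟩

theorem forall_le (f : (Fin n → M.Num) → M.Num) [IsTermFun f]
    {p : (Fin n → M.Num) → M.Num → Prop}
    (hp : HasFormula fun z : Fin (n + 1) → M.Num => p (fun i => z i.castSucc) (z (Fin.last n))) :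
    HasFormula fun z => ∀ a ≤ f z, p z a := by
  obtain ⟨S, hf⟩ := IsTermFun.exists_defines f
  obtain ⟨S', L, hp⟩ := hp
  refine ⟨S ++ S', L, fun param paramS h h' => ?_⟩
  obtain ⟨t, ht⟩ := hf param fun c hc => h c (by simp [hc])
  obtain ⟨φ, φ_sigma, φ_str, sat_φ⟩ := hp param paramS (fun c hc => h c (by simp [hc])) h'
  refine ⟨_, .allLe (ht.not_hasVar n le_rfl) φ_sigma, ?_,
    fun z v w hv hw => forall_congr' fun a => ?_⟩
  · simp [Formula.FreeStr, Formula.imp, NumTerm.HasStr, ht.not_hasStr, φ_str]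
  · have sat_φ := sat_φ (Fin.snoc z a : Fin (n + 1) → M.Num) _ w (hv.snoc a) hw
    simp only [Fin.snoc_castSucc, Fin.snoc_last] at sat_φ
    refine imp_iff_not_or.symm.trans (imp_congr ?_ sat_φ)
    simp only [Formula.Sat, eval_update_of_not_hasVar a (ht.not_hasVar n le_rfl),
      ht.eval_eq z v w hv, NumTerm.eval, Function.update_self]
    rfl

end HasFormula

theorem IsDefinable.hasFormula {p : (Fin n → M.Num) → Prop} (hp : IsDefinable p) :
    HasFormula p := by
  induction hp with
  | eq f g => exact .of_terms f g .eqNum (· = ·) .eqNum (fun _ _ _ => .rfl) fun _ _ _ _ => .rfl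
  | le f g => exact .of_terms f g .le M.le .le (fun _ _ _ => .rfl) fun _ _ _ _ => .rfl
  | mem f X => exact .mem f X
  | not _ hp => exact hp.not
  | and _ _ hp hq => exact hp.and hq
  | forall_le f _ hp => exact .forall_le f hp

end Definability

/-- Models of V#L. -/
class VSharpLModel (M : TwoSorted.{u}) : Prop where
  validIn : ∀ ψ ∈ VSharpL, ψ.ValidIn M

section

variable [VSharpLModel M]

theorem comprehension (p : M.Num → Prop) [hp : IsDefinable fun z : Fin 1 → M.Num => p (z 0)]
    (y : M.Num) : ∃ Y : M.Str, M.len Y ≤ y ∧ ∀ x < y, x ∈ Y ↔ p x := by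
  obtain ⟨S, L, hp⟩ := hp.hasFormula
  obtain ⟨X₀⟩ := M.str_nonempty
  obtain ⟨φ, φ_sigma, φ_str, sat_φ⟩ := hp (S.getD · 0) (L.getD · X₀)
    (fun c hc => by obtain ⟨i, hi, rfl⟩ := List.getElem_of_mem hc; exact ⟨i, by simp [hi]⟩)
    (fun C hC => by obtain ⟨i, hi, rfl⟩ := List.getElem_of_mem hC; exact ⟨i, by simp [hi]⟩)
  obtain ⟨Y, hY, h⟩ := VSharpLModel.validIn (BoundedArith.comprehension 0 2 0 φ)
    (Or.inl (Or.inr ⟨0, 2, 0, φ, by decide, φ_sigma, φ_str, rfl⟩))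
    (fun i => if i = 2 then y else S.getD (i / 2) 0) (fun i => L.getD (i - 1) X₀)
  refine ⟨Y, hY, fun x hx => ?_⟩
  have mem_iff := (h x).resolve_left (not_not.2 hx)
  simp only [Formula.iff, Formula.imp, Formula.Sat, ← imp_iff_not_or, ← iff_def] at mem_iff
  refine Iff.trans Iff.rfl (mem_iff.trans (sat_φ (fun _ => x) _ _ ⟨fun i => ?_, fun i => ?_⟩ ?_))
  · simp
  · rw [Function.update_of_ne (by omega), if_neg (by omega)]
    congr 1; omega
  · intro i
    rw [Function.update_of_ne (by omega)]; rfl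

instance : Nonempty M.Str := M.str_nonempty

theorem sat_of_mem_basicAxioms {ψ : Formula} (h : ψ ∈ basicAxioms) :
    ψ.Sat M (fun _ => 0) (fun _ => Classical.arbitrary _) :=
  VSharpLModel.validIn ψ (Or.inl (Or.inl h)) _ _

theorem Str.lt_len_of_mem {X : M.Str} {y : M.Num} (h : y ∈ X) : y < M.len X :=
  (sat_of_mem_basicAxioms (M := M)
    (ψ := (allS fun X => allN fun y => y ∈ₒ X →ₒ y <ₒ .len X).close)
    (by simp [basicAxioms]) X y).resolve_left (not_not.2 h)

theorem Str.mem_of_add_one_eq_len {X : M.Str} {y : M.Num} (h : y + 1 = M.len X) : y ∈ X :=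
  (sat_of_mem_basicAxioms (M := M)
    (ψ := (allS fun X => allN fun y => y + 1 =ₒ .len X →ₒ y ∈ₒ X).close)
    (by simp [basicAxioms]) X y).resolve_left (not_not.2 h)

namespace Num

protected theorem add_one_ne_zero (x : M.Num) : x + 1 ≠ 0 :=
  sat_of_mem_basicAxioms (M := M) (ψ := (allN fun x => ¬ₒ(x + 1 =ₒ 0)).close)
    (by simp [basicAxioms]) x

protected theorem add_one_inj {x y : M.Num} (h : x + 1 = y + 1) : x = y :=
  (sat_of_mem_basicAxioms (M := M)
    (ψ := (allN fun x => allN fun y => x + 1 =ₒ y + 1 →ₒ x =ₒ y).close)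
    (by simp [basicAxioms]) x y).resolve_left (not_not.2 h)

protected theorem add_zero (x : M.Num) : x + 0 = x :=
  sat_of_mem_basicAxioms (M := M) (ψ := (allN fun x => x + 0 =ₒ x).close)
    (by simp [basicAxioms]) x

protected theorem add_add_one (x y : M.Num) : x + (y + 1) = x + y + 1 :=
  sat_of_mem_basicAxioms (M := M)
    (ψ := (allN fun x => allN fun y => x + (y + 1) =ₒ (x + y) + 1).close)
    (by simp [basicAxioms]) x y

protected theorem mul_zero (x : M.Num) : x * 0 = 0 :=
  sat_of_mem_basicAxioms (M := M) (ψ := (allN fun x => x * 0 =ₒ 0).close)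
    (by simp [basicAxioms]) x

protected theorem mul_add_one (x y : M.Num) : x * (y + 1) = x * y + x :=
  sat_of_mem_basicAxioms (M := M)
    (ψ := (allN fun x => allN fun y => x * (y + 1) =ₒ x * y + x).close)
    (by simp [basicAxioms]) x y

protected theorem le_antisymm {x y : M.Num} (h : x ≤ y) (h' : y ≤ x) : x = y :=
  (sat_of_mem_basicAxioms (M := M)
    (ψ := (allN fun x => allN fun y => (x ≤ₒ y ∧ₒ y ≤ₒ x) →ₒ x =ₒ y).close)
    (by simp [basicAxioms]) x y).resolve_left (not_not.2 ⟨h, h'⟩)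

protected theorem le_add_right (x y : M.Num) : x ≤ x + y :=
  sat_of_mem_basicAxioms (M := M) (ψ := (allN fun x => allN fun y => x ≤ₒ x + y).close)
    (by simp [basicAxioms]) x y

protected theorem zero_le (x : M.Num) : 0 ≤ x :=
  sat_of_mem_basicAxioms (M := M) (ψ := (allN fun x => 0 ≤ₒ x).close)
    (by simp [basicAxioms]) x

protected theorem le_total (x y : M.Num) : x ≤ y ∨ y ≤ x :=
  sat_of_mem_basicAxioms (M := M) (ψ := (allN fun x => allN fun y => x ≤ₒ y ∨ₒ y ≤ₒ x).close)
    (by simp [basicAxioms]) x y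

protected theorem le_iff_lt_add_one {x y : M.Num} : x ≤ y ↔ x < y + 1 :=
  have h := sat_of_mem_basicAxioms (M := M)
    (ψ := (allN fun x => allN fun y => x ≤ₒ y ↔ₒ x <ₒ y + 1).close)
    (by simp [basicAxioms]) x y
  ⟨fun hxy => h.1.resolve_left (not_not.2 hxy), fun hxy => h.2.resolve_left (not_not.2 hxy)⟩

protected theorem exists_add_one_eq {x : M.Num} (h : x ≠ 0) : ∃ y, y + 1 = x :=
  have ⟨y, _, hy⟩ := (sat_of_mem_basicAxioms (M := M)
    (ψ := (allN fun x => ¬ₒ(x =ₒ 0) →ₒ exN fun y => y ≤ₒ x ∧ₒ y + 1 =ₒ x).close)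
    (by simp [basicAxioms]) x).resolve_left (not_not.2 h)
  ⟨y, hy⟩

protected theorem le_refl (x : M.Num) : x ≤ x := (Num.le_total x x).elim id id

protected theorem le_add_one_iff {x y : M.Num} : x ≤ y + 1 ↔ x ≤ y ∨ x = y + 1 := by
  by_cases h : x = y + 1
  · simp only [h, or_true, iff_true]; exact Num.le_refl _
  · simp only [h, or_false]
    exact ⟨fun h' => Num.le_iff_lt_add_one.2 ⟨h', h⟩, fun h' => (Num.le_iff_lt_add_one.1 h').1⟩

protected theorem add_one_le_of_lt {x y : M.Num} (h : x < y) : x + 1 ≤ y := by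
  rcases Num.le_total (x + 1) y with h' | h'
  · exact h'
  · by_cases heq : y = x + 1
    · rw [heq]; exact Num.le_refl _
    · exact absurd (Num.le_antisymm h.1 (Num.le_iff_lt_add_one.2 ⟨h', heq⟩)) h.2

protected theorem le_of_add_one_le {x y : M.Num} (h : x + 1 ≤ y) : x ≤ y := by
  rcases Num.le_total x y with h' | h'
  · exact h'
  · have hlt := Num.le_iff_lt_add_one.1 h'
    exact absurd (Num.le_antisymm hlt.1 h) hlt.2

theorem induction {p : M.Num → Prop}
    (definable : IsDefinable fun z : Fin 1 → M.Num => p (z 0))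
    (zero : p 0) (succ : ∀ x, p x → p (x + 1)) (y : M.Num) : p y := by
  obtain ⟨Y, len_Y, mem_Y⟩ := comprehension p (y + 1)
  have zero_mem : (0 : M.Num) ∈ Y := (mem_Y 0 (Num.le_iff_lt_add_one.1 (Num.zero_le y))).2 zero
  obtain ⟨x, hx⟩ : ∃ x, x + 1 = M.len Y := Num.exists_add_one_eq fun h =>
    (Str.lt_len_of_mem zero_mem).2 h.symm
  have x_lt : x < y + 1 := by
    rw [← hx] at len_Y
    rcases Num.le_add_one_iff.1 len_Y with h | h
    · exact Num.le_iff_lt_add_one.1 (Num.le_of_add_one_le h)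
    · rw [Num.add_one_inj h]; exact Num.le_iff_lt_add_one.1 (Num.le_refl _)
  have hp : p x := (mem_Y x x_lt).1 (Str.mem_of_add_one_eq_len hx)
  by_cases heq : x = y
  · exact heq ▸ hp
  · have hxy : x + 1 ≤ y := Num.add_one_le_of_lt ⟨Num.le_iff_lt_add_one.2 x_lt, heq⟩
    have add_one_mem : x + 1 ∈ Y := (mem_Y _ (Num.le_iff_lt_add_one.1 hxy)).2 (succ x hp)
    exact absurd hx (Str.lt_len_of_mem add_one_mem).2

protected theorem add_assoc (a b c : M.Num) : a + b + c = a + (b + c) := by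
  induction c using induction with
  | definable => infer_instance
  | zero => simp only [Num.add_zero]
  | succ c ih => simp only [Num.add_add_one, ih]

protected theorem zero_add (a : M.Num) : 0 + a = a := by
  induction a using induction with
  | definable => infer_instance
  | zero => exact Num.add_zero 0
  | succ a ih => rw [Num.add_add_one, ih]

protected theorem add_one_add (a b : M.Num) : a + 1 + b = a + b + 1 := by
  induction b using induction with
  | definable => infer_instance
  | zero => simp only [Num.add_zero]
  | succ b ih => simp only [Num.add_add_one, ih]

protected theorem add_comm (a b : M.Num) : a + b = b + a := by
  induction b using induction with
  | definable => infer_instance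
  | zero => rw [Num.add_zero, Num.zero_add]
  | succ b ih => rw [Num.add_add_one, Num.add_one_add, ih]

protected theorem zero_mul (a : M.Num) : 0 * a = 0 := by
  induction a using induction with
  | definable => infer_instance
  | zero => exact Num.mul_zero 0
  | succ a ih => rw [Num.mul_add_one, ih, Num.add_zero]

protected theorem add_one_mul (a b : M.Num) : (a + 1) * b = a * b + b := by
  induction b using induction with
  | definable => infer_instance
  | zero => simp only [Num.mul_zero, Num.add_zero]
  | succ b ih =>
    rw [Num.mul_add_one, ih, Num.mul_add_one, Num.add_assoc _ b, Num.add_assoc _ a,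
      Num.add_add_one b, Num.add_add_one a, Num.add_comm b]

protected theorem mul_comm (a b : M.Num) : a * b = b * a := by
  induction b using induction with
  | definable => infer_instance
  | zero => rw [Num.mul_zero, Num.zero_mul]
  | succ b ih => rw [Num.mul_add_one, Num.add_one_mul, ih]

protected theorem mul_add (a b c : M.Num) : a * (b + c) = a * b + a * c := by
  induction c using induction with
  | definable => infer_instance
  | zero => simp only [Num.mul_zero, Num.add_zero]
  | succ c ih => rw [Num.add_add_one, Num.mul_add_one, ih, Num.mul_add_one, Num.add_assoc]

protected theorem mul_assoc (a b c : M.Num) : a * b * c = a * (b * c) := by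
  induction c using induction with
  | definable => infer_instance
  | zero => simp only [Num.mul_zero]
  | succ c ih => rw [Num.mul_add_one, ih, Num.mul_add_one, Num.mul_add]

protected theorem one_mul (a : M.Num) : 1 * a = a := by
  rw [← Num.zero_add (1 : M.Num), Num.add_one_mul, Num.zero_mul, Num.zero_add]

/-- The embedding of the standard numbers, with `2` definitionally equal to `1 + 1`, the value of
the numeral `2` of the language. -/
protected def ofNat : ℕ → M.Num
  | 0 => 0
  | 1 => 1
  | n + 2 => Num.ofNat (n + 1) + 1

instance : CommSemiring M.Num where
  add_assoc := Num.add_assoc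
  zero_add := Num.zero_add
  add_zero := Num.add_zero
  add_comm := Num.add_comm
  left_distrib := Num.mul_add
  right_distrib a b c := by rw [Num.mul_comm, Num.mul_add, Num.mul_comm c a, Num.mul_comm c b]
  zero_mul := Num.zero_mul
  mul_zero := Num.mul_zero
  mul_assoc := Num.mul_assoc
  one_mul := Num.one_mul
  mul_one a := by rw [Num.mul_comm, Num.one_mul]
  mul_comm := Num.mul_comm
  nsmul := nsmulRec
  natCast := Num.ofNat
  natCast_zero := rfl
  natCast_succ
    | 0 => (Num.zero_add 1).symm
    | _ + 1 => rfl

protected theorem add_left_cancel {a b c : M.Num} (h : a + b = a + c) : b = c := by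
  induction a using induction with
  | definable => infer_instance
  | zero => simpa only [zero_add] using h
  | succ a ih => exact ih (Num.add_one_inj (by simpa only [Num.add_one_add] using h))

protected theorem exists_add_of_le {a b : M.Num} (h : a ≤ b) : ∃ c, b = a + c := by
  suffices ∃ c ≤ b, b = a + c from this.imp fun _ => And.right
  induction b using induction with
  | definable => infer_instance
  | zero => exact ⟨0, Num.le_refl _, by rw [add_zero]; exact Num.le_antisymm (Num.zero_le _) h⟩
  | succ b ih =>
    rcases Num.le_add_one_iff.1 h with h | rfl
    · obtain ⟨c, -, rfl⟩ := ih h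
      refine ⟨c + 1, ?_, add_assoc _ _ _⟩
      rw [add_assoc, add_comm a]
      exact Num.le_add_right _ _
    · exact ⟨0, Num.zero_le _, (add_zero (b + 1)).symm⟩

noncomputable instance : LinearOrder M.Num where
  le_refl := Num.le_refl
  le_trans a b c hab hbc := by
    obtain ⟨x, rfl⟩ := Num.exists_add_of_le hab
    obtain ⟨y, rfl⟩ := Num.exists_add_of_le hbc
    rw [add_assoc]; exact Num.le_add_right _ _
  le_antisymm _ _ := Num.le_antisymm
  le_total := Num.le_total
  lt_iff_le_not_ge _ _ := ⟨fun h => ⟨h.1, fun h' => h.2 (Num.le_antisymm h.1 h')⟩,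
    fun h => ⟨h.1, fun h' => h.2 (h' ▸ Num.le_refl _)⟩⟩
  toDecidableLE := Classical.decRel _

instance : CanonicallyOrderedAdd M.Num where
  exists_add_of_le := Num.exists_add_of_le
  le_add_self a b := by rw [add_comm]; exact Num.le_add_right _ _
  le_self_add := Num.le_add_right

instance : IsOrderedCancelAddMonoid M.Num where
  add_le_add_left a b h c := by
    obtain ⟨x, rfl⟩ := exists_add_of_le h
    rw [add_right_comm]; exact le_self_add
  le_of_add_le_add_left a b c h := by
    obtain ⟨x, hx⟩ := exists_add_of_le h
    rw [add_assoc] at hx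
    rw [Num.add_left_cancel hx]; exact le_self_add

instance : Nontrivial M.Num :=
  ⟨0, 1, fun h => Num.add_one_ne_zero (0 : M.Num) (by rw [zero_add, h])⟩

protected theorem add_one_le_iff {a b : M.Num} : a + 1 ≤ b ↔ a < b :=
  ⟨fun h => (Num.le_iff_lt_add_one.1 le_rfl).trans_le h, Num.add_one_le_of_lt⟩

protected theorem mul_lt_mul_left {a b c : M.Num} (hc : 0 < c) (hab : a < b) : c * a < c * b := by
  obtain ⟨d, rfl⟩ := exists_add_of_le (Num.add_one_le_iff.2 hab)
  rw [add_assoc, mul_add, mul_add, mul_one]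
  exact lt_add_of_pos_right _ (hc.trans_le le_self_add)

instance : IsStrictOrderedRing M.Num where
  mul_lt_mul_of_pos_left _ hc _ _ hab := Num.mul_lt_mul_left hc hab
  mul_lt_mul_of_pos_right c hc a b hab := by
    rw [mul_comm a, mul_comm b]; exact Num.mul_lt_mul_left hc hab

protected theorem lt_iff_add_one_le (a b : M.Num) : a < b ↔ a + 1 ≤ b :=
  Num.add_one_le_iff.symm

protected theorem add_one_le_of_not_le (a b : M.Num) (h : ¬a ≤ b) : b + 1 ≤ a :=
  Num.add_one_le_iff.2 (not_le.1 h)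

protected theorem add_two (a : M.Num) : a + 2 = a + 1 + 1 := by
  rw [add_assoc, one_add_one_eq_two]

protected theorem nonneg_and_nonneg (a b : M.Num) : 0 ≤ a ∧ 0 ≤ b ∧ (0 : M.Num) < 1 :=
  ⟨zero_le, zero_le, zero_lt_one⟩

-- These turn `grind` into a decision procedure for discrete linear arithmetic: its linear solver
-- knows neither that `M.Num` is nonnegative and discrete nor the values of numerals.
grind_pattern Num.nonneg_and_nonneg => a + b
grind_pattern Num.nonneg_and_nonneg => a ≤ b
grind_pattern Num.lt_iff_add_one_le => a < b
grind_pattern Num.add_one_le_of_not_le => a ≤ b where guard ¬a ≤ b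
grind_pattern two_mul => 2 * n
grind_pattern Num.add_two => a + 2

theorem exists_eq_two_mul_add {p : M.Num} (hp : 1 ≤ p) :
    ∃ h, p = 2 * h + 1 ∨ p = 2 * h + 2 := by
  suffices ∃ h ≤ p, p = 2 * h + 1 ∨ p = 2 * h + 2 from this.imp fun _ => And.right
  induction p using Num.induction with
  | definable => infer_instance
  | zero => exact absurd hp (by grind)
  | succ p ih =>
    rcases eq_or_ne p 0 with rfl | hp0
    · exact ⟨0, zero_le, by simp⟩
    · obtain ⟨h, hh, rfl | rfl⟩ := ih (by grind)
      · exact ⟨h, by grind, by grind⟩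
      · exact ⟨h + 1, by grind, by grind⟩

end Num

end

/-- The sequences of binary digits in `M`, coded by strings or not. Those of an integer start with
its sign. -/
abbrev Digits (M : TwoSorted.{u}) : Type u := M.Num → Prop

/-- The digit sequence of the natural number, and of the integer, `0`. -/
instance Digits.instZero : Zero M.Digits := ⟨fun _ => False⟩

theorem Digits.zero_eq : (0 : M.Digits) = fun _ => ¬(0 : M.Num) = 0 :=
  funext fun _ => not_true_eq_false.symm.trans (congrArg Not (eq_self _).symm)

theorem Digits.eq_iff {P Q : M.Digits} : P = Q ↔ ∀ b, (¬P b ∨ Q b) ∧ (¬Q b ∨ P b) := by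
  simp only [funext_iff, eq_iff_iff, iff_def, imp_iff_not_or]

theorem xor_iff_and_not_or_not_and {p q : Prop} : Xor p q ↔ p ∧ ¬q ∨ ¬p ∧ q :=
  or_congr_right and_comm

/-- The matrices of digit sequences in `M`, whose rows and columns are counted from `1`. -/
abbrev DigitMat (M : TwoSorted.{u}) : Type u := M.Num → M.Num → M.Digits

section

variable [VSharpLModel M]

/-- The pairing function of `M`. -/
def Num.pair (x y : M.Num) : M.Num := (x + y) * (x + y + 1) + 2 * y

namespace Str

/-- The digit sequence coded by a string. -/
def digits (X : M.Str) : M.Digits := fun b => b ∈ X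

/-- The sequence of digit sequences coded by a string. -/
def row (X : M.Str) (i : M.Num) : M.Digits := fun b => Num.pair i b ∈ X

/-- The matrix coded by a string. -/
def mat (X : M.Str) : M.DigitMat := fun i j b => Num.pair (Num.pair i j) b ∈ X

/-- The sequence of matrices coded by a string. -/
def matSeq (X : M.Str) (s : M.Num) : M.DigitMat :=
  fun i j b => Num.pair (Num.pair (Num.pair s i) j) b ∈ X

end Str

namespace Digits

/-- The digit sequence of the integer `1`. -/
instance : One M.Digits := ⟨fun b => b = 1⟩

/-- The digits of the absolute value of an integer. -/
def mag (P : M.Digits) : M.Digits := fun b => P (b + 1)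

/-- The negative of an integer; that of `0` has no sign. -/
instance : Neg M.Digits :=
  ⟨fun P b => b = 0 ∧ ¬P 0 ∧ (∃ c, P.mag c) ∨ ¬b = 0 ∧ P b⟩

/-- The digit sequence of the integer `(-1) ^ e`. -/
def negOnePow (e : M.Num) : M.Digits := fun b => b = 1 ∨ b = 0 ∧ ∃ h, e = 2 * h + 1

/-- The digit sequence of `2 ^ i * P`. -/
def shift (P : M.Digits) (i : M.Num) : M.Digits := fun b => ∃ c, b = i + c ∧ P c

/-- There is a carry into position `i` in the binary addition of `P` and `Q`. -/
def Carry (P Q : M.Digits) (i : M.Num) : Prop :=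
  ∃ k < i, P k ∧ Q k ∧ ∀ j, k < j ∧ j < i → P j ∨ Q j

/-- `P + Q = R` for natural numbers. -/
def IsNatAdd (P Q R : M.Digits) : Prop :=
  ∀ i, R i ↔ Xor (Xor (P i) (Q i)) (P.Carry Q i)

/-- `P * Q = R` for natural numbers, as witnessed by a string of partial sums. -/
def IsNatMul (P Q R : M.Digits) : Prop :=
  ∃ (W : M.Str) (l : M.Num), (∀ i, l ≤ i → ¬Q i) ∧ W.row 0 = 0 ∧
    (∀ i, i < l → IsNatAdd (W.row i) (fun b => Q i ∧ P.shift i b) (W.row (i + 1))) ∧ R = W.row l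

/-- A digit sequence represents an integer if it is not a negative zero. -/
def IsInt (P : M.Digits) : Prop := P 0 → ∃ c, P.mag c

/-- `P + Q = R` for integers. -/
def IsIntAdd (P Q R : M.Digits) : Prop :=
  R.IsInt ∧
    (((P 0 ↔ Q 0) ∧ (R 0 ↔ P 0) ∧ IsNatAdd P.mag Q.mag R.mag) ∨
      (¬(P 0 ↔ Q 0) ∧
        (((R 0 ↔ P 0) ∧ IsNatAdd R.mag Q.mag P.mag) ∨
          ((R 0 ↔ Q 0) ∧ IsNatAdd R.mag P.mag Q.mag))))

/-- `P * Q = R` for integers. -/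
def IsIntMul (P Q R : M.Digits) : Prop :=
  R.IsInt ∧ IsNatMul P.mag Q.mag R.mag ∧ ((∃ c, R.mag c) → (R 0 ↔ Xor (P 0) (Q 0)))

/-- `R` is the sum of the products `x r * y r` over `1 ≤ r ≤ l`, as witnessed by a string of partial
sums. -/
def IsDot (l : M.Num) (x y : M.Num → M.Digits) (R : M.Digits) : Prop :=
  ∃ T : M.Str, T.row 0 = 0 ∧
    (∀ r, r < l → ∃ U : M.Str, IsIntMul (x (r + 1)) (y (r + 1)) U.digits ∧
      IsIntAdd (T.row r) U.digits (T.row (r + 1))) ∧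
    R = T.row l

end Digits

namespace DigitMat

/-- The number `i` is one of the indices `1, …, l`. -/
def InRange (i l : M.Num) : Prop := 1 ≤ i ∧ i ≤ l

/-- The `a × b` matrices `X` and `Y` are equal. -/
def EqOn (a b : M.Num) (X Y : M.DigitMat) : Prop :=
  ∀ i j, InRange i a ∧ InRange j b → X i j = Y i j

/-- The entries of the `a × b` matrix `X` represent integers. -/
def IsIntOn (a b : M.Num) (X : M.DigitMat) : Prop :=
  ∀ i j, InRange i a ∧ InRange j b → (X i j).IsInt

/-- `X * Y = Z` for an `a × b` matrix `X`, a `b × c` matrix `Y` and an `a × c` matrix `Z`. -/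
def IsMul (a b c : M.Num) (X Y Z : M.DigitMat) : Prop :=
  ∀ i j, InRange i a ∧ InRange j c →
    Digits.IsDot b (fun r => X i r) (fun r => Y r j) (Z i j)

/-- The identity matrix. -/
def id : M.DigitMat := fun i j b => i = j ∧ (1 : M.Digits) b

/-- `Y = X ^ t` for `m × m` matrices, as witnessed by a string of powers. -/
def IsPow (m : M.Num) (X : M.DigitMat) (t : M.Num) (Y : M.DigitMat) : Prop :=
  ∃ W : M.Str, EqOn m m (W.matSeq 0) id ∧
    (∀ s, s < t → IsMul m m m (W.matSeq s) X (W.matSeq (s + 1))) ∧ EqOn m m Y (W.matSeq t)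

/-- The block diagonal matrix with the diagonal blocks `!![0, 1; -1, 0]`. -/
def J : M.DigitMat := fun i j b =>
  (∃ h, i = 2 * h + 1 ∧ j = 2 * h + 2 ∧ (1 : M.Digits) b) ∨
  (∃ h, i = 2 * h + 2 ∧ j = 2 * h + 1 ∧ (-1 : M.Digits) b)

/-- The matrix `A` without its first `p` rows and columns. -/
def minor (p : M.Num) (A : M.DigitMat) : M.DigitMat := fun i j => A (p + i) (p + j)

/-- `Z = R J (M J) ^ t S` for the block decomposition of a skew symmetric matrix `C` in which the
last block `M` is an `e × e` matrix. -/
def IsBerkowitzEntry (e : M.Num) (C : M.DigitMat) (t : M.Num) (Z : M.Digits) : Prop :=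
  ∃ MJ G RJ V : M.Str,
    IsMul e e e (minor 2 C) J MJ.mat ∧
    IsPow e MJ.mat t G.mat ∧
    IsMul 1 e e (fun _ j => C 1 (2 + j)) J RJ.mat ∧
    IsMul 1 e e RJ.mat G.mat V.mat ∧
    IsMul 1 e 1 V.mat (fun i _ => C (2 + i) 2) (fun _ _ => Z)

/-- `P` is the `(d + 1) × d` Toeplitz matrix `P_C` of the Berkowitz algorithm for the `2d × 2d`
matrix `C`. -/
def IsBerkowitzMat (d : M.Num) (C P : M.DigitMat) : Prop :=
  ∀ i j, InRange i (d + 1) ∧ InRange j d →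
    (i < j → P i j = 0) ∧ (i = j → P i j = 1) ∧ (i = j + 1 → P i j = C 1 2) ∧
      ∀ t e, i = j + 2 + t ∧ e + 2 = 2 * d → IsBerkowitzEntry e C t (P i j)

/-- `Z` is the Pfaffian of the `2m × 2m` matrix `A`, as witnessed by a string whose row `s` is the
coefficient vector of `A` without its first `2 * s` rows and columns. -/
def IsPfaffian (m : M.Num) (A : M.DigitMat) (Z : M.Digits) : Prop :=
  ∃ Q : M.Str,
    (∀ s, s + 1 = m → Q.mat s 1 = 1 ∧ Q.mat s 2 = minor (2 * s) A 1 2) ∧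
    (∀ s d, s + d = m ∧ 2 ≤ d →
      ∃ P : M.Str, IsBerkowitzMat d (minor (2 * s) A) P.mat ∧
        IsMul (d + 1) d 1 P.mat (fun i _ => Q.mat (s + 1) i) (fun i _ => Q.mat s i)) ∧
    Z = Q.mat 0 (m + 1)

/-- The identity matrix with the rows `k` and `k + 1` swapped. -/
def swap (k : M.Num) : M.DigitMat := fun i j b =>
  (i = k ∧ id (k + 1) j b) ∨ (i = k + 1 ∧ id k j b) ∨ (¬i = k ∧ ¬i = k + 1 ∧ id i j b)

/-- The block matrix `!![0, X; Y, 0]` with `N × N` blocks. -/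
def antidiag (N : M.Num) (X Y : M.DigitMat) : M.DigitMat := fun i j b =>
  (∃ h, i ≤ N ∧ 1 ≤ h ∧ j = N + h ∧ X i h b) ∨ (∃ h, j ≤ N ∧ 1 ≤ h ∧ i = N + h ∧ Y h j b)

/-- The `4n × 4n` matrix of the theorem. -/
def blockSwap (n k : M.Num) : M.DigitMat := antidiag (2 * n) (swap k) (fun i j => -swap k i j)

end DigitMat

open Digits DigitMat

-- The formulas only have the connectives ¬, ∧ and ∨; once → and ↔ are expressed by these, the two
-- sides agree definitionally.
set_option maxRecDepth 100000 in
theorem sat_matrixPowering (v : ℕ → M.Num) (w : ℕ → M.Str) :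
    matrixPowering.Sat M v w ↔
      ∀ (m t : M.Num) (X : M.Str), IsIntOn m m X.mat → ∃ Y : M.Str, IsPow m X.mat t Y.mat := by
  refine iff_of_eq ?_
  simp only [IsPow, IsMul, EqOn, IsIntOn, IsDot, IsIntMul, IsIntAdd, IsNatMul, IsNatAdd, Carry,
    IsInt, Digits.eq_iff, Digits.zero_eq, iff_def, imp_iff_not_or, xor_iff_and_not_or_not_and,
    -eq_self]
  rfl

set_option maxRecDepth 100000 in
theorem sat_pfaffianBlockSwap (v : ℕ → M.Num) (w : ℕ → M.Str) :
    pfaffianBlockSwap.Sat M v w ↔ ∀ n k : M.Num, 1 ≤ k ∧ k < 2 * n →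
      (∃ A : M.Str, EqOn (2 * (2 * n)) (2 * (2 * n)) A.mat (DigitMat.blockSwap n k)) ∧
      ∀ A : M.Str, EqOn (2 * (2 * n)) (2 * (2 * n)) A.mat (DigitMat.blockSwap n k) →
        (∃ Z : M.Str, IsPfaffian (2 * n) A.mat Z.digits) ∧
        ∀ Z : M.Str, IsPfaffian (2 * n) A.mat Z.digits → Z.digits = Digits.negOnePow (n + 1) := by
  refine iff_of_eq ?_
  simp only [IsPfaffian, IsBerkowitzMat, IsBerkowitzEntry, IsPow, IsMul, EqOn, IsDot,
    IsIntMul, IsIntAdd, IsNatMul, IsNatAdd, Carry,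
    IsInt, Digits.eq_iff, Digits.zero_eq, iff_def, imp_iff_not_or, xor_iff_and_not_or_not_and,
    -eq_self]
  rfl

end

/-- The binary relation `p` is definable. -/
abbrev IsDefinable₂ (p : M.Num → M.Num → Prop) : Prop :=
  IsDefinable fun z : Fin 2 → M.Num => p (z 0) (z 1)

/-- The ternary relation `p` is definable. -/
abbrev IsDefinable₃ (p : M.Num → M.Num → M.Num → Prop) : Prop :=
  IsDefinable fun z : Fin 3 → M.Num => p (z 0) (z 1) (z 2)

theorem IsDefinable₂.of_terms {p : M.Num → M.Num → Prop} (hp : IsDefinable₂ p) (n : ℕ)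
    (f g : (Fin n → M.Num) → M.Num) [IsTermFun f] [IsTermFun g] :
    IsDefinable fun z => p (f z) (g z) := by
  have : ∀ i, IsTermFun ((![f, g] : Fin 2 → (Fin n → M.Num) → M.Num) i) :=
    Fin.forall_fin_two.2 ⟨‹_›, ‹_›⟩
  exact hp.comp ![f, g]

theorem IsDefinable₃.of_terms {p : M.Num → M.Num → M.Num → Prop} (hp : IsDefinable₃ p) (n : ℕ)
    (f g h : (Fin n → M.Num) → M.Num) [IsTermFun f] [IsTermFun g] [IsTermFun h] :
    IsDefinable fun z => p (f z) (g z) (h z) := by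
  have : ∀ i, IsTermFun ((![f, g, h] : Fin 3 → (Fin n → M.Num) → M.Num) i) :=
    Fin.forall_fin_succ.2 ⟨‹_›, Fin.forall_fin_two.2 ⟨‹_›, ‹_›⟩⟩
  exact hp.comp ![f, g, h]

theorem IsDefinable.eq_of_le {n : ℕ} {P R : (Fin n → M.Num) → M.Digits} (L : M.Num)
    (hP : ∀ z b, P z b → b ≤ L) (hR : ∀ z b, R z b → b ≤ L)
    [IsDefinable fun z : Fin (n + 1) → M.Num => P (fun i => z i.castSucc) (z (Fin.last n))]
    [IsDefinable fun z : Fin (n + 1) → M.Num => R (fun i => z i.castSucc) (z (Fin.last n))] :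
    IsDefinable fun z => P z = R z :=
  .congr (p := fun z => ∀ b ≤ L, (P z b ↔ R z b)) inferInstance fun z =>
    ⟨fun h => funext fun b => propext ⟨fun hb => (h b (hP z b hb)).1 hb,
      fun hb => (h b (hR z b hb)).2 hb⟩, fun h b _ => iff_of_eq (congrFun h b)⟩

namespace Digits

/-- The digit sequence is that of a string. -/
def IsCoded (P : M.Digits) : Prop := ∃ X : M.Str, X.digits = P

theorem isCoded_digits (X : M.Str) : X.digits.IsCoded := ⟨X, rfl⟩

theorem ne_zero_iff {P : M.Digits} : P ≠ 0 ↔ ∃ b, P b := by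
  rw [Function.ne_iff]
  exact exists_congr fun b => ⟨fun h => by_contra fun hb => h (eq_false hb), fun hb h => h.mp hb⟩

theorem isInt_iff {P : M.Digits} : P.IsInt ↔ (P 0 → P.mag ≠ 0) := by
  rw [IsInt, ne_zero_iff]

theorem isInt_zero : (0 : M.Digits).IsInt := False.elim

theorem carry_comm (P Q : M.Digits) (i : M.Num) : Carry P Q i ↔ Carry Q P i := by
  simp only [Carry, or_comm, and_left_comm]

theorem isNatAdd_comm {P Q R : M.Digits} : IsNatAdd P Q R ↔ IsNatAdd Q P R := by
  simp only [IsNatAdd, carry_comm P Q, xor_comm (P _)]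

theorem isNatAdd_of_disjoint {P Q R : M.Digits} (h : ∀ b, ¬(P b ∧ Q b)) :
    IsNatAdd P Q R ↔ R = fun b => P b ∨ Q b := by
  have not_carry : ∀ i, ¬Carry P Q i := fun i ⟨k, _, hP, hQ, _⟩ => h k ⟨hP, hQ⟩
  simp only [IsNatAdd, not_carry, funext_iff, eq_iff_iff]
  refine forall_congr' fun b => ?_
  have := h b
  simp only [Xor]
  tauto

theorem isNatAdd_zero {P R : M.Digits} : IsNatAdd P 0 R ↔ R = P := by
  rw [isNatAdd_of_disjoint (Q := 0) fun _ => And.right]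
  exact Eq.congr_right (funext fun b => propext (or_iff_left _root_.id))

theorem isIntAdd_comm {P Q R : M.Digits} : IsIntAdd P Q R ↔ IsIntAdd Q P R := by
  unfold IsIntAdd
  rw [isNatAdd_comm (P := P.mag) (Q := Q.mag)]
  grind

/-- The product of an integer with the integer `0`, `1` or `-1`. -/
instance : SMul SignType M.Digits where
  smul
    | 0, _ => 0
    | 1, P => P
    | -1, P => -P

protected theorem zero_smul (P : M.Digits) : (0 : SignType) • P = 0 := rfl

protected theorem one_smul (P : M.Digits) : (1 : SignType) • P = P := rfl

protected theorem neg_one_smul (P : M.Digits) : (-1 : SignType) • P = -P := rfl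

theorem neg_apply {P : M.Digits} {b : M.Num} :
    (-P) b ↔ b = 0 ∧ ¬P 0 ∧ P.mag ≠ 0 ∨ b ≠ 0 ∧ P b := by
  rw [ne_zero_iff]; rfl

theorem neg_apply_zero {P : M.Digits} : (-P) 0 ↔ ¬P 0 ∧ P.mag ≠ 0 := by
  simp only [neg_apply, true_and, ne_eq, not_true_eq_false, false_and, or_false]

end Digits

variable [VSharpLModel M]

namespace Num

theorem add_le_pair (x y : M.Num) : x + y ≤ pair x y := by
  rw [pair, mul_add_one]
  exact le_add_self.trans le_self_add

theorem left_le_pair (x y : M.Num) : x ≤ pair x y := le_self_add.trans (add_le_pair x y)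

theorem right_le_pair (x y : M.Num) : y ≤ pair x y := le_add_self.trans (add_le_pair x y)

@[gcongr]
theorem pair_le_pair {x y x' y' : M.Num} (hx : x ≤ x') (hy : y ≤ y') : pair x y ≤ pair x' y' := by
  unfold pair; gcongr

theorem add_le_add_of_pair_le_pair {x y x' y' : M.Num} (h : pair x y ≤ pair x' y') :
    x + y ≤ x' + y' := by
  by_contra! lt
  have le : x' + y' + 1 ≤ x + y := Num.add_one_le_of_lt lt
  refine h.not_gt ?_
  calc pair x' y'
    _ < (x' + y') * (x' + y' + 1) + 2 * (x' + y' + 1) := by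
      unfold pair; gcongr; grind
    _ = (x' + y' + 1) * (x' + y' + 1 + 1) := by ring
    _ ≤ (x + y) * (x + y + 1) := mul_le_mul' le (by gcongr)
    _ ≤ pair x y := le_self_add

theorem pair_inj {x y x' y' : M.Num} : pair x y = pair x' y' ↔ x = x' ∧ y = y' := by
  refine ⟨fun h => ?_, fun h => by rw [h.1, h.2]⟩
  have sum_eq : x + y = x' + y' :=
    le_antisymm (add_le_add_of_pair_le_pair h.le) (add_le_add_of_pair_le_pair h.ge)
  unfold pair at h
  rw [sum_eq] at h
  obtain rfl : y = y' := mul_left_cancel₀ two_ne_zero (add_left_cancel h)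
  exact ⟨add_right_cancel sum_eq, rfl⟩

end Num

instance IsTermFun.pair {n : ℕ} {f g : (Fin n → M.Num) → M.Num} [IsTermFun f] [IsTermFun g] :
    IsTermFun fun z => Num.pair (f z) (g z) := by
  unfold Num.pair; infer_instance

namespace IsDefinable

variable {n : ℕ} {f g h : (Fin n → M.Num) → M.Num} [IsTermFun f] [IsTermFun g] [IsTermFun h]

instance digits (X : M.Str) : IsDefinable fun z => X.digits (f z) :=
  inferInstanceAs (IsDefinable fun z => f z ∈ X)

instance row (X : M.Str) : IsDefinable fun z => X.row (f z) (g z) :=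
  inferInstanceAs (IsDefinable fun z => Num.pair (f z) (g z) ∈ X)

instance mat (X : M.Str) : IsDefinable fun z => X.mat (f z) (g z) (h z) :=
  inferInstanceAs (IsDefinable fun z => Num.pair (Num.pair (f z) (g z)) (h z) ∈ X)

end IsDefinable

namespace Str

theorem exists_digits_eq (P : M.Digits) [IsDefinable fun z : Fin 1 → M.Num => P (z 0)] (L : M.Num)
    (hL : ∀ b, P b → b ≤ L) : ∃ Y : M.Str, Y.digits = P := by
  obtain ⟨Y, len_le, mem_iff⟩ := comprehension P (L + 1)
  refine ⟨Y, funext fun b => propext ?_⟩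
  by_cases hb : b < L + 1
  · exact mem_iff b hb
  · exact iff_of_false (fun hY => hb ((lt_len_of_mem hY).trans_le len_le))
      fun hP => hb (Num.lt_iff_add_one_le _ _ |>.2 (by have := hL b hP; gcongr))

theorem exists_row_eq (p : M.Num → M.Digits) [hp : IsDefinable₂ p] (I L : M.Num)
    (hL : ∀ i ≤ I, ∀ b, p i b → b ≤ L) : ∃ Y : M.Str, ∀ i ≤ I, Y.row i = p i := by
  have := hp.of_terms
  obtain ⟨Y, hY⟩ := exists_digits_eq
    (fun x : M.Num => ∃ i ≤ x, ∃ b ≤ x, x = Num.pair i b ∧ i ≤ I ∧ p i b) (Num.pair I L) (by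
      rintro _ ⟨i, -, b, -, rfl, hi, hp⟩
      exact Num.pair_le_pair hi (hL i hi b hp))
  refine ⟨Y, fun i hi => funext fun b => (congrFun hY _).trans (propext ⟨?_, fun hp => ?_⟩)⟩
  · rintro ⟨i', -, b', -, h, -, hp⟩
    obtain ⟨rfl, rfl⟩ := Num.pair_inj.1 h
    exact hp
  · exact ⟨i, Num.left_le_pair i b, b, Num.right_le_pair i b, rfl, hi, hp⟩

theorem exists_mat_eq (p : M.DigitMat) [hp : IsDefinable₃ p] (I J L : M.Num)
    (hL : ∀ i ≤ I, ∀ j ≤ J, ∀ b, p i j b → b ≤ L) :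
    ∃ Y : M.Str, ∀ i ≤ I, ∀ j ≤ J, Y.mat i j = p i j := by
  have := hp.of_terms
  obtain ⟨Y, hY⟩ := exists_digits_eq
    (fun x : M.Num => ∃ i ≤ x, ∃ j ≤ x, ∃ b ≤ x,
      x = Num.pair (Num.pair i j) b ∧ i ≤ I ∧ j ≤ J ∧ p i j b) (Num.pair (Num.pair I J) L) (by
      rintro _ ⟨i, -, j, -, b, -, rfl, hi, hj, hp⟩
      exact Num.pair_le_pair (Num.pair_le_pair hi hj) (hL i hi j hj b hp))
  refine ⟨Y, fun i hi j hj => funext fun b =>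
    (congrFun hY _).trans (propext ⟨?_, fun hp => ?_⟩)⟩
  · rintro ⟨i', -, j', -, b', -, h, -, -, hp⟩
    obtain ⟨pair_eq, rfl⟩ := Num.pair_inj.1 h
    obtain ⟨rfl, rfl⟩ := Num.pair_inj.1 pair_eq
    exact hp
  · have pair_le := Num.left_le_pair (Num.pair i j) b
    exact ⟨i, (Num.left_le_pair i j).trans pair_le, j, (Num.right_le_pair i j).trans pair_le, b,
      Num.right_le_pair _ b, rfl, hi, hj, hp⟩

theorem le_len_of_row {X : M.Str} {i b : M.Num} (h : X.row i b) : b ≤ M.len X :=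
  (Num.right_le_pair i b).trans (lt_len_of_mem h).le

end Str

namespace Digits

theorem IsCoded.of_bounded (P : M.Digits) [IsDefinable fun z : Fin 1 → M.Num => P (z 0)]
    (L : M.Num) (hL : ∀ b, P b → b ≤ L) : P.IsCoded :=
  Str.exists_digits_eq P L hL

theorem isCoded_row (X : M.Str) (i : M.Num) : (X.row i).IsCoded :=
  .of_bounded _ (M.len X) fun _ => Str.le_len_of_row

theorem isCoded_mat (X : M.Str) (i j : M.Num) : (X.mat i j).IsCoded :=
  isCoded_row X (Num.pair i j)

theorem isCoded_matSeq (X : M.Str) (s i j : M.Num) : (X.matSeq s i j).IsCoded :=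
  isCoded_row X (Num.pair (Num.pair s i) j)

theorem isCoded_zero : (0 : M.Digits).IsCoded :=
  .of_bounded (fun _ => False) 0 fun _ => False.elim

theorem IsCoded.mag {P : M.Digits} (hP : P.IsCoded) : P.mag.IsCoded := by
  obtain ⟨X, rfl⟩ := hP
  exact .of_bounded (fun b => X.digits (b + 1)) (M.len X) fun _ h =>
    le_self_add.trans (Str.lt_len_of_mem h).le

theorem ext_of_mag {P Q : M.Digits} (sign : P 0 ↔ Q 0) (mag : P.mag = Q.mag) : P = Q := by
  funext b
  by_cases hb : b = 0
  · exact hb ▸ propext sign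
  · obtain ⟨c, rfl⟩ := Num.exists_add_one_eq hb
    exact congrFun mag c

theorem IsCoded.exists_isGreatest {P : M.Digits} (hP : P.IsCoded) (h : P ≠ 0) :
    ∃ b, IsGreatest {b | P b} b := by
  obtain ⟨X, rfl⟩ := hP
  obtain ⟨c, hc⟩ := ne_zero_iff.1 h
  obtain ⟨b, hb⟩ := Num.exists_add_one_eq ((zero_le.trans_lt (Str.lt_len_of_mem hc)).ne')
  exact ⟨b, Str.mem_of_add_one_eq_len hb, fun x hx => by
    have := Str.lt_len_of_mem hx
    grind⟩

theorem carry_add_one_iff {P Q : M.Digits} {i : M.Num} :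
    Carry P Q (i + 1) ↔ P i ∧ Q i ∨ (P i ∨ Q i) ∧ Carry P Q i := by
  constructor
  · rintro ⟨k, hk, hP, hQ, h⟩
    rcases (show k ≤ i by grind).lt_or_eq with hki | rfl
    · exact Or.inr ⟨h i ⟨hki, by grind⟩, k, hki, hP, hQ, fun j hj => h j ⟨hj.1, by grind⟩⟩
    · exact Or.inl ⟨hP, hQ⟩
  · rintro (⟨hP, hQ⟩ | ⟨hi, k, hk, hP, hQ, h⟩)
    · exact ⟨i, by grind, hP, hQ, fun j hj => by grind⟩
    · refine ⟨k, by grind, hP, hQ, fun j ⟨hkj, hj⟩ => ?_⟩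
      rcases (show j ≤ i by grind).lt_or_eq with hji | rfl
      · exact h j ⟨hkj, hji⟩
      · exact hi

theorem eq_zero_of_isNatAdd_zero {P Q : M.Digits} (hP : P.IsCoded) (hQ : Q.IsCoded)
    (h : IsNatAdd P Q 0) : Q = 0 := by
  by_contra hne
  obtain ⟨X, rfl⟩ := hP
  obtain ⟨Y, rfl⟩ := hQ
  have union_coded : IsCoded fun b => X.digits b ∨ Y.digits b :=
    .of_bounded _ (M.len X + M.len Y) fun b hb =>
      hb.elim (fun hX => (Str.lt_len_of_mem hX).le.trans le_self_add)
        fun hY => (Str.lt_len_of_mem hY).le.trans le_add_self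
  obtain ⟨y, hy⟩ := ne_zero_iff.1 hne
  obtain ⟨b, hb, le_b⟩ := union_coded.exists_isGreatest (ne_zero_iff.2 ⟨y, Or.inr hy⟩)
  have succ_nmem : ¬(X.digits (b + 1) ∨ Y.digits (b + 1)) := fun hb => by
    have : b + 1 ≤ b := le_b hb
    grind
  have hb : X.digits b ∨ Y.digits b := hb
  -- Beyond the leading digit of both summands there is only the carry, so there is none.
  have not_carry : ¬Carry X.digits Y.digits (b + 1) := by
    have := h (b + 1); simp only [Xor] at this; tauto
  have digit_b := h b
  rw [carry_add_one_iff] at not_carry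
  simp only [Xor] at digit_b
  tauto

theorem isIntAdd_zero {P R : M.Digits} (hP : P.IsCoded) (hPi : P.IsInt) (hR : R.IsCoded) :
    IsIntAdd P 0 R ↔ R = P := by
  constructor
  · rintro ⟨-, ⟨-, sign, add⟩ | ⟨sign_ne, ⟨sign, add⟩ | ⟨-, add⟩⟩⟩
    · exact ext_of_mag sign (isNatAdd_zero.1 add)
    · exact ext_of_mag sign (isNatAdd_zero.1 add).symm
    · exact absurd (eq_zero_of_isNatAdd_zero hR.mag hP.mag add)
        (isInt_iff.1 hPi (not_not.1 fun hP0 => sign_ne (iff_of_false hP0 _root_.id)))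
  · rintro rfl
    refine ⟨hPi, ?_⟩
    by_cases sign : R 0
    · exact Or.inr ⟨fun h => h.1 sign, Or.inl ⟨Iff.rfl, isNatAdd_zero.2 rfl⟩⟩
    · exact Or.inl ⟨iff_of_false sign _root_.id, Iff.rfl, isNatAdd_zero.2 rfl⟩

theorem mag_neg (P : M.Digits) : (-P).mag = P.mag := by
  funext b
  simp only [mag, neg_apply, Num.add_one_ne_zero, false_and, ne_eq,
    not_false_eq_true, true_and, false_or]

theorem smul_one_apply (s : SignType) (b : M.Num) :
    (s • (1 : M.Digits)) b ↔ b = 1 ∧ s ≠ 0 ∨ b = 0 ∧ s = -1 := by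
  cases s
  · exact iff_of_false _root_.id (by simp)
  · have one_apply_zero : ¬(1 : M.Digits) 0 := zero_ne_one
    have mag_one_ne_zero : (1 : M.Digits).mag ≠ 0 := ne_zero_iff.2 ⟨0, zero_add 1⟩
    have one_apply : (1 : M.Digits) b ↔ b = 1 := Iff.rfl
    rw [SignType.neg_eq_neg_one, Digits.neg_one_smul, neg_apply]
    by_cases hb : b = 0 <;> simp [hb, one_apply_zero, mag_one_ne_zero, one_apply]
  · simp only [SignType.pos_eq_one, Digits.one_smul]
    simp; rfl

theorem smul_one_apply_zero (s : SignType) : (s • (1 : M.Digits)) 0 ↔ s = -1 := by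
  simp [smul_one_apply]

theorem mag_smul_one_apply (s : SignType) (b : M.Num) :
    (s • (1 : M.Digits)).mag b ↔ b = 0 ∧ s ≠ 0 := by
  simp [mag, smul_one_apply]

theorem isInt_smul_one (s : SignType) : (s • (1 : M.Digits)).IsInt :=
  fun h => ⟨0, by rw [mag_smul_one_apply, (smul_one_apply_zero s).1 h]; exact ⟨rfl, by decide⟩⟩

theorem isCoded_smul_one (s : SignType) : (s • (1 : M.Digits)).IsCoded := by
  rw [show s • (1 : M.Digits) = _ from funext fun b => propext (smul_one_apply s b)]
  exact .of_bounded (fun b => b = 1 ∧ s ≠ 0 ∨ b = 0 ∧ s = -1) 1 fun b hb => by grind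

theorem isInt_smul {s : SignType} {P : M.Digits} (hP : P.IsInt) : (s • P).IsInt := by
  cases s
  · exact isInt_zero
  · rw [SignType.neg_eq_neg_one, Digits.neg_one_smul, isInt_iff, neg_apply_zero, mag_neg]
    exact And.right
  · exact hP

theorem IsCoded.smul {s : SignType} {P : M.Digits} (hP : P.IsCoded) : (s • P).IsCoded := by
  cases s
  · exact isCoded_zero
  · obtain ⟨X, rfl⟩ := hP
    rw [SignType.neg_eq_neg_one, Digits.neg_one_smul,
      show -X.digits = _ from funext fun b => propext neg_apply]
    refine .of_bounded (fun b => b = 0 ∧ ¬X.digits 0 ∧ X.digits.mag ≠ 0 ∨ b ≠ 0 ∧ X.digits b)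
      (M.len X) ?_
    rintro b (⟨rfl, -⟩ | ⟨-, h⟩)
    · exact zero_le
    · exact (Str.lt_len_of_mem h).le
  · exact hP

theorem smul_smul_one (s s' : SignType) : s • s' • (1 : M.Digits) = (s * s') • (1 : M.Digits) := by
  cases s
  · rfl
  · refine ext_of_mag ?_ (funext fun b => ?_)
    · rw [SignType.neg_eq_neg_one, Digits.neg_one_smul, neg_apply_zero, smul_one_apply_zero,
        smul_one_apply_zero, ne_zero_iff]
      simp only [mag_smul_one_apply, exists_eq_left]
      cases s' <;> decide
    · rw [SignType.neg_eq_neg_one, Digits.neg_one_smul, mag_neg, eq_iff_iff, mag_smul_one_apply,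
        mag_smul_one_apply]
      cases s' <;> simp
  · exact congrArg (· • (1 : M.Digits)) (one_mul s').symm

end Digits

theorem Str.row_eq_of_recursion {W : M.Str} {l : M.Num} {f : M.Num → M.Digits} [hf : IsDefinable₂ f]
    {a : M.Num} (L : M.Num) (hL : ∀ i b, f i b → b ≤ L) (base : W.row a = f a)
    (step : ∀ i, a ≤ i → i < l → W.row i = f i → W.row (i + 1) = f (i + 1)) :
    ∀ i, a ≤ i → i ≤ l → W.row i = f i := by
  intro i
  induction i using Num.induction with
  | definable =>
    have := hf.of_terms
    have := IsDefinable.eq_of_le (n := 1) (P := fun z => W.row (z 0)) (R := fun z => f (z 0))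
      (M.len W + L) (fun _ _ h => (Str.le_len_of_row h).trans le_self_add)
      fun z b h => (hL (z 0) b h).trans le_add_self
    infer_instance
  | zero =>
    intro ha _
    rw [← le_antisymm ha zero_le]
    exact base
  | succ i ih =>
    intro ha hi
    rcases ha.lt_or_eq with ha | rfl
    · exact step i (by grind) (by grind) (ih (by grind) (by grind))
    · exact base

open Digits DigitMat

namespace Digits

theorem isNatMul_iff_eq {P Q R C : M.Digits} (partialSum : M.Num → M.Digits)
    [IsDefinable₂ partialSum] (L : M.Num) (hL : ∀ i b, partialSum i b → b ≤ L) (hQ : Q.IsCoded)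
    (partialSum_zero : partialSum 0 = 0)
    (isNatAdd_iff : ∀ i S,
      IsNatAdd (partialSum i) (fun b => Q i ∧ P.shift i b) S ↔ S = partialSum (i + 1))
    (partialSum_eq : ∀ l, (∀ i, l ≤ i → ¬Q i) → partialSum l = C) :
    IsNatMul P Q R ↔ R = C := by
  constructor
  · rintro ⟨W, l, hl, W_zero, W_step, rfl⟩
    rw [← partialSum_eq l hl]
    refine Str.row_eq_of_recursion L hL (W_zero.trans partialSum_zero.symm) (fun i _ hi h => ?_)
      l zero_le le_rfl
    rw [← isNatAdd_iff, ← h]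
    exact W_step i hi
  · rintro rfl
    obtain ⟨X, rfl⟩ := hQ
    have hl : ∀ i, M.len X ≤ i → ¬X.digits i := fun i hi h => (Str.lt_len_of_mem h).not_ge hi
    obtain ⟨W, hW⟩ := Str.exists_row_eq partialSum (M.len X) L fun i _ => hL i
    refine ⟨W, M.len X, hl, (hW 0 zero_le).trans partialSum_zero, fun i hi => ?_,
      ((hW _ le_rfl).trans (partialSum_eq _ hl)).symm⟩
    rw [hW i hi.le, hW (i + 1) (Num.add_one_le_of_lt hi), isNatAdd_iff]

theorem singleDigit_isNatMul_iff {P R : M.Digits} (hP : P.IsCoded) (q : Prop) :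
    IsNatMul (fun b => b = 0 ∧ q) P R ↔ R = fun b => P b ∧ q := by
  obtain ⟨X, rfl⟩ := hP
  refine isNatMul_iff_eq (fun i b => b < i ∧ X.digits b ∧ q) (M.len X)
    (fun i b h => (Str.lt_len_of_mem h.2.1).le) (isCoded_digits X)
    (funext fun b => eq_false fun h => not_lt_zero h.1) (fun i S => ?_) fun l hl => ?_
  · have shift_iff (b : M.Num) : shift (fun b => b = 0 ∧ q) i b ↔ b = i ∧ q := by simp [shift]
    simp only [shift_iff]
    rw [isNatAdd_of_disjoint (by grind)]
    refine Eq.congr_right (funext fun b => propext ?_)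
    rcases lt_trichotomy b i with _ | rfl | _ <;> grind
  · funext b
    have := hl b
    grind

theorem isNatMul_singleDigit_iff {P R : M.Digits} (hP : P.IsCoded) (q : Prop) :
    IsNatMul P (fun b => b = 0 ∧ q) R ↔ R = fun b => P b ∧ q := by
  obtain ⟨X, rfl⟩ := hP
  refine isNatMul_iff_eq (fun i b => 0 < i ∧ X.digits b ∧ q) (M.len X)
    (fun i b h => (Str.lt_len_of_mem h.2.1).le)
    (.of_bounded (fun b => b = 0 ∧ q) 0 fun b h => h.1.le)
    (funext fun b => eq_false fun h => h.1.false) (fun i S => ?_) fun l hl => ?_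
  · rw [isNatAdd_of_disjoint (by grind)]
    refine Eq.congr_right (funext fun b => propext ?_)
    have shift_zero : shift X.digits 0 b ↔ X.digits b := by simp [shift]
    grind
  · funext b
    have := hl 0
    grind

theorem isIntMul_iff_eq {P Q R C : M.Digits} (hC : C.IsInt)
    (mul : IsNatMul P.mag Q.mag R.mag ↔ R.mag = C.mag)
    (sign : C.mag ≠ 0 → (C 0 ↔ Xor (P 0) (Q 0))) :
    IsIntMul P Q R ↔ R = C := by
  rw [IsIntMul, mul, ← ne_zero_iff]
  constructor
  · rintro ⟨hR, mag_eq, hsign⟩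
    refine ext_of_mag ?_ mag_eq
    rw [isInt_iff] at hR hC
    rw [mag_eq] at hR hsign
    tauto
  · rintro rfl
    exact ⟨hC, rfl, sign⟩

theorem mag_smul_apply (s : SignType) (P : M.Digits) (b : M.Num) :
    (s • P).mag b ↔ P.mag b ∧ s ≠ 0 := by
  cases s
  · exact iff_of_false _root_.id (by simp)
  · rw [SignType.neg_eq_neg_one, Digits.neg_one_smul, mag_neg]
    simp
  · rw [SignType.pos_eq_one, Digits.one_smul]
    simp

theorem smul_apply_zero {s : SignType} {P : M.Digits} (h : (s • P).mag ≠ 0) :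
    (s • P) 0 ↔ Xor (s = -1) (P 0) := by
  obtain ⟨b, hb⟩ := ne_zero_iff.1 h
  have hP : P.mag ≠ 0 := ne_zero_iff.2 ⟨b, ((mag_smul_apply s P b).1 hb).1⟩
  cases s
  · exact absurd rfl h
  · rw [SignType.neg_eq_neg_one, Digits.neg_one_smul, neg_apply_zero]
    simp [hP]
  · rw [SignType.pos_eq_one, Digits.one_smul]
    simp

theorem smul_one_isIntMul_iff {s : SignType} {P R : M.Digits} (hP : P.IsCoded)
    (h : (s • P).IsInt) : IsIntMul (s • 1) P R ↔ R = s • P := by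
  refine isIntMul_iff_eq h ?_ fun hne => by rw [smul_apply_zero hne, smul_one_apply_zero]
  rw [funext fun b => propext (mag_smul_one_apply s b), singleDigit_isNatMul_iff hP.mag,
    funext fun b => propext (mag_smul_apply s P b)]

theorem isIntMul_smul_one_iff {s : SignType} {P R : M.Digits} (hP : P.IsCoded)
    (h : (s • P).IsInt) : IsIntMul P (s • 1) R ↔ R = s • P := by
  refine isIntMul_iff_eq h ?_ fun hne => by rw [smul_apply_zero hne, smul_one_apply_zero, xor_comm]
  rw [funext fun b => propext (mag_smul_one_apply s b), isNatMul_singleDigit_iff hP.mag,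
    funext fun b => propext (mag_smul_apply s P b)]

/-! ### Dot products -/

variable {l m o : M.Num} {x y x' y' : M.Num → M.Digits} {R : M.Digits}

theorem row_eq_of_isIntAdd_zero {T : M.Str} {a : M.Num} (ha : (T.row a).IsInt)
    (add : ∀ i, a ≤ i → i < l → IsIntAdd (T.row i) 0 (T.row (i + 1))) :
    ∀ i, a ≤ i → i ≤ l → T.row i = T.row a :=
  Str.row_eq_of_recursion (f := fun _ => T.row a) (M.len T) (fun _ _ => Str.le_len_of_row) rfl
    fun i hai hil row_eq => by
      have := add i hai hil
      rwa [row_eq, isIntAdd_zero (isCoded_row T a) ha (isCoded_row T _)] at this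

theorem isInt_row_of_isIntAdd {T : M.Str} (zero : T.row 0 = 0)
    (add : ∀ r < l, ∃ U, IsIntAdd (T.row r) U (T.row (r + 1))) : ∀ r ≤ l, (T.row r).IsInt := by
  intro r hr
  rcases eq_or_ne r 0 with rfl | hr0
  · exact zero ▸ isInt_zero
  · obtain ⟨r, rfl⟩ := Num.exists_add_one_eq hr0
    obtain ⟨U, add⟩ := add r (by grind)
    exact add.1

theorem IsDot.of_window (hm : o + l ≤ m)
    (inside : ∀ r, InRange r l → ∀ U, IsIntMul (x' (o + r)) (y' (o + r)) U → IsIntMul (x r) (y r) U)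
    (outside : ∀ q, InRange q m → q ≤ o ∨ o + l < q → ∀ U, IsIntMul (x' q) (y' q) U → U = 0)
    (h : IsDot m x' y' R) : IsDot l x y R := by
  obtain ⟨T, T_zero, T_step, rfl⟩ := h
  have isInt_T := isInt_row_of_isIntAdd T_zero fun r hr =>
    (T_step r hr).elim fun U h => ⟨U.digits, h.2⟩
  have add_zero : ∀ q, q + 1 ≤ o ∨ o + l ≤ q → q < m →
      IsIntAdd (T.row q) 0 (T.row (q + 1)) := by
    intro q hq hqm
    obtain ⟨U, mul, add⟩ := T_step q hqm
    rwa [outside (q + 1) ⟨by grind, by grind⟩ (by grind) _ mul] at add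
  have row_o : T.row o = 0 :=
    (row_eq_of_isIntAdd_zero (isInt_T 0 zero_le) (fun q _ hq => add_zero q (by grind) (by grind)) o
      zero_le le_rfl).trans T_zero
  have row_m : T.row m = T.row (o + l) :=
    row_eq_of_isIntAdd_zero (isInt_T _ hm) (fun q hq hqm => add_zero q (Or.inr hq) hqm) m hm le_rfl
  obtain ⟨T', hT'⟩ := Str.exists_row_eq (fun r => T.row (o + r)) l (M.len T)
    fun _ _ _ => Str.le_len_of_row
  refine ⟨T', ?_, fun r hr => ?_, row_m.trans (hT' l le_rfl).symm⟩
  · rw [hT' 0 zero_le, _root_.add_zero, row_o]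
  · obtain ⟨U, mul, add⟩ := T_step (o + r) (by grind)
    rw [add_assoc] at mul add
    rw [hT' r hr.le, hT' (r + 1) (by grind)]
    exact ⟨U, inside (r + 1) ⟨by grind, by grind⟩ _ mul, add⟩

theorem exists_row_eq_clamp (T : M.Str) (o l m : M.Num) : ∃ T' : M.Str, ∀ q ≤ m,
    (q ≤ o → T'.row q = T.row 0) ∧ (∀ r ≤ l, q = o + r → T'.row q = T.row r) ∧
      (o + l ≤ q → T'.row q = T.row l) := by
  obtain ⟨T', hT'⟩ := Str.exists_row_eq
    (fun q b => ∃ r ≤ l, (q = o + r ∨ r = 0 ∧ q < o ∨ r = l ∧ o + l < q) ∧ T.row r b) m (M.len T)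
    fun _ _ _ ⟨_, _, _, h⟩ => Str.le_len_of_row h
  have row_eq (q : M.Num) (hq : q ≤ m) (r : M.Num) (hr : r ≤ l)
      (h : q = o + r ∨ r = 0 ∧ q < o ∨ r = l ∧ o + l < q) : T'.row q = T.row r := by
    refine (hT' q hq).trans (funext fun b => propext ⟨?_, fun hTr => ⟨r, hr, h, hTr⟩⟩)
    rintro ⟨r', hr', h', hTr'⟩
    obtain rfl : r' = r := by grind
    exact hTr'
  exact ⟨T', fun q hq => ⟨fun _ => row_eq q hq 0 zero_le (by grind),
    fun r hr _ => row_eq q hq r hr (by grind), fun _ => row_eq q hq l le_rfl (by grind)⟩⟩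

theorem IsDot.window (hm : o + l ≤ m)
    (inside : ∀ r, InRange r l → ∀ U, IsIntMul (x r) (y r) U → IsIntMul (x' (o + r)) (y' (o + r)) U)
    (outside : ∀ q, InRange q m → q ≤ o ∨ o + l < q → IsIntMul (x' q) (y' q) 0)
    (h : IsDot l x y R) : IsDot m x' y' R := by
  obtain ⟨T, T_zero, T_step, rfl⟩ := h
  have isInt_T := isInt_row_of_isIntAdd T_zero fun r hr =>
    (T_step r hr).elim fun U h => ⟨U.digits, h.2⟩
  obtain ⟨T', hT'⟩ := exists_row_eq_clamp T o l m
  obtain ⟨U₀, hU₀⟩ := isCoded_zero (M := M)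
  refine ⟨T', ((hT' 0 zero_le).1 zero_le).trans T_zero, fun q hq => ?_,
    ((hT' m le_rfl).2.2 hm).symm⟩
  obtain ⟨row_le, row_add, row_ge⟩ := hT' q hq.le
  obtain ⟨row_le', row_add', row_ge'⟩ := hT' (q + 1) (Num.add_one_le_of_lt hq)
  by_cases h : q + 1 ≤ o ∨ o + l ≤ q
  · have row_eq : T'.row (q + 1) = T'.row q := by
      rcases h with h | h
      · rw [row_le' h, row_le (by grind)]
      · rw [row_ge' (by grind), row_ge h]
    have isInt_row : (T'.row q).IsInt := by
      rcases h with h | h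
      · exact row_le (by grind) ▸ isInt_T 0 zero_le
      · exact row_ge h ▸ isInt_T l le_rfl
    rw [row_eq]
    exact ⟨U₀, hU₀ ▸ outside (q + 1) ⟨by grind, by grind⟩ (by grind),
      hU₀ ▸ (isIntAdd_zero (isCoded_row _ _) isInt_row (isCoded_row _ _)).2 rfl⟩
  · obtain ⟨r, rfl⟩ := exists_add_of_le (show o ≤ q by grind)
    have hr : r < l := by grind
    obtain ⟨U, mul, add⟩ := T_step r hr
    rw [row_add r hr.le rfl, row_add' (r + 1) (by grind) (add_assoc o r 1), add_assoc]
    exact ⟨U, inside (r + 1) ⟨by grind, by grind⟩ _ mul, add⟩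

theorem IsDot.congr (hx : ∀ r, InRange r l → x r = x' r) (hy : ∀ r, InRange r l → y r = y' r)
    (h : IsDot l x y R) : IsDot l x' y' R := by
  obtain ⟨T, T_zero, T_step, rfl⟩ := h
  refine ⟨T, T_zero, fun r hr => ?_, rfl⟩
  have hr' : InRange (r + 1) l := ⟨le_add_self, Num.add_one_le_of_lt hr⟩
  rw [← hx _ hr', ← hy _ hr']
  exact T_step r hr

theorem isDot_one_iff {C : M.Digits} (hC : C.IsCoded) (hCi : C.IsInt)
    (mul : ∀ U, IsIntMul (x 1) (y 1) U ↔ U = C) : IsDot 1 x y R ↔ R = C := by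
  obtain ⟨X, rfl⟩ := hC
  constructor
  · rintro ⟨T, T_zero, T_step, rfl⟩
    obtain ⟨U, hU, add⟩ := T_step 0 zero_lt_one
    rw [zero_add] at hU add
    rwa [T_zero, (mul _).1 hU, isIntAdd_comm,
      isIntAdd_zero (isCoded_digits X) hCi (isCoded_row T 1)] at add
  · rintro rfl
    obtain ⟨T, hT⟩ := Str.exists_row_eq (fun i b => i = 1 ∧ X.digits b) 1 (M.len X)
      fun _ _ _ h => (Str.lt_len_of_mem h.2).le
    have T_zero : T.row 0 = 0 :=
      (hT 0 zero_le).trans (funext fun b => eq_false fun h => zero_ne_one h.1)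
    have T_one : T.row 1 = X.digits :=
      (hT 1 le_rfl).trans (funext fun b => propext (and_iff_right rfl))
    refine ⟨T, T_zero, fun r hr => ?_, T_one.symm⟩
    obtain rfl : r = 0 := by grind
    rw [zero_add, T_zero, T_one]
    exact ⟨X, (mul _).2 rfl,
      isIntAdd_comm.1 ((isIntAdd_zero (isCoded_digits X) hCi (isCoded_digits X)).2 rfl)⟩

theorem isDot_iff_eq {c : M.Num} {C : M.Digits} (hc : InRange c l) (hC : C.IsCoded) (hCi : C.IsInt)
    (mul : ∀ U, IsIntMul (x c) (y c) U ↔ U = C)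
    (mul_eq_zero : ∀ q, InRange q l → q ≠ c → ∀ U, IsIntMul (x q) (y q) U ↔ U = 0) :
    IsDot l x y R ↔ R = C := by
  obtain ⟨o, rfl⟩ := Num.exists_add_one_eq (zero_lt_one.trans_le hc.1).ne'
  rw [← isDot_one_iff (x := fun r => x (o + r)) (y := fun r => y (o + r)) hC hCi mul]
  have outside : ∀ q, InRange q l → q ≤ o ∨ o + 1 < q → ∀ U, IsIntMul (x q) (y q) U ↔ U = 0 :=
    fun q hq h => mul_eq_zero q hq (by grind)
  exact ⟨.of_window hc.2 (fun _ _ _ => _root_.id) fun q hq h U => (outside q hq h U).1,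
    .window hc.2 (fun _ _ _ => _root_.id) fun q hq h => (outside q hq h 0).2 rfl⟩

/-- The terms `a` at the position `c` and `0` elsewhere of a sequence of integers. -/
noncomputable def single (c : M.Num) (a : SignType) : M.Num → M.Digits :=
  fun r => (if r = c then a else 0) • 1

theorem single_self (c : M.Num) (a : SignType) : single c a c = a • 1 := by
  rw [single, if_pos rfl]

theorem single_zero (c r : M.Num) : single c 0 r = 0 := by
  simp only [single, ite_self, Digits.zero_smul]

theorem single_of_ne {c r : M.Num} (h : r ≠ c) (a : SignType) : single c a r = 0 := by
  rw [single, if_neg h, Digits.zero_smul]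

theorem isDot_single_left_iff {c : M.Num} {a : SignType} (hc : InRange c l)
    (hx : ∀ r, InRange r l → x r = single c a r) (hy : ∀ r, InRange r l → (y r).IsCoded)
    (hyi : (a • y c).IsInt) : IsDot l x y R ↔ R = a • y c := by
  refine isDot_iff_eq hc (hy c hc).smul hyi (fun U => ?_) fun q hq hne U => ?_
  · rw [hx c hc, single_self, smul_one_isIntMul_iff (hy c hc) hyi]
  · rw [hx q hq, single_of_ne hne, ← Digits.zero_smul 1,
      smul_one_isIntMul_iff (hy q hq) isInt_zero, Digits.zero_smul, Digits.zero_smul]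

theorem isDot_single_right_iff {c : M.Num} {a : SignType} (hc : InRange c l)
    (hx : ∀ r, InRange r l → (x r).IsCoded) (hy : ∀ r, InRange r l → y r = single c a r)
    (hxi : (a • x c).IsInt) : IsDot l x y R ↔ R = a • x c := by
  refine isDot_iff_eq hc (hx c hc).smul hxi (fun U => ?_) fun q hq hne U => ?_
  · rw [hy c hc, single_self, isIntMul_smul_one_iff (hx c hc) hxi]
  · rw [hy q hq, single_of_ne hne, ← Digits.zero_smul 1,
      isIntMul_smul_one_iff (hx q hq) isInt_zero, Digits.zero_smul, Digits.zero_smul]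

theorem smul_single (s : SignType) (c : M.Num) (a : SignType) (r : M.Num) :
    s • single c a r = single c (s * a) r := by
  rw [single, smul_smul_one, mul_ite, mul_zero, single]

theorem isCoded_single (c : M.Num) (a : SignType) (r : M.Num) : (single c a r).IsCoded :=
  isCoded_smul_one _

theorem isInt_single (c : M.Num) (a : SignType) (r : M.Num) : (single c a r).IsInt :=
  isInt_smul_one _

end Digits

instance IsDefinable.ite_eq {n : ℕ} {α : Type*} {p : (Fin n → M.Num) → Prop} [∀ z, Decidable (p z)]
    {f g : (Fin n → M.Num) → α} {c : α} [IsDefinable p] [IsDefinable fun z => f z = c]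
    [IsDefinable fun z => g z = c] : IsDefinable fun z => (if p z then f z else g z) = c := by
  refine .congr (p := fun z => p z ∧ f z = c ∨ ¬p z ∧ g z = c) inferInstance fun z => ?_
  split_ifs with h <;> simp [h]

theorem Str.exists_mat_eq_smul_one (μ : M.Num → M.Num → SignType)
    [zero : IsDefinable₂ fun i j => μ i j = 0] [neg : IsDefinable₂ fun i j => μ i j = -1]
    (I J : M.Num) : ∃ Y : M.Str, ∀ i ≤ I, ∀ j ≤ J, Y.mat i j = μ i j • 1 := by
  have := zero.of_terms
  have := neg.of_terms
  obtain ⟨Y, hY⟩ := exists_mat_eq (fun i j b => b = 1 ∧ ¬μ i j = 0 ∨ b = 0 ∧ μ i j = -1) I J 1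
    fun i _ j _ b hb => by grind
  exact ⟨Y, fun i hi j hj => (hY i hi j hj).trans (funext fun b => propext (by
    rw [smul_one_apply]))⟩

theorem Str.exists_mat_row_eq_single (c : M.Num) (a : SignType) (J : M.Num) :
    ∃ Y : M.Str, ∀ j ≤ J, Y.mat 1 j = single c a j := by
  obtain ⟨Y, hY⟩ := exists_mat_eq_smul_one (fun _ j => if j = c then a else 0) 1 J
  exact ⟨Y, hY 1 le_rfl⟩

instance IsDefinable.neg_mat {n : ℕ} {f g h : (Fin n → M.Num) → M.Num} [IsTermFun f] [IsTermFun g]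
    [IsTermFun h] (X : M.Str) : IsDefinable fun z => (-X.mat (f z) (g z)) (h z) := by
  refine .congr (p := fun z => h z = 0 ∧ ¬X.mat (f z) (g z) 0 ∧
    (∃ c ≤ M.len X, X.mat (f z) (g z) (c + 1)) ∨ ¬h z = 0 ∧ X.mat (f z) (g z) (h z))
    inferInstance fun z => ?_
  refine or_congr_left (and_congr_right' (and_congr_right' ?_))
  exact ⟨fun ⟨c, _, hc⟩ => ⟨c, hc⟩,
    fun ⟨c, hc⟩ => ⟨c, le_self_add.trans (Str.le_len_of_row hc), hc⟩⟩

/-! ### Multiplication by the matrix `J` -/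

namespace DigitMat

/-- The entry of the matrix `J` at the position `(p, q)` is `b ≠ 0`. -/
def IsJEntry (p q : M.Num) (b : SignType) : Prop :=
  (∃ h, p = 2 * h + 1 ∧ q = 2 * h + 2 ∧ b = 1) ∨ ∃ h, p = 2 * h + 2 ∧ q = 2 * h + 1 ∧ b = -1

namespace IsJEntry

variable {p q r f : M.Num} {b c : SignType}

theorem symm (h : IsJEntry p q b) : IsJEntry q p (-b) := by
  obtain ⟨h, rfl, rfl, rfl⟩ | ⟨h, rfl, rfl, rfl⟩ := h
  · exact Or.inr ⟨h, rfl, rfl, rfl⟩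
  · exact Or.inl ⟨h, rfl, rfl, neg_neg 1⟩

theorem inRange_right (h : IsJEntry p q b) (hp : InRange p (2 * f)) : InRange q (2 * f) := by
  unfold InRange at *
  obtain ⟨h, rfl, rfl, rfl⟩ | ⟨h, rfl, rfl, rfl⟩ := h <;> rcases lt_or_ge h f with _ | _ <;> grind

theorem unique (h : IsJEntry p q b) (h' : IsJEntry p r c) : q = r ∧ b = c := by
  obtain ⟨h, rfl, rfl, rfl⟩ | ⟨h, rfl, rfl, rfl⟩ := h <;>
  obtain ⟨h', hp, rfl, rfl⟩ | ⟨h', hp, rfl, rfl⟩ := h' <;>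
  rcases lt_trichotomy h h' with _ | _ | _ <;> grind

end IsJEntry

theorem exists_isJEntry {p : M.Num} (hp : 1 ≤ p) : ∃ q b, IsJEntry p q b := by
  obtain ⟨h, rfl | rfl⟩ := Num.exists_eq_two_mul_add hp
  · exact ⟨_, _, Or.inl ⟨h, rfl, rfl, rfl⟩⟩
  · exact ⟨_, _, Or.inr ⟨h, rfl, rfl, rfl⟩⟩

theorem J_apply_iff {p q x : M.Num} : J p q x ↔ ∃ b, IsJEntry p q b ∧ (b • (1 : M.Digits)) x := by
  constructor
  · rintro (⟨h, rfl, rfl, hx⟩ | ⟨h, rfl, rfl, hx⟩)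
    · exact ⟨1, Or.inl ⟨h, rfl, rfl, rfl⟩, hx⟩
    · exact ⟨-1, Or.inr ⟨h, rfl, rfl, rfl⟩, hx⟩
  · rintro ⟨b, ⟨h, rfl, rfl, rfl⟩ | ⟨h, rfl, rfl, rfl⟩, hx⟩
    · exact Or.inl ⟨h, rfl, rfl, hx⟩
    · exact Or.inr ⟨h, rfl, rfl, hx⟩

theorem IsJEntry.J_eq {p q : M.Num} {b : SignType} (h : IsJEntry p q b) : J p q = b • 1 :=
  funext fun _ => propext (J_apply_iff.trans
    ⟨fun ⟨_, h', hx⟩ => (h.unique h').2 ▸ hx, fun hx => ⟨b, h, hx⟩⟩)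

theorem J_eq_zero {p q : M.Num} (h : ∀ b, ¬IsJEntry p q b) : (J p q : M.Digits) = 0 :=
  funext fun _ => eq_false fun hx => (J_apply_iff.1 hx).elim fun b hb => h b hb.1

theorem IsJEntry.J_row_eq {p q : M.Num} {b : SignType} (h : IsJEntry p q b) (r : M.Num) :
    J p r = single q b r := by
  rcases eq_or_ne r q with rfl | hr
  · rw [single_self, h.J_eq]
  · rw [single_of_ne hr, J_eq_zero fun c hc => hr (hc.unique h).1]

theorem IsJEntry.J_col_eq {p q : M.Num} {b : SignType} (h : IsJEntry p q b) (r : M.Num) :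
    J r q = single p b r := by
  rcases eq_or_ne r p with rfl | hr
  · rw [single_self, h.J_eq]
  · rw [single_of_ne hr, J_eq_zero fun c hc => hr (hc.symm.unique h.symm).1]

theorem isCoded_J {p : M.Num} (hp : 1 ≤ p) (q : M.Num) : (J p q : M.Digits).IsCoded := by
  obtain ⟨r, b, h⟩ := exists_isJEntry hp
  exact h.J_row_eq q ▸ isCoded_single r b q

theorem isDot_J_iff {f j p : M.Num} {b : SignType} {x : M.Num → M.Digits} {R : M.Digits}
    (hj : InRange j (2 * f)) (hx : ∀ r, InRange r (2 * f) → (x r).IsCoded)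
    (hxi : ∀ r, InRange r (2 * f) → (x r).IsInt) (h : IsJEntry j p b) :
    IsDot (2 * f) x (fun r => J r j) R ↔ R = -b • x p :=
  have hp := h.inRange_right hj
  isDot_single_right_iff hp hx (fun r _ => h.symm.J_col_eq r) (isInt_smul (hxi p hp))

theorem IsMul.isIntOn_J {f l : M.Num} {X Y : M.DigitMat} (h : IsMul l (2 * f) (2 * f) X J Y)
    (hX : ∀ i j, InRange i l ∧ InRange j (2 * f) → (X i j).IsCoded)
    (hXi : IsIntOn l (2 * f) X) : IsIntOn l (2 * f) Y := fun i j ⟨hi, hj⟩ => by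
  obtain ⟨p, b, hJ⟩ := exists_isJEntry hj.1
  rw [(isDot_J_iff hj (fun r hr => hX i r ⟨hi, hr⟩) (fun r hr => hXi i r ⟨hi, hr⟩) hJ).1
    (h i j ⟨hi, hj⟩)]
  exact isInt_smul (hXi i p ⟨hi, hJ.inRange_right hj⟩)

theorem exists_isMul_J (f g : M.Num) (A : M.Str) (hA : IsIntOn (2 * f) (2 * f) (minor g A.mat)) :
    ∃ Y : M.Str, IsMul (2 * f) (2 * f) (2 * f) (minor g A.mat) J Y.mat := by
  obtain ⟨Y, hY⟩ := Str.exists_mat_eq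
    (fun i j b => (∃ h ≤ j, j = 2 * h + 1 ∧ (-A.mat (g + i) (g + (2 * h + 2))) b) ∨
      ∃ h ≤ j, j = 2 * h + 2 ∧ A.mat (g + i) (g + (2 * h + 1)) b) (2 * f) (2 * f) (M.len A) (by
    rintro i - j - b (⟨h, -, -, hb⟩ | ⟨h, -, -, hb⟩)
    · rcases neg_apply.1 hb with ⟨rfl, -⟩ | ⟨-, hb⟩
      · exact zero_le
      · exact Str.le_len_of_row hb
    · exact Str.le_len_of_row hb)
  refine ⟨Y, fun i j ⟨hi, hj⟩ => ?_⟩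
  obtain ⟨p, b, h⟩ := exists_isJEntry hj.1
  rw [isDot_J_iff (x := fun r => minor g A.mat i r) hj (fun _ _ => isCoded_mat A _ _)
    (fun r hr => hA i r ⟨hi, hr⟩) h, hY i hi.2 j hj.2]
  funext x
  refine propext ⟨?_, fun hx => ?_⟩
  · rintro (⟨h', -, hj', hx⟩ | ⟨h', -, hj', hx⟩)
    · obtain ⟨rfl, rfl⟩ := h.unique (Or.inl ⟨h', hj', rfl, rfl⟩)
      rwa [Digits.neg_one_smul]
    · obtain ⟨rfl, rfl⟩ := h.unique (Or.inr ⟨h', hj', rfl, rfl⟩)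
      rwa [neg_neg, Digits.one_smul]
  · obtain ⟨h, rfl, rfl, rfl⟩ | ⟨h, rfl, rfl, rfl⟩ := h
    · exact Or.inl ⟨h, by grind, rfl, by rwa [Digits.neg_one_smul] at hx⟩
    · exact Or.inr ⟨h, by grind, rfl, by rwa [neg_neg, Digits.one_smul] at hx⟩

end DigitMat

/-! ### Rows with a single nonzero entry in products and powers -/

namespace DigitMat

/-- The row `i` of the matrix `X` with `m` columns has the entry `a` in the column `p` and zeros
elsewhere. -/
def IsSingleRow (m : M.Num) (X : M.DigitMat) (i p : M.Num) (a : SignType) : Prop :=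
  ∀ j, InRange j m → X i j = single p a j

variable {m t : M.Num} {X : M.DigitMat} {W : M.Str} {i p q s : M.Num} {a b v : SignType}

theorem isSingleRow_zero_iff : IsSingleRow m X i p 0 ↔ ∀ j, InRange j m → X i j = 0 := by
  simp only [IsSingleRow, single_zero]

theorem IsSingleRow.zero (h : IsSingleRow m X i p 0) (q : M.Num) : IsSingleRow m X i q 0 :=
  isSingleRow_zero_iff.2 (isSingleRow_zero_iff.1 h)

theorem isDot_iff_of_isSingleRow {Y : M.DigitMat} {l j : M.Num} {R : M.Digits}
    (hp : InRange p m) (hX : IsSingleRow m X i p a) (hY : ∀ r, InRange r m → (Y r j).IsCoded)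
    (row : IsSingleRow l Y p q b) (hj : InRange j l) :
    IsDot m (fun r => X i r) (fun r => Y r j) R ↔ R = single q (a * b) j := by
  have smul_eq : a • Y p j = single q (a * b) j := by rw [row j hj, smul_single]
  rw [isDot_single_left_iff (y := fun r => Y r j) hp hX hY (smul_eq ▸ isInt_single q _ j), smul_eq]

theorem IsMul.isSingleRow {Y Z : M.DigitMat} {k l : M.Num} (h : IsMul k m l X Y Z)
    (hi : InRange i k) (hp : InRange p m) (hX : IsSingleRow m X i p a)
    (hY : ∀ i j, InRange i m ∧ InRange j l → (Y i j).IsCoded) (row : IsSingleRow l Y p q b) :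
    IsSingleRow l Z i q (a * b) := fun j hj =>
  (isDot_iff_of_isSingleRow hp hX (fun r hr => hY r j ⟨hr, hj⟩) row hj).1 (h i j ⟨hi, hj⟩)

theorem IsMul.isSingleRow_J {Y : M.DigitMat} {f l : M.Num} (h : IsMul l (2 * f) (2 * f) X J Y)
    (hi : InRange i l) (hp : InRange p (2 * f)) (row : IsSingleRow (2 * f) X i p a)
    (hJ : IsJEntry p q b) : IsSingleRow (2 * f) Y i q (a * b) :=
  h.isSingleRow hi hp row (fun _ j hij => isCoded_J hij.1.1 j) fun r _ => hJ.J_row_eq r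

/-- The string `W` codes a sequence starting with the powers `X ^ 0, …, X ^ t` of an `m × m`
matrix. -/
def IsPowSeq (m : M.Num) (X : M.DigitMat) (t : M.Num) (W : M.Str) : Prop :=
  EqOn m m (W.matSeq 0) id ∧ ∀ s, s < t → IsMul m m m (W.matSeq s) X (W.matSeq (s + 1))

theorem isPow_iff {Y : M.DigitMat} :
    IsPow m X t Y ↔ ∃ W, IsPowSeq m X t W ∧ EqOn m m Y (W.matSeq t) := by
  simp only [IsPow, IsPowSeq, and_assoc]

theorem id_eq_single (i j : M.Num) : (id i j : M.Digits) = single i 1 j := by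
  funext b
  rcases eq_or_ne j i with rfl | hj
  · simp [id, single_self, Digits.one_smul]
  · rw [single_of_ne hj]
    exact eq_false fun h => hj h.1.symm

namespace IsPowSeq

theorem isSingleRow_zero (h : IsPowSeq m X t W) (hi : InRange i m) :
    IsSingleRow m (W.matSeq 0) i i 1 := fun j hj => (h.1 i j ⟨hi, hj⟩).trans (id_eq_single i j)

theorem isSingleRow_add_one {X : M.Str} (h : IsPowSeq m X.mat t W) (hs : s < t) (hi : InRange i m)
    (hp : InRange p m) (row : IsSingleRow m (W.matSeq s) i p a) (hX : IsSingleRow m X.mat p q b) :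
    IsSingleRow m (W.matSeq (s + 1)) i q (a * b) :=
  (h.2 s hs).isSingleRow hi hp row (fun _ _ _ => isCoded_mat X _ _) hX

theorem isSingleRow_eq_zero {X : M.Str} (h : IsPowSeq m X.mat t W) (hi : InRange i m)
    (hp : InRange p m) (row : IsSingleRow m (W.matSeq s) i p 0) (hst : s ≤ t) :
    IsSingleRow m (W.matSeq t) i p 0 := by
  have bounded (u : M.Num) : IsSingleRow m (W.matSeq u) i p 0 ↔
      ∀ j ≤ m, 1 ≤ j → ∀ b ≤ M.len W, ¬W.row (Num.pair (Num.pair u i) j) b := by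
    rw [isSingleRow_zero_iff]
    exact ⟨fun h j hj hj1 b _ => (congrFun (h j ⟨hj1, hj⟩) b).mp, fun h j hj =>
      funext fun b => eq_false fun hb => h j hj.2 hj.1 b (Str.le_len_of_row hb) hb⟩
  have isSingleRow_add (d : M.Num) : s + d ≤ t → IsSingleRow m (W.matSeq (s + d)) i p 0 := by
    simp only [bounded]
    induction d using Num.induction with
    | definable => infer_instance
    | zero => rwa [add_zero, ← bounded, imp_iff_right hst]
    | succ d ih =>
      intro hd
      rw [← add_assoc] at hd
      have row := (bounded _).2 (ih (by grind))
      rw [← add_assoc, ← bounded, isSingleRow_zero_iff]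
      exact fun j hj => (isDot_single_left_iff (y := fun r => X.mat r j) hp row
        (fun _ _ => isCoded_mat X _ _) isInt_zero).1 (h.2 (s + d) (by grind) i j ⟨hi, hj⟩)
  obtain ⟨d, rfl⟩ := exists_add_of_le hst
  exact isSingleRow_add d le_rfl

theorem isSingleRow_of_dead_end {X : M.Str} (h : IsPowSeq m X.mat t W) (hi : InRange i m)
    (hp : InRange p m) (hst : s ≤ t) (row : IsSingleRow m (W.matSeq s) i p a)
    (hX : IsSingleRow m X.mat p p 0) :
    IsSingleRow m (W.matSeq t) i p (if t = s then a else 0) := by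
  split_ifs with ht
  · exact ht ▸ row
  · have row' := h.isSingleRow_add_one (lt_of_le_of_ne hst (Ne.symm ht)) hi hp row hX
    rw [mul_zero] at row'
    exact h.isSingleRow_eq_zero hi hp row' (Num.add_one_le_of_lt (lt_of_le_of_ne hst (Ne.symm ht)))

end IsPowSeq

/-! ### Entries of the Berkowitz matrices -/

theorem isMul_one_iff {l n : M.Num} {X Y Z : M.DigitMat} : IsMul 1 l n X Y Z ↔
    ∀ j, InRange j n → IsDot l (fun r => X 1 r) (fun r => Y r j) (Z 1 j) := by
  refine ⟨fun h j hj => h 1 j ⟨⟨le_rfl, le_rfl⟩, hj⟩, fun h i j hij => ?_⟩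
  obtain rfl := le_antisymm hij.1.2 hij.1.1
  exact h j hij.2

theorem exists_isMul_one_of_isSingleRow {Y : M.DigitMat} (hp : InRange p m)
    (hX : IsSingleRow m X 1 p a) (hY : ∀ i j, InRange i m ∧ InRange j m → (Y i j).IsCoded)
    (row : IsSingleRow m Y p q b) : ∃ Z : M.Str, IsMul 1 m m X Y Z.mat := by
  obtain ⟨Z, hZ⟩ := Str.exists_mat_row_eq_single q (a * b) m
  exact ⟨Z, isMul_one_iff.2 fun j hj => (isDot_iff_of_isSingleRow hp hX
    (fun r hr => hY r j ⟨hr, hj⟩) row hj).2 (hZ j hj.2)⟩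

theorem exists_isPow (t : M.Num) {X : M.Str} (hX : IsIntOn m m X.mat) :
    ∃ Y : M.Str, IsPow m X.mat t Y.mat :=
  (sat_matrixPowering (fun _ => 0) (fun _ => X)).1
    (VSharpLModel.validIn matrixPowering (Or.inr (by simp)) _ _) m t X hX

/-- Only the path through the nonzero entries of `R`, `J` and the powers of `M J` to the nonzero
entry of `S` contributes to `R J (M J) ^ t S`. -/
theorem isBerkowitzEntry_iff {A : M.Str} {f g c₀ c' : M.Num} {a' : SignType} {Z : M.Digits}
    (hA : IsIntOn (2 * f) (2 * f) (minor g A.mat)) {C : M.DigitMat} (hC : minor 2 C = minor g A.mat)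
    (hR : IsSingleRow (2 * f) (fun _ j => C 1 (2 + j)) 1 c₀ a) (hc₀ : InRange c₀ (2 * f))
    (hJ : IsJEntry c₀ i b)
    (hS : ∀ j, InRange j (2 * f) → C (2 + j) 2 = single c' a' j) (hc' : InRange c' (2 * f))
    (hpow : ∀ X W : M.Str, IsMul (2 * f) (2 * f) (2 * f) (minor g A.mat) J X.mat →
      IsPowSeq (2 * f) X.mat t W → IsSingleRow (2 * f) (W.matSeq t) i p v) :
    IsBerkowitzEntry (2 * f) C t Z ↔ Z = single p (a' * (a * b * v)) c' := by
  have hi := hJ.inRange_right hc₀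
  have one_inRange : InRange (1 : M.Num) 1 := ⟨le_rfl, le_rfl⟩
  have pow_row {X G : M.Str} (hX : IsMul (2 * f) (2 * f) (2 * f) (minor 2 C) J X.mat)
      (hG : IsPow (2 * f) X.mat t G.mat) : IsSingleRow (2 * f) G.mat i p v := by
    obtain ⟨W, hW, hGW⟩ := isPow_iff.1 hG
    exact fun j hj => (hGW i j ⟨hi, hj⟩).trans (hpow X W (hC ▸ hX) hW j hj)
  have row_iff {V : M.Str} (hV : IsSingleRow (2 * f) V.mat 1 p (a * b * v)) :
      IsMul 1 (2 * f) 1 V.mat (fun i _ => C (2 + i) 2) (fun _ _ => Z) ↔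
        Z = single p (a' * (a * b * v)) c' := by
    have smul_eq : a' • V.mat 1 c' = single p (a' * (a * b * v)) c' := by
      rw [hV c' hc', smul_single]
    rw [isMul_one_iff, ← smul_eq, ← isDot_single_right_iff (x := V.mat 1) hc'
      (fun _ _ => isCoded_mat V _ _) hS (smul_eq ▸ isInt_single p _ c')]
    exact ⟨fun h => h 1 one_inRange, fun h _ _ => h⟩
  constructor
  · rintro ⟨X, G, RJ, V, hX, hG, hRJ, hV, hZ⟩
    have row_RJ := hRJ.isSingleRow_J one_inRange hc₀ hR hJ
    exact (row_iff (hV.isSingleRow one_inRange hi row_RJ (fun _ _ _ => isCoded_mat G _ _)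
      (pow_row hX hG))).1 hZ
  · intro hZ
    obtain ⟨X, hX⟩ := exists_isMul_J f g A hA
    obtain ⟨G, hG⟩ := exists_isPow t (hX.isIntOn_J (fun _ _ _ => isCoded_mat A _ _) hA)
    obtain ⟨RJ, hRJ⟩ := exists_isMul_one_of_isSingleRow hc₀ hR
      (fun i j hij => isCoded_J hij.1.1 j) fun r _ => hJ.J_row_eq r
    have row_RJ := hRJ.isSingleRow_J one_inRange hc₀ hR hJ
    rw [← hC] at hX
    obtain ⟨V, hV⟩ := exists_isMul_one_of_isSingleRow hi row_RJ (fun _ _ _ => isCoded_mat G _ _)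
      (pow_row hX hG)
    exact ⟨X, G, RJ, V, hX, hG, hRJ, hV, (row_iff (hV.isSingleRow one_inRange hi row_RJ
      (fun _ _ _ => isCoded_mat G _ _) (pow_row hX hG))).2 hZ⟩

end DigitMat

namespace Digits

theorem single_apply (c : M.Num) (a : SignType) (r b : M.Num) :
    single c a r b ↔ r = c ∧ (a • (1 : M.Digits)) b := by
  rcases eq_or_ne r c with rfl | hr
  · simp only [single_self, true_and]
  · exact iff_of_false (by rw [single_of_ne hr]; exact _root_.id) fun h => hr h.1

theorem single_add_add (g c : M.Num) (a : SignType) (r : M.Num) :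
    single (g + c) a (g + r) = single c a r := by
  simp only [single, add_right_inj]

theorem neg_single (c : M.Num) (a : SignType) (r : M.Num) : -single c a r = single c (-a) r := by
  rw [← Digits.neg_one_smul, smul_single, neg_one_mul]

end Digits

/-! ### The entries of the block matrix -/

namespace DigitMat

variable {n k : M.Num} {i j j' : M.Num} {a a' : SignType}

theorem swap_eq_single (k i j : M.Num) :
    (swap k i j : M.Digits) = single (Equiv.swap k (k + 1) i) 1 j := by
  funext b
  simp only [swap, id_eq_single, single_apply]
  grind

/-- The entry of the matrix of the theorem at the position `(i, j)` is `a ≠ 0`. -/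
def IsBlockEntry (n k i j : M.Num) (a : SignType) : Prop :=
  (i ≤ 2 * n ∧ j = 2 * n + Equiv.swap k (k + 1) i ∧ a = 1) ∨
    (j ≤ 2 * n ∧ i = 2 * n + Equiv.swap k (k + 1) j ∧ a = -1)

theorem IsBlockEntry.symm (h : IsBlockEntry n k i j a) : IsBlockEntry n k j i (-a) := by
  obtain ⟨hi, hj, rfl⟩ | ⟨hj, hi, rfl⟩ := h
  · exact Or.inr ⟨hi, hj, rfl⟩
  · exact Or.inl ⟨hj, hi, neg_neg 1⟩

theorem one_le_swap (hk : 1 ≤ k) (hi : 1 ≤ i) : 1 ≤ Equiv.swap k (k + 1) i := by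
  grind

theorem IsBlockEntry.unique (hk : 1 ≤ k) (hj : 1 ≤ j) (hj' : 1 ≤ j')
    (h : IsBlockEntry n k i j a) (h' : IsBlockEntry n k i j' a') : j = j' ∧ a = a' := by
  have := one_le_swap hk hj
  have := one_le_swap hk hj'
  obtain ⟨hi, rfl, rfl⟩ | ⟨-, hi, rfl⟩ := h <;> obtain ⟨hi', rfl, rfl⟩ | ⟨-, hi', rfl⟩ := h'
  · exact ⟨rfl, rfl⟩
  · grind
  · grind
  · exact ⟨(Equiv.swap k (k + 1)).injective (add_left_cancel (hi.symm.trans hi')), rfl⟩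

theorem exists_isBlockEntry_of_lt (hk : 1 ≤ k) (hkn : k < 2 * n) (hi : 2 * n < i)
    (hin : i ≤ 2 * (2 * n)) : ∃ j, InRange j (2 * n) ∧ IsBlockEntry n k i j (-1) := by
  obtain ⟨h, rfl⟩ := exists_add_of_le hi.le
  have inRange : InRange (Equiv.swap k (k + 1) h) (2 * n) := by unfold InRange; grind
  exact ⟨_, inRange, Or.inr ⟨inRange.2, by rw [Equiv.swap_apply_self], rfl⟩⟩

theorem blockSwap_apply_iff (hk : 1 ≤ k) (hi : 1 ≤ i) (hj : 1 ≤ j) (b : M.Num) :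
    blockSwap n k i j b ↔ ∃ a, IsBlockEntry n k i j a ∧ (a • (1 : M.Digits)) b := by
  simp only [blockSwap, antidiag, swap_eq_single, neg_single, single_apply]
  constructor
  · rintro (⟨h, hi, -, rfl, rfl, hb⟩ | ⟨h, hj, -, rfl, rfl, hb⟩)
    · exact ⟨1, Or.inl ⟨hi, rfl, rfl⟩, hb⟩
    · exact ⟨-1, Or.inr ⟨hj, by rw [Equiv.swap_apply_self], rfl⟩, hb⟩
  · rintro ⟨_, ⟨hi', rfl, rfl⟩ | ⟨hj', rfl, rfl⟩, hb⟩
    · exact Or.inl ⟨_, hi', one_le_swap hk hi, rfl, rfl, hb⟩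
    · exact Or.inr ⟨_, hj', one_le_swap hk hj, rfl, (Equiv.swap_apply_self _ _ _).symm, hb⟩

theorem blockSwap_row_eq (hk : 1 ≤ k) (hi : 1 ≤ i) (hj : 1 ≤ j) (h : IsBlockEntry n k i j a)
    {r : M.Num} (hr : 1 ≤ r) : blockSwap n k i r = single j a r := by
  funext b
  rw [blockSwap_apply_iff hk hi hr, single_apply]
  refine propext ⟨?_, ?_⟩
  · rintro ⟨a', h', hb⟩
    obtain ⟨rfl, rfl⟩ := h.unique hk hj hr h'
    exact ⟨rfl, hb⟩
  · rintro ⟨rfl, hb⟩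
    exact ⟨a, h, hb⟩

theorem blockSwap_col_eq (hk : 1 ≤ k) (hi : 1 ≤ i) (hj : 1 ≤ j) (h : IsBlockEntry n k i j a)
    {r : M.Num} (hr : 1 ≤ r) : blockSwap n k r j = single i a r := by
  funext b
  rw [blockSwap_apply_iff hk hr hj, single_apply]
  refine propext ⟨?_, ?_⟩
  · rintro ⟨a', h', hb⟩
    obtain ⟨rfl, h⟩ := h.symm.unique hk hi hr h'.symm
    exact ⟨rfl, neg_injective h ▸ hb⟩
  · rintro ⟨rfl, hb⟩
    exact ⟨a, h, hb⟩

section Minor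

variable {A : M.Str} {f g l p s c₀ c' t : M.Num} {b v : SignType} {Z : M.Digits}

theorem minor_minor (p q : M.Num) (A : M.DigitMat) : minor p (minor q A) = minor (q + p) A := by
  funext i j
  simp only [minor, add_assoc]

theorem EqOn.isSingleRow_blockSwap (hA : EqOn (2 * (2 * n)) (2 * (2 * n)) A.mat (blockSwap n k))
    (hk : 1 ≤ k) (hi : InRange i (2 * (2 * n))) (hj : 1 ≤ j) (h : IsBlockEntry n k i j a) :
    IsSingleRow (2 * (2 * n)) A.mat i j a := fun r hr =>
  (hA i r ⟨hi, hr⟩).trans (blockSwap_row_eq hk hi.1 hj h hr.1)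

theorem IsSingleRow.minor {X : M.DigitMat} (h : IsSingleRow l X (g + i) (g + j) a)
    (hg : g + f = l) : IsSingleRow f (minor g X) i j a := fun r hr => by
  rw [DigitMat.minor, h _ ⟨hr.1.trans le_add_self, by grind [hr.2]⟩, single_add_add]

theorem IsSingleRow.minor_eq_zero {X : M.DigitMat} (h : IsSingleRow l X (g + i) j a)
    (hg : g + f = l) (hj : j ≤ g) : IsSingleRow f (DigitMat.minor g X) i p 0 :=
  isSingleRow_zero_iff.2 fun r hr => by
    rw [DigitMat.minor, h _ ⟨hr.1.trans le_add_self, by grind [hr.2]⟩,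
      single_of_ne (by grind [hr.1])]

theorem isIntOn_minor (hA : EqOn (2 * (2 * n)) (2 * (2 * n)) A.mat (blockSwap n k))
    (hk : 1 ≤ k) (hkn : k < 2 * n) (hg : g + f = 2 * (2 * n)) : IsIntOn f f (minor g A.mat) := by
  rintro i j ⟨hi, hj⟩
  have inRange {r : M.Num} (hr : InRange r f) : InRange (g + r) (2 * (2 * n)) :=
    ⟨hr.1.trans le_add_self, by grind [hr.2]⟩
  obtain ⟨p, a, hp, h⟩ : ∃ p a, 1 ≤ p ∧ IsBlockEntry n k (g + i) p a := by
    rcases le_or_gt (g + i) (2 * n) with h | h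
    · exact ⟨_, _, (one_le_swap hk (inRange hi).1).trans le_add_self, Or.inl ⟨h, rfl, rfl⟩⟩
    · obtain ⟨p, hp, h⟩ := exists_isBlockEntry_of_lt hk hkn h (inRange hi).2
      exact ⟨p, -1, hp.1, h⟩
  rw [minor, hA.isSingleRow_blockSwap hk (inRange hi) hp h _ (inRange hj)]
  exact isInt_single p a _

theorem isBerkowitzEntry_iff_of_isBlockEntry
    (hA : EqOn (2 * (2 * n)) (2 * (2 * n)) A.mat (blockSwap n k)) (hk : 1 ≤ k) (hkn : k < 2 * n)
    (hf : s + 1 + f = 2 * n) (hR : IsBlockEntry n k (2 * s + 1) (2 * s + 2 + c₀) 1)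
    (hJ : IsJEntry c₀ i b) (hS : IsBlockEntry n k (2 * s + 2 + c') (2 * s + 2) (-1))
    (hc₀ : InRange c₀ (2 * f)) (hc' : InRange c' (2 * f))
    (hpow : ∀ X W : M.Str,
      IsMul (2 * f) (2 * f) (2 * f) (minor (2 * s + 2) A.mat) J X.mat →
      IsPowSeq (2 * f) X.mat t W → IsSingleRow (2 * f) (W.matSeq t) i p v) :
    IsBerkowitzEntry (2 * f) (minor (2 * s) A.mat) t Z ↔ Z = single p (-(b * v)) c' := by
  rw [isBerkowitzEntry_iff (a := 1) (a' := -1) (isIntOn_minor hA hk hkn (by grind))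
    (minor_minor _ _ _) (fun j hj => ?_) hc₀ hJ (fun j hj => ?_) hc' hpow, one_mul, neg_one_mul]
  · simp only [minor, ← add_assoc]
    rw [hA _ _ ⟨⟨le_add_self, by grind⟩, ⟨by grind [hj.1], by grind [hj.2]⟩⟩,
      blockSwap_row_eq hk le_add_self (by grind) hR (by grind [hj.1]), single_add_add]
  · simp only [minor, ← add_assoc]
    rw [hA _ _ ⟨⟨by grind [hj.1], by grind [hj.2]⟩, ⟨by grind, by grind⟩⟩,
      blockSwap_col_eq hk (by grind) (by grind) hS (by grind [hj.1]), single_add_add]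

end Minor

end DigitMat

/-! ### The Berkowitz matrices of the block matrix -/

namespace DigitMat

variable {A : M.Str} {n k f g i j s c₀ c' t : M.Num} {a b : SignType} {Z : M.Digits}

theorem isSingleRow_mul_J_eq_zero {X : M.DigitMat}
    (hA : EqOn (2 * (2 * n)) (2 * (2 * n)) A.mat (blockSwap n k)) (hk : 1 ≤ k)
    (hX : IsMul (2 * f) (2 * f) (2 * f) (minor g A.mat) J X) (hg : g + 2 * f = 2 * (2 * n))
    (hi : InRange i (2 * f)) (hj : InRange j g) (h : IsBlockEntry n k (g + i) j a) :
    IsSingleRow (2 * f) X i i 0 := by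
  obtain ⟨q, b, hJ⟩ := exists_isJEntry hi.1
  have row := hA.isSingleRow_blockSwap hk ⟨hi.1.trans le_add_self, by grind [hi.2]⟩ hj.1 h
  have row' := hX.isSingleRow_J hi hi (row.minor_eq_zero hg hj.2) hJ
  exact (zero_mul b ▸ row').zero i

theorem isBerkowitzEntry_iff_of_dead_end
    (hA : EqOn (2 * (2 * n)) (2 * (2 * n)) A.mat (blockSwap n k)) (hk : 1 ≤ k) (hkn : k < 2 * n)
    (hf : s + 1 + f = 2 * n) (hR : IsBlockEntry n k (2 * s + 1) (2 * s + 2 + c₀) 1)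
    (hJ : IsJEntry c₀ i b) (hS : IsBlockEntry n k (2 * s + 2 + c') (2 * s + 2) (-1))
    (hc₀ : InRange c₀ (2 * f)) (hc' : InRange c' (2 * f)) (hj : InRange j (2 * s + 2))
    (h : IsBlockEntry n k (2 * s + 2 + i) j a) :
    IsBerkowitzEntry (2 * f) (minor (2 * s) A.mat) t Z ↔
      Z = single i (-(b * if t = 0 then 1 else 0)) c' := by
  have hi := hJ.inRange_right hc₀
  exact isBerkowitzEntry_iff_of_isBlockEntry hA hk hkn hf hR hJ hS hc₀ hc' fun X W hX hW =>
    hW.isSingleRow_of_dead_end hi hi zero_le (hW.isSingleRow_zero hi)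
      (isSingleRow_mul_J_eq_zero hA hk hX (by grind) hi hj h)

theorem row_col_eq_zero_of_lt (hA : EqOn (2 * (2 * n)) (2 * (2 * n)) A.mat (blockSwap n k))
    (hk : 1 ≤ k) (hkn : k < 2 * n) (hi : 2 * n < i) (hij : i < j) (hj : j ≤ 2 * (2 * n)) :
    A.mat i j = 0 ∧ A.mat j i = 0 := by
  have inRange_i : InRange i (2 * (2 * n)) := ⟨by grind, hij.le.trans hj⟩
  have inRange_j : InRange j (2 * (2 * n)) := ⟨by grind, hj⟩
  obtain ⟨p, hp, h⟩ := exists_isBlockEntry_of_lt hk hkn hi inRange_i.2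
  have ne : j ≠ p := by grind [hp.2]
  rw [hA _ _ ⟨inRange_i, inRange_j⟩, hA _ _ ⟨inRange_j, inRange_i⟩,
    blockSwap_row_eq hk inRange_i.1 hp.1 h inRange_j.1,
    blockSwap_col_eq hk hp.1 inRange_i.1 h.symm inRange_j.1]
  exact ⟨single_of_ne ne _, single_of_ne ne _⟩

theorem isBerkowitzEntry_iff_of_le (hA : EqOn (2 * (2 * n)) (2 * (2 * n)) A.mat (blockSwap n k))
    (hk : 1 ≤ k) (hkn : k < 2 * n) (hf : s + 1 + f = 2 * n) (hf1 : 1 ≤ f) (hs : n ≤ s) :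
    IsBerkowitzEntry (2 * f) (minor (2 * s) A.mat) t Z ↔ Z = 0 := by
  have two_mul_hf : 2 * s + 2 + 2 * f = 2 * (2 * n) := by grind
  have entry_eq_zero {q j : M.Num} (hq : q ≤ 2) (hq' : 1 ≤ q) (hj : InRange j (2 * f)) :
      A.mat (2 * s + q) (2 * s + (2 + j)) = 0 ∧ A.mat (2 * s + (2 + j)) (2 * s + q) = 0 :=
    row_col_eq_zero_of_lt hA hk hkn (by grind) (by grind [hj.1]) (by grind [hj.2])
  have hJ : IsJEntry (1 : M.Num) 2 1 := Or.inl ⟨0, by grind, by grind, rfl⟩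
  have inRange_one : InRange 1 (2 * f) := ⟨le_rfl, by grind⟩
  have inRange_two := hJ.inRange_right inRange_one
  obtain ⟨j, hj, h⟩ := exists_isBlockEntry_of_lt hk hkn (i := 2 * s + 2 + 2) (by grind)
    (by grind [inRange_two.2])
  have dead_end (X W : M.Str) (hX : IsMul (2 * f) (2 * f) (2 * f) (minor (2 * s + 2) A.mat) J X.mat)
      (hW : IsPowSeq (2 * f) X.mat t W) :=
    hW.isSingleRow_of_dead_end inRange_two inRange_two zero_le (hW.isSingleRow_zero inRange_two)
      (isSingleRow_mul_J_eq_zero hA hk hX two_mul_hf inRange_two ⟨hj.1, by grind [hj.2]⟩ h)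
  have row : IsSingleRow (2 * f) (fun _ j => minor (2 * s) A.mat 1 (2 + j)) 1 1 0 :=
    isSingleRow_zero_iff.2 fun j hj => (entry_eq_zero (by grind) le_rfl hj).1
  have col (j : M.Num) (hj : InRange j (2 * f)) :
      minor (2 * s) A.mat (2 + j) 2 = single 1 0 j :=
    (entry_eq_zero le_rfl (by grind) hj).2.trans (single_zero 1 j).symm
  rw [isBerkowitzEntry_iff (isIntOn_minor hA hk hkn two_mul_hf) (minor_minor _ _ _)
    row inRange_one hJ col inRange_one dead_end, zero_mul, single_zero]

theorem isBerkowitzEntry_iff_of_eq_two_mul_add_one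
    (hA : EqOn (2 * (2 * n)) (2 * (2 * n)) A.mat (blockSwap n k)) (hs : s < n)
    (hf : s + 1 + f = 2 * n) (hk : k = 2 * s + 1) :
    IsBerkowitzEntry (2 * f) (minor (2 * s) A.mat) t Z ↔
      Z = (if t = 0 then 1 else 0 : SignType) • 1 := by
  obtain ⟨h, rfl⟩ := Num.exists_add_one_eq (zero_le.trans_lt hs).ne'
  subst hk
  rw [isBerkowitzEntry_iff_of_dead_end hA le_add_self (by grind) hf (c₀ := 2 * h + 2)
    (i := 2 * h + 1) (c' := 2 * h + 1) (j := 2 * s + 2) (a := -1)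
    (Or.inl ⟨by grind, by grind, rfl⟩) (Or.inr ⟨h, rfl, rfl, rfl⟩)
    (Or.inr ⟨by grind, by grind, rfl⟩) ⟨by grind, by grind⟩ ⟨by grind, by grind⟩
    ⟨by grind, by grind⟩ (Or.inr ⟨by grind, by grind, rfl⟩), single_self, neg_one_mul, neg_neg]

theorem isBerkowitzEntry_iff_of_eq_two_mul
    (hA : EqOn (2 * (2 * n)) (2 * (2 * n)) A.mat (blockSwap n k)) (hs : s < n)
    (hf : s + 1 + f = 2 * n) (hk : 1 ≤ k) (hks : k = 2 * s) :
    IsBerkowitzEntry (2 * f) (minor (2 * s) A.mat) t Z ↔ Z = 0 := by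
  subst hks
  obtain ⟨r, rfl⟩ := Num.exists_add_one_eq (show s ≠ 0 by rintro rfl; grind)
  obtain ⟨e, rfl⟩ := exists_add_of_le (Num.add_one_le_of_lt hs)
  rw [isBerkowitzEntry_iff_of_dead_end hA hk (by grind) hf (c₀ := 2 * (r + e) + 2)
    (i := 2 * (r + e) + 1) (c' := 2 * (r + 1 + 1 + e)) (j := 2 * r + 1) (a := -1)
    (Or.inl ⟨by grind, by grind, rfl⟩) (Or.inr ⟨r + e, rfl, rfl, rfl⟩)
    (Or.inr ⟨by grind, by grind, rfl⟩) ⟨by grind, by grind⟩ ⟨by grind, by grind⟩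
    ⟨by grind, by grind⟩ (Or.inr ⟨by grind, by grind, rfl⟩), single_of_ne (by grind)]

theorem isBerkowitzEntry_iff_of_ne
    (hA : EqOn (2 * (2 * n)) (2 * (2 * n)) A.mat (blockSwap n k)) (hk : 1 ≤ k) (hkn : k < 2 * n)
    (hs : s < n) (hf : s + 1 + f = 2 * n) (hk₀ : k ≠ 2 * s) (hk₁ : k ≠ 2 * s + 1)
    (hk₂ : k ≠ 2 * s + 2) :
    IsBerkowitzEntry (2 * f) (minor (2 * s) A.mat) t Z ↔
      Z = (if t = 0 then -1 else 0 : SignType) • 1 := by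
  obtain ⟨h, rfl⟩ := Num.exists_add_one_eq (zero_le.trans_lt hs).ne'
  rw [isBerkowitzEntry_iff_of_dead_end hA hk (by grind) hf (c₀ := 2 * h + 1)
    (i := 2 * h + 2) (c' := 2 * h + 2) (j := 2 * s + 2) (a := -1)
    (Or.inl ⟨by grind, by grind, rfl⟩) (Or.inl ⟨h, rfl, rfl, rfl⟩)
    (Or.inr ⟨by grind, by grind, rfl⟩) ⟨by grind, by grind⟩ ⟨by grind, by grind⟩
    ⟨by grind, by grind⟩ (Or.inr ⟨by grind, by grind, rfl⟩), single_self, one_mul]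
  split_ifs <;> rfl

theorem isSingleRow_mul_J {X : M.DigitMat} {p q : M.Num}
    (hA : EqOn (2 * (2 * n)) (2 * (2 * n)) A.mat (blockSwap n k)) (hk : 1 ≤ k)
    (hX : IsMul (2 * f) (2 * f) (2 * f) (minor g A.mat) J X) (hg : g + 2 * f = 2 * (2 * n))
    (hi : InRange i (2 * f)) (hp : InRange p (2 * f)) (h : IsBlockEntry n k (g + i) (g + p) a)
    (hJ : IsJEntry p q b) : IsSingleRow (2 * f) X i q (a * b) :=
  hX.isSingleRow_J hi hp ((hA.isSingleRow_blockSwap hk ⟨hi.1.trans le_add_self, by grind [hi.2]⟩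
    (hp.1.trans le_add_self) h).minor hg) hJ

theorem IsPowSeq.isSingleRow_of_path {X W : M.Str} {m p q r : M.Num} (hW : IsPowSeq m X.mat t W)
    (hp : InRange p m) (hq : InRange q m) (hr : InRange r m) (hpq : IsSingleRow m X.mat p q a)
    (hqr : IsSingleRow m X.mat q r b) (hX : IsSingleRow m X.mat r r 0) (ht : 2 ≤ t) :
    IsSingleRow m (W.matSeq t) p r (if t = 2 then a * b else 0) := by
  have row_one :=
    hW.isSingleRow_add_one (zero_lt_two.trans_le ht) hp hp (hW.isSingleRow_zero hp) hpq
  have row_two := hW.isSingleRow_add_one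
    ((zero_add (1 : M.Num)).trans_lt (one_lt_two.trans_le ht)) hp hq row_one hqr
  rw [one_mul, zero_add, one_add_one_eq_two] at row_two
  exact hW.isSingleRow_of_dead_end hp hr ht row_two hX

theorem isBerkowitzEntry_iff_of_path {p p' q : M.Num} {a₁ b₁ a₂ b₂ : SignType}
    (hA : EqOn (2 * (2 * n)) (2 * (2 * n)) A.mat (blockSwap n k)) (hk : 1 ≤ k) (hkn : k < 2 * n)
    (hf : s + 1 + f = 2 * n) (hR : IsBlockEntry n k (2 * s + 1) (2 * s + 2 + c₀) 1)
    (hJ : IsJEntry c₀ i b) (hS : IsBlockEntry n k (2 * s + 2 + c') (2 * s + 2) (-1))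
    (hc₀ : InRange c₀ (2 * f)) (hc' : InRange c' (2 * f)) (hp : InRange p (2 * f))
    (h₁ : IsBlockEntry n k (2 * s + 2 + i) (2 * s + 2 + p) a₁) (hJ₁ : IsJEntry p q b₁)
    (h₂ : IsBlockEntry n k (2 * s + 2 + q) (2 * s + 2 + p') a₂) (hJ₂ : IsJEntry p' c' b₂)
    (hj : InRange j (2 * s + 2)) (h₃ : IsBlockEntry n k (2 * s + 2 + c') j a) (hic' : c' ≠ i)
    (hqc' : c' ≠ q) :
    IsBerkowitzEntry (2 * f) (minor (2 * s) A.mat) t Z ↔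
      Z = (if t = 2 then -(b * (a₁ * b₁ * (a₂ * b₂))) else 0 : SignType) • 1 := by
  have hg : 2 * s + 2 + 2 * f = 2 * (2 * n) := by grind
  have hi := hJ.inRange_right hc₀
  have hq := hJ₁.inRange_right hp
  have hp' := hJ₂.symm.inRange_right hc'
  have iff_of_row {p : M.Num} {v : SignType} (hpow) := isBerkowitzEntry_iff_of_isBlockEntry
    (t := t) (Z := Z) (p := p) (v := v) hA hk hkn hf hR hJ hS hc₀ hc' hpow
  obtain rfl | rfl | ht : t = 0 ∨ t = 1 ∨ 1 + 1 ≤ t := by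
    rcases lt_trichotomy t 1 with _ | _ | _ <;> grind
  · rw [iff_of_row fun X W _ hW => hW.isSingleRow_zero hi, single_of_ne hic',
      if_neg two_ne_zero.symm, Digits.zero_smul]
  · rw [iff_of_row fun X W hX hW => zero_add (1 : M.Num) ▸ hW.isSingleRow_add_one zero_lt_one
        hi hi (hW.isSingleRow_zero hi) (isSingleRow_mul_J hA hk hX hg hi hp h₁ hJ₁),
      single_of_ne hqc', if_neg one_lt_two.ne, Digits.zero_smul]
  · rw [iff_of_row fun X W hX hW => hW.isSingleRow_of_path hi hq hc'
      (isSingleRow_mul_J hA hk hX hg hi hp h₁ hJ₁) (isSingleRow_mul_J hA hk hX hg hq hp' h₂ hJ₂)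
      (isSingleRow_mul_J_eq_zero hA hk hX hg hc' hj h₃) (one_add_one_eq_two.symm.trans_le ht),
      single_self]
    split_ifs
    · rfl
    · rw [mul_zero, neg_zero]

theorem isBerkowitzEntry_iff_of_eq_two_mul_add_two
    (hA : EqOn (2 * (2 * n)) (2 * (2 * n)) A.mat (blockSwap n k)) (hkn : k < 2 * n)
    (hf : s + 1 + f = 2 * n) (hk : k = 2 * s + 2) :
    IsBerkowitzEntry (2 * f) (minor (2 * s) A.mat) t Z ↔
      Z = (if t = 2 then -1 else 0 : SignType) • 1 := by
  subst hk
  have hs : s + 1 < n := by rcases lt_or_ge (s + 1) n with _ | _ <;> grind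
  obtain ⟨h, rfl⟩ := exists_add_of_le (Num.add_one_le_of_lt hs)
  rw [isBerkowitzEntry_iff_of_path hA (le_add_self.trans' (by grind)) hkn hf
    (c₀ := 2 * (s + 1 + h) + 1) (i := 2 * (s + 1 + h) + 2) (b := 1) (p := 1) (q := 2)
    (p' := 2 * (s + 1 + h) + 2 + 1 + 1) (c' := 2 * (s + 1 + h) + 2 + 1) (j := 2 * s + 2)
    (a₁ := -1) (b₁ := 1) (a₂ := 1) (b₂ := -1) (a := -1)
    (Or.inl ⟨by grind, by grind, rfl⟩) (Or.inl ⟨s + 1 + h, rfl, rfl, rfl⟩)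
    (Or.inr ⟨by grind, by grind, rfl⟩) ⟨by grind, by grind⟩ ⟨by grind, by grind⟩
    ⟨le_rfl, by grind⟩ (Or.inr ⟨by grind, by grind, rfl⟩) (Or.inl ⟨0, by grind, by grind, rfl⟩)
    (Or.inl ⟨by grind, by grind, rfl⟩) (Or.inr ⟨s + 1 + h + 1, by grind, by grind, rfl⟩)
    ⟨by grind, by grind⟩ (Or.inr ⟨by grind, by grind, rfl⟩) (by grind) (by grind)]
  split_ifs <;> rfl

/-- The Berkowitz matrix of the `s`-th minor of the block matrix has ones on its diagonal and at
most one further nonzero subdiagonal; `stageShift k s` is the distance between the two. -/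
noncomputable def stageShift (k s : M.Num) : M.Num := if k = 2 * s + 2 then 4 else 2

/-- The entries of the Berkowitz matrix of the `s`-th minor of the block matrix on the subdiagonal
given by `stageShift`. -/
noncomputable def stageSign (n k s : M.Num) : SignType :=
  if n ≤ s then 0 else if k = 2 * s + 1 then 1 else if k = 2 * s then 0 else -1

theorem isBerkowitzEntry_iff_eq_stageSign
    (hA : EqOn (2 * (2 * n)) (2 * (2 * n)) A.mat (blockSwap n k)) (hk : 1 ≤ k) (hkn : k < 2 * n)
    (hf : s + 1 + f = 2 * n) (hf1 : 1 ≤ f) :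
    IsBerkowitzEntry (2 * f) (minor (2 * s) A.mat) t Z ↔
      Z = (if t + 2 = stageShift k s then stageSign n k s else 0) • 1 := by
  have add_two_eq_two : t + 2 = 2 ↔ t = 0 := by rw [add_eq_right]
  have add_two_eq_four : t + 2 = 4 ↔ t = 2 := by
    rw [show (4 : M.Num) = 2 + 2 by norm_num, add_left_inj]
  have zero_eq : (0 : M.Digits) = (0 : SignType) • 1 := (Digits.zero_smul 1).symm
  rcases le_or_gt n s with hs | hs
  · rw [isBerkowitzEntry_iff_of_le hA hk hkn hf hf1 hs, stageSign, if_pos hs, ite_self, zero_eq]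
  rw [stageShift, stageSign, if_neg hs.not_ge]
  rcases eq_or_ne k (2 * s + 1) with hk₁ | hk₁
  · have hk₂ : k ≠ 2 * s + 2 := hk₁.trans_ne (by simp)
    simp only [isBerkowitzEntry_iff_of_eq_two_mul_add_one hA hs hf hk₁, if_pos hk₁, if_neg hk₂,
      add_two_eq_two]
  rcases eq_or_ne k (2 * s) with hk₀ | hk₀
  · rw [isBerkowitzEntry_iff_of_eq_two_mul hA hs hf hk hk₀, if_neg hk₁, if_pos hk₀, ite_self,
      zero_eq]
  rw [if_neg hk₁, if_neg hk₀]
  rcases eq_or_ne k (2 * s + 2) with hk₂ | hk₂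
  · simp only [isBerkowitzEntry_iff_of_eq_two_mul_add_two hA hkn hf hk₂, if_pos hk₂,
      add_two_eq_four]
  · simp only [isBerkowitzEntry_iff_of_ne hA hk hkn hs hf hk₀ hk₁ hk₂, if_neg hk₂, add_two_eq_two]

/-- The Berkowitz matrix of the `s`-th minor of the block matrix. -/
noncomputable def toeplitz (n k s i j : M.Num) : SignType :=
  if i = j then 1 else if i = j + stageShift k s then stageSign n k s else 0

theorem isDefinable_eq_add_stageShift {m : ℕ} (k : M.Num) (f g h : (Fin m → M.Num) → M.Num)
    [IsTermFun f] [IsTermFun g] [IsTermFun h] :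
    IsDefinable fun z => f z = g z + stageShift k (h z) := by
  refine .congr (p := fun z => (k = 2 * h z + 2 ∧ f z = g z + 4) ∨
    (¬k = 2 * h z + 2 ∧ f z = g z + 2)) inferInstance fun z => ?_
  unfold stageShift
  split_ifs with hk <;> simp [hk]

instance {m : ℕ} (n k : M.Num) (f g h : (Fin m → M.Num) → M.Num) (a : SignType)
    [IsTermFun f] [IsTermFun g] [IsTermFun h] :
    IsDefinable fun z => toeplitz n k (f z) (g z) (h z) = a := by
  have := isDefinable_eq_add_stageShift k g h f
  unfold toeplitz stageSign
  infer_instance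

theorem exists_mat_eq_toeplitz (n k s I J : M.Num) :
    ∃ P : M.Str, ∀ i ≤ I, ∀ j ≤ J, P.mat i j = toeplitz n k s i j • 1 :=
  Str.exists_mat_eq_smul_one (toeplitz n k s) I J

variable {d : M.Num}

theorem toeplitz_self (n k s i : M.Num) : toeplitz n k s i i = 1 :=
  if_pos rfl

theorem toeplitz_add_two_add (n k s j t : M.Num) : toeplitz n k s (j + 2 + t) j =
    if t + 2 = stageShift k s then stageSign n k s else 0 := by
  have ne : j + 2 + t ≠ j := by rw [add_assoc]; exact (lt_add_of_pos_right j (by simp)).ne'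
  rw [toeplitz, if_neg ne]
  simp only [add_assoc, add_right_inj, add_comm 2 t]

theorem two_le_stageShift (k s : M.Num) : 2 ≤ stageShift k s := by
  unfold stageShift
  split_ifs <;> norm_num

theorem toeplitz_of_lt (h : i < j) : toeplitz n k s i j = 0 := by
  rw [toeplitz, if_neg h.ne, if_neg (h.trans_le le_self_add).ne]

theorem toeplitz_add_one (n k s j : M.Num) : toeplitz n k s (j + 1) j = 0 := by
  rw [toeplitz, if_neg (by simp), if_neg]
  rw [add_right_inj]
  exact (one_lt_two.trans_le (two_le_stageShift k s)).ne

theorem minor_one_two_eq_zero (hA : EqOn (2 * (2 * n)) (2 * (2 * n)) A.mat (blockSwap n k))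
    (hk : 1 ≤ k) (hkn : k < 2 * n) (hs : s < 2 * n) : minor (2 * s) A.mat 1 2 = 0 := by
  have bound : 2 * s + 1 < 2 * s + 2 := by gcongr; exact one_lt_two
  have inRange : InRange (2 * s + 2) (2 * (2 * n)) := ⟨by grind, by grind⟩
  rcases lt_or_ge (2 * n) (2 * s + 1) with h | h
  · exact (row_col_eq_zero_of_lt hA hk hkn h bound inRange.2).1
  · have hj : 1 ≤ 2 * n + Equiv.swap k (k + 1) (2 * s + 1) :=
      (one_le_swap hk le_add_self).trans le_add_self
    rw [minor, hA.isSingleRow_blockSwap hk ⟨le_add_self, by grind⟩ hj (Or.inl ⟨h, rfl, rfl⟩) _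
      inRange, single_of_ne]
    have : s < n := by rcases lt_or_ge s n with _ | _ <;> grind
    grind [one_le_swap hk (i := 2 * s + 1) le_add_self]

theorem isBerkowitzMat_iff (hA : EqOn (2 * (2 * n)) (2 * (2 * n)) A.mat (blockSwap n k))
    (hk : 1 ≤ k) (hkn : k < 2 * n) (hd : s + d = 2 * n) (hd' : 2 ≤ d) {P : M.DigitMat} :
    IsBerkowitzMat d (minor (2 * s) A.mat) P ↔
      EqOn (d + 1) d P fun i j => toeplitz n k s i j • 1 := by
  obtain ⟨f, rfl⟩ := exists_add_of_le hd'
  have two_eq : 2 * (2 + f) = 2 * (f + 1) + 2 := by grind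
  have hs : s < 2 * n := hd ▸ lt_add_of_pos_right s (by simp)
  have entry_iff {t : M.Num} {Z : M.Digits} :=
    isBerkowitzEntry_iff_eq_stageSign (s := s) (f := f + 1) (t := t) (Z := Z) hA hk hkn
      (by rw [← hd]; ring) le_add_self
  refine forall₃_congr fun i j _ => ⟨?_, fun h => ?_⟩ <;> beta_reduce at *
  · rintro ⟨eq_zero, eq_one, eq_minor, entry⟩
    rcases lt_trichotomy i j with h | rfl | h
    · rw [eq_zero h, toeplitz_of_lt h, Digits.zero_smul]
    · rw [eq_one rfl, toeplitz_self, Digits.one_smul]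
    rcases (Num.add_one_le_of_lt h).eq_or_lt' with rfl | h'
    · rw [eq_minor rfl, minor_one_two_eq_zero hA hk hkn hs, toeplitz_add_one, Digits.zero_smul]
    · obtain ⟨t, rfl⟩ := exists_add_of_le (Num.add_one_le_of_lt h')
      rw [add_assoc j, one_add_one_eq_two] at entry ⊢
      rw [toeplitz_add_two_add]
      exact entry_iff.1 (entry t _ ⟨rfl, two_eq.symm⟩)
  · rw [h]
    refine ⟨fun h => ?_, ?_, ?_, ?_⟩
    · rw [toeplitz_of_lt h, Digits.zero_smul]
    · rintro rfl
      rw [toeplitz_self, Digits.one_smul]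
    · rintro rfl
      rw [toeplitz_add_one, Digits.zero_smul, minor_one_two_eq_zero hA hk hkn hs]
    · rintro t e ⟨rfl, he⟩
      obtain rfl := add_right_cancel (he.trans two_eq)
      rw [entry_iff, toeplitz_add_two_add]

/-- The recursion for the coefficient vectors of the minors of the block matrix. -/
def IsRecursion (n k N : M.Num) (Q : M.Str) : Prop :=
  (∀ s, s + 1 = N → Q.mat s 1 = 1 ∧ Q.mat s 2 = 0) ∧
  ∀ s d, s + d = N ∧ 2 ≤ d → ∀ i, InRange i (d + 1) →
    IsDot d (fun r => toeplitz n k s i r • 1) (fun r => Q.mat (s + 1) r) (Q.mat s i)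

theorem isPfaffian_iff (hA : EqOn (2 * (2 * n)) (2 * (2 * n)) A.mat (blockSwap n k))
    (hk : 1 ≤ k) (hkn : k < 2 * n) :
    IsPfaffian (2 * n) A.mat Z ↔ ∃ Q, IsRecursion n k (2 * n) Q ∧ Z = Q.mat 0 (2 * n + 1) := by
  simp only [IsPfaffian, IsRecursion, and_assoc]
  refine exists_congr fun Q => and_congr ?_ (and_congr ?_ Iff.rfl)
  · refine forall₂_congr fun s hs => ?_
    rw [minor_one_two_eq_zero hA hk hkn (Num.add_one_le_iff.1 hs.le)]
  · refine forall₃_congr fun s d hd => ?_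
    simp only [isBerkowitzMat_iff hA hk hkn hd.1 hd.2]
    constructor
    · rintro ⟨P, hP, h⟩ i hi
      exact (h i 1 ⟨hi, le_rfl, le_rfl⟩).congr (fun r hr => hP i r ⟨hi, hr⟩) fun _ _ => rfl
    · intro h
      obtain ⟨P, hP⟩ := exists_mat_eq_toeplitz n k s (d + 1) d
      exact ⟨P, fun i j hij => hP i hij.1.2 j hij.2.2, fun i j hij => (h i hij.1).congr
        (fun r hr => (hP i hij.1.2 r hr.2).symm) fun _ _ => rfl⟩

end DigitMat

open Classical in
theorem Str.exists_mat_eq_smul_one_of_rel (E : M.Num → M.Num → SignType → Prop)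
    [hE : ∀ a, IsDefinable₂ fun i j => E i j a] (unique : ∀ i j a b, E i j a → E i j b → a = b)
    (I J : M.Num) : ∃ Y : M.Str, ∀ i ≤ I, ∀ j ≤ J,
      (∀ a, E i j a → Y.mat i j = a • 1) ∧ ((∀ a, ¬E i j a) → Y.mat i j = 0) := by
  let μ (i j : M.Num) : SignType := if E i j 1 then 1 else if E i j (-1) then -1 else 0
  have (a : SignType) := (hE a).of_terms
  have : IsDefinable₂ fun i j => μ i j = 0 := by unfold μ; infer_instance
  have : IsDefinable₂ fun i j => μ i j = -1 := by unfold μ; infer_instance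
  obtain ⟨Y, hY⟩ := Str.exists_mat_eq_smul_one μ I J
  refine ⟨Y, fun i hi j hj => ⟨fun a ha => ?_, fun h => ?_⟩⟩
  · rw [hY i hi j hj]
    congr 1
    have (b : SignType) : E i j b ↔ b = a := ⟨fun hb => unique i j b a hb ha, fun h => h ▸ ha⟩
    simp only [μ, this]
    cases a <;> decide
  · rw [hY i hi j hj]
    simp only [μ, h, if_false, Digits.zero_smul]

namespace DigitMat

instance {m : ℕ} (n k : M.Num) (f g : (Fin m → M.Num) → M.Num) (a : SignType)
    [IsTermFun f] [IsTermFun g] : IsDefinable fun z => IsBlockEntry n k (f z) (g z) a := by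
  have eq_swap (f g : (Fin m → M.Num) → M.Num) [IsTermFun f] [IsTermFun g] :
      IsDefinable fun z => f z = 2 * n + Equiv.swap k (k + 1) (g z) := by
    refine .congr (p := fun z => (g z = k ∧ f z = 2 * n + (k + 1)) ∨
      (¬g z = k ∧ ((g z = k + 1 ∧ f z = 2 * n + k) ∨
        (¬g z = k + 1 ∧ f z = 2 * n + g z)))) inferInstance fun z => ?_
    rw [Equiv.swap_apply_def]
    split_ifs <;> simp_all
  have := eq_swap f g
  have := eq_swap g f
  unfold IsBlockEntry
  infer_instance

theorem exists_eqOn_blockSwap {n k : M.Num} (hk : 1 ≤ k) (hkn : k < 2 * n) (l : M.Num) :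
    ∃ A : M.Str, EqOn l l A.mat (blockSwap n k) := by
  have unique (i j : M.Num) (a b : SignType) (ha : IsBlockEntry n k i j a)
      (hb : IsBlockEntry n k i j b) : a = b := by
    have (i : M.Num) : i ≤ 2 * n → Equiv.swap k (k + 1) i ≤ 2 * n := by grind
    obtain ⟨_, hj, rfl⟩ | ⟨_, hi, rfl⟩ := ha <;> obtain ⟨_, hj', rfl⟩ | ⟨_, hi', rfl⟩ := hb <;>
      grind
  obtain ⟨A, hA⟩ := Str.exists_mat_eq_smul_one_of_rel (IsBlockEntry n k) unique l l
  refine ⟨A, fun i j ⟨hi, hj⟩ => ?_⟩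
  obtain ⟨eq_smul, eq_zero⟩ := hA i hi.2 j hj.2
  by_cases h : ∃ a, IsBlockEntry n k i j a
  · obtain ⟨a, ha⟩ := h
    rw [eq_smul a ha, blockSwap_row_eq hk hi.1 hj.1 ha hj.1, single_self]
  · rw [eq_zero (not_exists.1 h)]
    funext b
    rw [blockSwap_apply_iff hk hi.1 hj.1]
    exact propext ⟨False.elim, fun ⟨a, ha, _⟩ => h ⟨a, ha⟩⟩

end DigitMat

/-! ### The value of the Pfaffian -/

namespace Digits

theorem negOnePow_two_mul (h : M.Num) : negOnePow (2 * h) = 1 := by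
  have odd_ne : ¬∃ g, 2 * h = 2 * g + 1 := fun ⟨g, hg⟩ => by
    rcases lt_or_ge g h with _ | _ <;> grind
  funext b
  simp only [negOnePow, odd_ne, and_false, or_false]
  rfl

theorem negOnePow_two_mul_add_one (h : M.Num) : negOnePow (2 * h + 1) = -1 := by
  funext b
  rw [← Digits.neg_one_smul, eq_iff_iff, smul_one_apply]
  simp [negOnePow]

theorem negOnePow_add_one (e : M.Num) : negOnePow (e + 1) = -negOnePow e := by
  obtain ⟨h, he | he⟩ := Num.exists_eq_two_mul_add (p := e + 1) le_add_self
  · rw [he, add_right_cancel he, negOnePow_two_mul, negOnePow_two_mul_add_one]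
  · have he' : e = 2 * h + 1 := by grind
    rw [he, he', negOnePow_two_mul_add_one, show 2 * h + 2 = 2 * (h + 1) by ring,
      negOnePow_two_mul, ← Digits.neg_one_smul, ← Digits.neg_one_smul, smul_smul_one]
    rfl

theorem exists_negOnePow_eq (e : M.Num) : ∃ ε : SignType, negOnePow e = ε • 1 := by
  obtain ⟨h, he | he⟩ := Num.exists_eq_two_mul_add (p := e + 1) le_add_self
  · exact ⟨1, by rw [add_right_cancel he, negOnePow_two_mul, Digits.one_smul]⟩
  · have he' : e = 2 * h + 1 := by grind
    exact ⟨-1, by rw [he', negOnePow_two_mul_add_one, Digits.neg_one_smul]⟩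

theorem negOnePow_add_two (e : M.Num) : negOnePow (e + 2) = negOnePow e := by
  obtain ⟨ε, hε⟩ := exists_negOnePow_eq e
  rw [Num.add_two, negOnePow_add_one, negOnePow_add_one, hε, ← Digits.neg_one_smul,
    ← Digits.neg_one_smul, smul_smul_one, smul_smul_one, ← mul_assoc, neg_one_mul, neg_neg, one_mul]

instance {m : ℕ} (f g : (Fin m → M.Num) → M.Num) [IsTermFun f] [IsTermFun g] :
    IsDefinable fun z => negOnePow (f z) (g z) := by
  refine .congr (p := fun z => g z = 1 ∨ g z = 0 ∧ ∃ h ≤ f z, f z = 2 * h + 1) inferInstance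
    fun z => or_congr_right (and_congr_right fun _ => exists_congr fun h => ?_)
  rw [and_iff_right_of_imp]
  grind

end Digits

instance {m : ℕ} (Q : M.Str) (f g : (Fin m → M.Num) → M.Num) [IsTermFun f] [IsTermFun g] :
    IsDefinable fun z => Q.mat (f z) (g z) = 0 :=
  .congr (p := fun z => ∀ b ≤ M.len Q, ¬Q.mat (f z) (g z) b) inferInstance fun z =>
    ⟨fun h => funext fun b => eq_false fun hb => h b (Str.le_len_of_row hb) hb,
      fun h b _ => by rw [h]; exact _root_.id⟩

instance {m : ℕ} (Q : M.Str) (f g h : (Fin m → M.Num) → M.Num) [IsTermFun f] [IsTermFun g]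
    [IsTermFun h] : IsDefinable fun z => Q.mat (f z) (g z) = Digits.negOnePow (h z) :=
  IsDefinable.eq_of_le (P := fun z => Q.mat (f z) (g z)) (R := fun z => Digits.negOnePow (h z))
    (M.len Q + 1) (fun _ _ hb => (Str.le_len_of_row hb).trans le_self_add)
    fun _ _ hb => hb.elim (fun h => h ▸ le_add_self) fun h => h.1 ▸ zero_le

namespace DigitMat

variable {n N k s s₀ s₁ d p i u v : M.Num} {Q : M.Str}

/-- The coefficient vector of the minor `s` has the entry `(-1) ^ v` at position `p`, followed by
zeros only. -/
def EndsWith (N : M.Num) (Q : M.Str) (v s p : M.Num) : Prop :=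
  Q.mat s p = Digits.negOnePow v ∧ ∀ i ≤ N + 1, p < i ∧ s + i ≤ N + 1 → Q.mat s i = 0

instance {m : ℕ} (N : M.Num) (Q : M.Str) (f g h : (Fin m → M.Num) → M.Num) [IsTermFun f]
    [IsTermFun g] [IsTermFun h] : IsDefinable fun z => EndsWith N Q (f z) (g z) (h z) := by
  unfold EndsWith
  infer_instance

theorem stageShift_eq_two (hk : k < 2 * s ∨ 2 * s + 2 < k) : stageShift k s = 2 :=
  if_neg (by grind)

theorem stageSign_eq_neg_one (hs : s < n) (hk : k < 2 * s ∨ 2 * s + 2 < k) :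
    stageSign n k s = -1 := by
  rw [stageSign, if_neg hs.not_ge, if_neg (by grind), if_neg (by grind)]

namespace IsRecursion

variable (hQ : IsRecursion n k N Q)
include hQ

theorem entry_eq (hd : s + d = N) (hd2 : 2 ≤ d) (hp : InRange p d) (h : EndsWith N Q v (s + 1) p)
    (hi : InRange i (d + 1)) (hr : ∀ r < p, toeplitz n k s i r = 0) :
    Q.mat s i = toeplitz n k s i p • Digits.negOnePow v := by
  obtain ⟨ε, hε⟩ := exists_negOnePow_eq v
  refine (isDot_iff_eq hp ?_ ?_ (fun U => ?_) fun r hr' hne U => ?_).1 (hQ.2 s d ⟨hd, hd2⟩ i hi)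
  · rw [hε]
    exact (isCoded_smul_one ε).smul
  · rw [hε]
    exact isInt_smul (isInt_smul_one ε)
  · rw [h.1, hε, smul_one_isIntMul_iff (isCoded_smul_one ε) (isInt_smul (isInt_smul_one ε))]
  · rcases hne.lt_or_gt with hlt | hlt
    · rw [hr r hlt, smul_one_isIntMul_iff (isCoded_mat Q _ _) isInt_zero, Digits.zero_smul]
    · rw [h.2 r (by grind [hr'.2]) ⟨hlt, by grind [hr'.2]⟩, ← Digits.zero_smul 1,
        isIntMul_smul_one_iff (isCoded_smul_one _) isInt_zero, Digits.zero_smul, Digits.zero_smul]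

theorem endsWith_of_stageSign_eq_zero (hs : s + 2 ≤ N) (hp : 1 ≤ p) (hpN : s + p ≤ N)
    (h0 : stageSign n k s = 0) (h : EndsWith N Q v (s + 1) p) : EndsWith N Q v s p := by
  obtain ⟨d, rfl⟩ := exists_add_of_le (le_self_add.trans hs)
  have hd2 := le_of_add_le_add_left hs
  have hpd : InRange p d := ⟨hp, le_of_add_le_add_left hpN⟩
  have toeplitz_eq_zero {i r : M.Num} (hir : i ≠ r) : toeplitz n k s i r = 0 := by
    rw [toeplitz, if_neg hir, h0, ite_self]
  refine ⟨?_, fun i _ ⟨hpi, _⟩ => ?_⟩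
  · rw [hQ.entry_eq rfl hd2 hpd h ⟨hp, hpd.2.trans le_self_add⟩ fun r hr => toeplitz_eq_zero hr.ne',
      toeplitz_self, Digits.one_smul]
  · rw [hQ.entry_eq rfl hd2 hpd h ⟨hp.trans hpi.le, by grind⟩
      fun r hr => toeplitz_eq_zero (hr.trans hpi).ne', toeplitz_eq_zero hpi.ne', Digits.zero_smul]

theorem endsWith_of_stageSign_ne_zero (hp : 1 ≤ p) (hpN : s + (p + stageShift k s) ≤ N + 1)
    (hs : s + 2 ≤ N) (hv : stageSign n k s • Digits.negOnePow v = Digits.negOnePow u)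
    (h : EndsWith N Q v (s + 1) p) : EndsWith N Q u s (p + stageShift k s) := by
  obtain ⟨d, rfl⟩ := exists_add_of_le (le_self_add.trans hs)
  have hd2 := le_of_add_le_add_left hs
  have hδ := two_le_stageShift k s
  have hpd : InRange p d := ⟨hp, by grind⟩
  have toeplitz_eq_zero {i r : M.Num} (hi : p + stageShift k s ≤ i) (hr : r < p) :
      toeplitz n k s i r = 0 := by
    rw [toeplitz, if_neg (by grind), if_neg (by grind)]
  refine ⟨?_, fun i _ ⟨hpi, _⟩ => ?_⟩
  · rw [hQ.entry_eq rfl hd2 hpd h ⟨by grind, by grind⟩ fun r hr => toeplitz_eq_zero le_rfl hr,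
      toeplitz, if_neg (by grind), if_pos rfl, hv]
  · rw [hQ.entry_eq rfl hd2 hpd h ⟨by grind, by grind⟩ fun r hr => toeplitz_eq_zero hpi.le hr,
      toeplitz, if_neg (by grind), if_neg (by grind), Digits.zero_smul]

theorem endsWith_of_le (hs : n ≤ s) (hsN : s < N) : EndsWith N Q 0 s 1 := by
  obtain ⟨u, hu⟩ := exists_add_of_le (Num.add_one_le_of_lt hsN)
  suffices ∀ s ≤ N, N = s + 1 + u → n ≤ s → EndsWith N Q 0 s 1 from this s hsN.le hu hs
  clear hs hsN hu
  induction u using Num.induction with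
  | definable => infer_instance
  | zero =>
    intro s _ hs _
    obtain ⟨one, two⟩ := hQ.1 s (by grind)
    refine ⟨?_, fun i _ hi => ?_⟩
    · rw [one, ← mul_zero 2, negOnePow_two_mul]
    · rwa [show i = 2 by rw [← one_add_one_eq_two]; grind]
  | succ u ih =>
    intro s _ hs hns
    exact hQ.endsWith_of_stageSign_eq_zero (by grind) le_rfl (by grind) (if_pos hns)
      (ih (s + 1) (by grind) (by grind) (by grind))

theorem endsWith_run (hp : 1 ≤ p) (hs₁ : s₁ ≤ n) (hs₁N : 2 * s₁ + p ≤ N + 1)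
    (hk : k < 2 * s₀ ∨ 2 * s₁ < k) (h : EndsWith N Q v s₁ p) (hu : s₀ + u = s₁) :
    EndsWith N Q (v + u) s₀ (p + 2 * u) := by
  suffices ∀ s ≤ s₁, s + u = s₁ → s₀ ≤ s → EndsWith N Q (v + u) s (p + 2 * u) from
    this s₀ (hu ▸ le_self_add) hu le_rfl
  clear hu
  induction u using Num.induction with
  | definable => infer_instance
  | zero =>
    intro s _ hs _
    rw [add_zero] at hs
    rwa [hs, add_zero, mul_zero, add_zero]
  | succ u ih =>
    intro s _ hs hs₀
    have hsk : k < 2 * s ∨ 2 * s + 2 < k := by grind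
    have shift := stageShift_eq_two hsk
    have := hQ.endsWith_of_stageSign_ne_zero (p := p + 2 * u) (u := v + (u + 1))
      (hp.trans le_self_add) (by grind) (by grind)
      (by rw [stageSign_eq_neg_one (by grind) hsk, Digits.neg_one_smul, ← add_assoc,
        negOnePow_add_one])
      (ih (s + 1) (by grind) (by grind) (by grind))
    rwa [shift, add_assoc, show 2 * u + 2 = 2 * (u + 1) by ring] at this

end IsRecursion

theorem IsRecursion.last_eq_of_odd {h a : M.Num}
    (hQ : IsRecursion (h + 1 + a) (2 * h + 1) (2 * (h + 1 + a)) Q) :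
    Q.mat 0 (2 * (h + 1 + a) + 1) = Digits.negOnePow (h + a) := by
  have before := hQ.endsWith_run (s₀ := h + 1) le_rfl le_rfl (by grind) (by grind)
    (hQ.endsWith_of_le le_rfl (by grind)) rfl
  have shift : stageShift (2 * h + 1) h = 2 := if_neg (by simp)
  have sign : stageSign (h + 1 + a) (2 * h + 1) h = 1 := by
    rw [stageSign, if_neg (by grind), if_pos rfl]
  have at_h := hQ.endsWith_of_stageSign_ne_zero le_self_add (by grind) (by grind)
    (by rw [sign, Digits.one_smul]) before
  have after := hQ.endsWith_run (s₀ := 0) (by grind) (by grind) (by grind) (by grind) at_h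
    (zero_add h)
  rw [shift] at after
  rw [show 2 * (h + 1 + a) + 1 = 1 + 2 * a + 2 + 2 * h by ring, after.1]
  congr 1
  ring

theorem IsRecursion.last_eq_of_even {h a : M.Num}
    (hQ : IsRecursion (h + 2 + a) (2 * h + 2) (2 * (h + 2 + a)) Q) :
    Q.mat 0 (2 * (h + 2 + a) + 1) = Digits.negOnePow (h + 1 + a) := by
  have before := hQ.endsWith_run (s₀ := h + 2) le_rfl le_rfl (by grind) (by grind)
    (hQ.endsWith_of_le le_rfl (by grind)) rfl
  have sign_zero : stageSign (h + 2 + a) (2 * h + 2) (h + 1) = 0 := by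
    rw [stageSign, if_neg (by grind), if_neg (by grind), if_pos (by ring)]
  have at_h_add_one := hQ.endsWith_of_stageSign_eq_zero (s := h + 1) (v := 0 + a)
    (p := 1 + 2 * a) (by grind) le_self_add (by grind) sign_zero
    (by rwa [show h + 1 + 1 = h + 2 from (Num.add_two h).symm])
  have shift : stageShift (2 * h + 2) h = 4 := if_pos rfl
  have sign : stageSign (h + 2 + a) (2 * h + 2) h = -1 := by
    rw [stageSign, if_neg (by grind), if_neg (by grind), if_neg (by grind)]
  have four_eq : (4 : M.Num) = 2 + 2 := by norm_num
  have at_h := hQ.endsWith_of_stageSign_ne_zero (u := a + 1) le_self_add (by grind) (by grind)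
    (by rw [sign, Digits.neg_one_smul, negOnePow_add_one, zero_add]) at_h_add_one
  have after := hQ.endsWith_run (s₀ := 0) (by grind) (by grind) (by grind) (by grind) at_h
    (zero_add h)
  rw [shift] at after
  rw [show 2 * (h + 2 + a) + 1 = 1 + 2 * a + 4 + 2 * h by ring, after.1]
  congr 1
  ring

theorem IsRecursion.last_eq (hk : 1 ≤ k) (hkn : k < 2 * n) (hQ : IsRecursion n k (2 * n) Q) :
    Q.mat 0 (2 * n + 1) = Digits.negOnePow (n + 1) := by
  obtain ⟨h, rfl | rfl⟩ := Num.exists_eq_two_mul_add hk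
  · obtain ⟨a, rfl⟩ : ∃ a, n = h + 1 + a := exists_add_of_le (by grind)
    rw [hQ.last_eq_of_odd, ← negOnePow_add_two]
    congr 1
    ring
  · obtain ⟨a, rfl⟩ : ∃ a, n = h + 2 + a := exists_add_of_le (by grind)
    rw [hQ.last_eq_of_even, ← negOnePow_add_two]
    congr 1
    ring

end DigitMat

/-! ### Existence of the Pfaffian -/

theorem Digits.IsDot.isInt {l : M.Num} {x y : M.Num → M.Digits} {R : M.Digits}
    (h : IsDot l x y R) : R.IsInt := by
  obtain ⟨T, T_zero, T_step, rfl⟩ := h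
  exact isInt_row_of_isIntAdd T_zero (fun r hr => (T_step r hr).elim fun U h => ⟨U.digits, h.2⟩)
    l le_rfl

theorem Num.mul_add_inj {D a a' r r' : M.Num} (hr : DigitMat.InRange r D)
    (hr' : DigitMat.InRange r' D) : a * D + r = a' * D + r' ↔ a = a' ∧ r = r' := by
  have not_lt {a a' r r' : M.Num} (hr : r ≤ D) (hr' : 1 ≤ r') (h : a * D + r = a' * D + r') :
      ¬a < a' := by
    intro hlt
    obtain ⟨c, rfl⟩ := exists_add_of_le (Num.add_one_le_of_lt hlt)
    have : 0 ≤ c * D := zero_le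
    rw [add_mul, add_mul, one_mul] at h
    grind
  refine ⟨fun h => ?_, by rintro ⟨rfl, rfl⟩; rfl⟩
  obtain rfl := le_antisymm (_root_.not_lt.1 (not_lt hr'.2 hr.1 h.symm))
    (_root_.not_lt.1 (not_lt hr.2 hr'.1 h))
  exact ⟨rfl, add_left_cancel h⟩

namespace DigitMat

variable {n k N t a i p q s : M.Num}

theorem IsPowSeq.isIntOn {X : M.DigitMat} {W : M.Str} {m : M.Num} (h : IsPowSeq m X t W)
    (hs : s ≤ t) : IsIntOn m m (W.matSeq s) := by
  intro i j hij
  rcases eq_or_ne s 0 with rfl | hs0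
  · rw [h.1 i j hij, id_eq_single]
    exact isInt_single i 1 j
  · obtain ⟨s, rfl⟩ := Num.exists_add_one_eq hs0
    exact (h.2 s (Num.add_one_le_iff.1 hs) i j hij).isInt

/-- The block matrix of size `N * (N + 1)` whose only nonzero blocks are the transposed Berkowitz
matrices of the minors `s`, those of size `(a + 2) × (a + 3)` with `s + (a + 2) = N` in the position
`(a, a + 1)`. -/
def IsTransferMat (n k N : M.Num) (X : M.DigitMat) : Prop :=
  ∀ s a i, s + (a + 2) = N → InRange i (a + 2 + 1) →
    (∀ r, InRange r (a + 2) →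
      X (a * (N + 1) + r) ((a + 1) * (N + 1) + i) = toeplitz n k s i r • 1) ∧
    ∀ p ≤ N * (N + 1), p ≤ a * (N + 1) ∨ a * (N + 1) + (a + 2) < p →
      X p ((a + 1) * (N + 1) + i) = 0

/-- The entry `(p, q)` of the transfer matrix lies in a nonzero block and equals `ε`. -/
def IsTransferEntry (n k N p q : M.Num) (ε : SignType) : Prop :=
  ∃ s ≤ N, ∃ a ≤ N, ∃ r ≤ N, ∃ i ≤ N + 1, s + (a + 2) = N ∧ (1 ≤ r ∧ r ≤ a + 2) ∧
    (1 ≤ i ∧ i ≤ a + 2 + 1) ∧ p = a * (N + 1) + r ∧ q = (a + 1) * (N + 1) + i ∧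
    toeplitz n k s i r = ε

instance (n k N : M.Num) (ε : SignType) : IsDefinable₂ fun p q => IsTransferEntry n k N p q ε := by
  unfold IsTransferEntry
  infer_instance

theorem isTransferEntry_iff {ε : SignType} (hs : s + (a + 2) = N) (hi : InRange i (a + 2 + 1)) :
    IsTransferEntry n k N p ((a + 1) * (N + 1) + i) ε ↔
      ∃ r, InRange r (a + 2) ∧ p = a * (N + 1) + r ∧ toeplitz n k s i r = ε := by
  constructor
  · rintro ⟨s', -, a', -, r, -, i', -, hs', hr, hi', rfl, hq, h⟩
    obtain ⟨ha, rfl⟩ := (Num.mul_add_inj ⟨hi.1, by grind [hi.2]⟩ ⟨hi'.1, by grind⟩).1 hq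
    obtain rfl := add_right_cancel ha
    obtain rfl := add_right_cancel (hs.trans hs'.symm)
    exact ⟨r, hr, rfl, h⟩
  · rintro ⟨r, hr, rfl, h⟩
    exact ⟨s, by grind, a, by grind, r, by grind [hr.2], i, by grind [hi.2], hs, hr, hi, rfl, rfl,
      h⟩

theorem IsTransferEntry.unique {ε δ : SignType} (hε : IsTransferEntry n k N p q ε)
    (hδ : IsTransferEntry n k N p q δ) : ε = δ := by
  obtain ⟨s, -, a, -, r, -, i, -, hs, hr, hi, rfl, rfl, rfl⟩ := hε
  obtain ⟨r', hr', eq, rfl⟩ := (isTransferEntry_iff hs hi).1 hδ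
  rw [((Num.mul_add_inj ⟨hr.1, by grind⟩ ⟨hr'.1, by grind [hr'.2]⟩).1 eq).2]

theorem mul_add_le_of_le (ha : a + 1 ≤ N) (hi : i ≤ N + 1) :
    a * (N + 1) + i ≤ N * (N + 1) :=
  calc a * (N + 1) + i ≤ a * (N + 1) + (N + 1) := by gcongr
    _ = (a + 1) * (N + 1) := by ring
    _ ≤ N * (N + 1) := by gcongr

theorem exists_isTransferMat (n k N : M.Num) : ∃ X : M.Str,
    IsIntOn (N * (N + 1)) (N * (N + 1)) X.mat ∧ IsTransferMat n k N X.mat := by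
  obtain ⟨X, hX⟩ := Str.exists_mat_eq_smul_one_of_rel (IsTransferEntry n k N)
    (fun _ _ _ _ => IsTransferEntry.unique) (N * (N + 1)) (N * (N + 1))
  refine ⟨X, fun p q hpq => ?_, fun s a i hs hi => ?_⟩
  · obtain ⟨eq_smul, eq_zero⟩ := hX p hpq.1.2 q hpq.2.2
    by_cases h : ∃ ε, IsTransferEntry n k N p q ε
    · obtain ⟨ε, hε⟩ := h
      exact eq_smul ε hε ▸ isInt_smul_one ε
    · exact eq_zero (not_exists.1 h) ▸ isInt_zero
  · have col_le : (a + 1) * (N + 1) + i ≤ N * (N + 1) :=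
      mul_add_le_of_le (by grind) (by grind [hi.2])
    refine ⟨fun r hr => ?_, fun p hp outside => ?_⟩
    · have row_le : a * (N + 1) + r ≤ N * (N + 1) :=
        mul_add_le_of_le (by grind) (by grind [hr.2])
      exact (hX _ row_le _ col_le).1 _ ((isTransferEntry_iff hs hi).2 ⟨r, hr, rfl, rfl⟩)
    · refine (hX p hp _ col_le).2 fun ε hε => ?_
      obtain ⟨r, ⟨hr, hr'⟩, rfl, -⟩ := (isTransferEntry_iff hs hi).1 hε
      grind

theorem IsPowSeq.isDot_of_isTransferMat {X : M.DigitMat} {W : M.Str}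
    (hW : IsPowSeq (N * (N + 1)) X t W) (hX : IsTransferMat n k N X) (hs : s + (a + 2) = N)
    (hat : a < t) (hi : InRange i (a + 2 + 1)) :
    IsDot (a + 2) (fun r => toeplitz n k s i r • 1) (fun r => W.matSeq a 1 (a * (N + 1) + r))
      (W.matSeq (a + 1) 1 ((a + 1) * (N + 1) + i)) := by
  obtain ⟨inside, outside⟩ := hX s a i hs hi
  have inRange {b j : M.Num} (hb : b + 1 ≤ N) (hj : InRange j (N + 1)) :
      InRange (b * (N + 1) + j) (N * (N + 1)) :=
    ⟨hj.1.trans le_add_self, mul_add_le_of_le hb hj.2⟩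
  have one_inRange : InRange 1 (N * (N + 1)) := by
    simpa only [zero_mul, zero_add] using
      inRange (b := 0) (j := 1) (by grind) ⟨le_rfl, le_add_self⟩
  have dot := hW.2 a hat 1 _
    ⟨one_inRange, inRange (b := a + 1) (by grind) ⟨hi.1, by grind [hi.2]⟩⟩
  refine dot.of_window (o := a * (N + 1)) (mul_add_le_of_le (by grind) (by grind))
    (fun r hr U hU => ?_) fun q hq hqo U hU => ?_
  · have isInt := isInt_smul (s := toeplitz n k s i r) (hW.isIntOn hat.le 1 _
      ⟨one_inRange, inRange (b := a) (by grind) ⟨hr.1, by grind [hr.2]⟩⟩)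
    rw [inside r hr, isIntMul_smul_one_iff (isCoded_matSeq W _ _ _) isInt] at hU
    exact (smul_one_isIntMul_iff (isCoded_matSeq W _ _ _) isInt).2 hU
  · rw [outside q hq.2 hqo, ← Digits.zero_smul 1,
      isIntMul_smul_one_iff (isCoded_matSeq W _ _ _) isInt_zero] at hU
    rw [hU, Digits.zero_smul]

/-- The coefficient vector of the minor `s` with `s + (a + 1) = N` is found in the block `a` of the
first row of the `a`-th power of the transfer matrix. -/
theorem exists_isRecursion (hN : 1 ≤ N) : ∃ Q, IsRecursion n k N Q := by
  obtain ⟨X, isIntOn_X, hX⟩ := exists_isTransferMat n k N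
  obtain ⟨t, ht⟩ := Num.exists_add_one_eq (zero_lt_one.trans_le hN).ne'
  obtain ⟨Y, hY⟩ := exists_isPow t isIntOn_X
  obtain ⟨W, hW, -⟩ := isPow_iff.1 hY
  obtain ⟨Q, hQ⟩ := Str.exists_mat_eq (fun s i b => ∃ a ≤ N, s + (a + 1) = N ∧
    W.row (Num.pair (Num.pair a 1) (a * (N + 1) + i)) b) N (N + 1) (M.len W)
    fun _ _ _ _ _ ⟨_, _, _, h⟩ => Str.le_len_of_row h
  have Q_eq (s a i : M.Num) (hs : s + (a + 1) = N) (hi : i ≤ N + 1) :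
      Q.mat s i = W.matSeq a 1 (a * (N + 1) + i) := by
    rw [hQ s (by grind) i hi]
    refine funext fun b => propext ⟨?_, fun h => ⟨a, by grind, hs, h⟩⟩
    rintro ⟨a', -, hs', h⟩
    obtain rfl := add_right_cancel (add_left_cancel (hs.trans hs'.symm))
    exact h
  refine ⟨Q, fun s hs => ?_, fun s d ⟨hs, hd⟩ i hi => ?_⟩
  · have size : 1 + 1 ≤ N * (N + 1) :=
      (add_le_add_left hN 1).trans (le_mul_of_one_le_left zero_le hN)
    have one_inRange : InRange 1 (N * (N + 1)) := ⟨le_rfl, le_add_self.trans size⟩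
    have two_inRange : InRange (1 + 1) (N * (N + 1)) := ⟨le_add_self, size⟩
    rw [← one_add_one_eq_two, Q_eq s 0 1 (by rwa [zero_add]) le_add_self,
      Q_eq s 0 (1 + 1) (by rwa [zero_add]) (add_le_add_left hN 1), zero_mul, zero_add, zero_add,
      hW.1 _ _ ⟨one_inRange, one_inRange⟩, hW.1 _ _ ⟨one_inRange, two_inRange⟩, id_eq_single,
      id_eq_single, single_self, single_of_ne (by simp), Digits.one_smul]
    exact ⟨rfl, rfl⟩
  · obtain ⟨a, rfl⟩ := exists_add_of_le hd
    rw [add_comm 2 a] at hs hi ⊢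
    rw [Q_eq s (a + 1) i (by rw [← hs]; ring) (by grind [hi.2])]
    exact (hW.isDot_of_isTransferMat hX hs (by grind) hi).congr (fun _ _ => rfl) fun r hr =>
      (Q_eq (s + 1) a r (by rw [← hs]; ring) (by grind [hr.2])).symm

end DigitMat

theorem sat_pfaffianBlockSwap_of_model (v : ℕ → M.Num) (w : ℕ → M.Str) :
    pfaffianBlockSwap.Sat M v w := by
  refine (sat_pfaffianBlockSwap v w).2 fun n k ⟨hk, hkn⟩ =>
    ⟨DigitMat.exists_eqOn_blockSwap hk hkn _, fun A hA => ?_⟩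
  simp only [DigitMat.isPfaffian_iff hA hk hkn]
  constructor
  · obtain ⟨Q, hQ⟩ := DigitMat.exists_isRecursion (n := n) (k := k) (hk.trans hkn.le)
    obtain ⟨Z, hZ⟩ := isCoded_mat Q 0 (2 * n + 1)
    exact ⟨Z, Q, hQ, hZ⟩
  · rintro Z ⟨Q, hQ, hZ⟩
    rw [hZ, hQ.last_eq hk hkn]

end BoundedArith.TwoSorted

theorem mainTheorem10 :
    BoundedArith.Proves.{u} BoundedArith.VSharpL BoundedArith.pfaffianBlockSwap := by
  intro M hM v w
  have : BoundedArith.TwoSorted.VSharpLModel M := ⟨hM⟩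
  exact BoundedArith.TwoSorted.sat_pfaffianBlockSwap_of_model v w
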